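/- **Setting.** For sequences $x\in\mathbb C^{\mathbb Z}$ let $[\Delta x]_t=x_{t-1}$, $[u*v]_t=\sum_{\tau\in\mathbb Z}u_\tau v_{t-\tau}$, $\mathbb C(\mathbb Z_{a,b})=\{u: u_t=0 \text{ for } t\notin[a,b]\}$, $\|x\|_{n,2}=\big(\sum_{t=0}^n|x_t|^2\big)^{1/2}$, and let $\|x\|^F_{n,1}$ be the $\ell_1$-norm of the unitary discrete Fourier transform $\big((n+1)^{-1/2}\sum_{t=0}^n x_te^{2\pi i jt/(n+1)}\big)_{0\le j\le n}$ of $(x_0,\dots,x_n)$. One observes $y_t=x_t+\sigma\zeta_t$, where $\sigma>0$ and the $\zeta_t$, $t\in\mathbb Z$, are i.i.d. with the law of $\xi^1+i\xi^2$ for independent $\xi^1,\xi^2\sim\mathcal N(0,1)$. The signal $x$ is *$(m,n,k_0,\varrho)$-interpolable*, where $\varrho\ge1$ and $0\le k_0\le m$, if there is a filter $\varphi\in\mathbb C(\mathbb Z_{-k_0,m-k_0})$ with $\mathbf E|x_t-[\varphi*y]_t|^2\le \frac{\varrho\sigma^2}{m+1}$ for all $-m-k_0\le t\le n-k_0$.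 *Assumption 1* (with parameters $s$ and $\varkappa\ge0$): $x=x^{\mathcal S}+\varepsilon$, where $x^{\mathcal S}$ belongs to a shift-invariant ($\Delta\mathcal S\subseteq\mathcal S$) complex linear subspace $\mathcal S$ of $\mathbb C^{\mathbb Z}$ of dimension $s$, $1\le s\le n+1$, and $\|\Delta^\tau\varepsilon\|_{n,2}\le\varkappa\sigma$ for all $0\le\tau\le n$. The *$k$-interpolating constrained least-squares estimator* of $x$ is $\widehat\varphi*y$, where $\widehat\varphi$ is any minimizer of $\|\Delta^k[y-\varphi*y]\|_{n,2}^2$ over all $\varphi\in\mathbb C(\mathbb Z_{-k,n-k})$ with $\|\Delta^k\varphi\|^F_{n,1}\le\overline\varrho/\sqrt{n+1}$. **Proposition.** There is an absolute constant $C>0$ such that the following holds. Let $m\ge1$, $n=2m$, let $x$ be $(m,n,k_0,\varrho)$-interpolable, and let Assumption 1 hold. Let $\widehat\varphi$ be as above with $\overline\varrho=2\varrho$ and $k=2k_0$. Then for every $\alpha\in(0,1)$ there is a set $\Xi_\alpha$ of realizations of the noise $\zeta$ with $\mathbb P\{\zeta\in\Xi_\alpha\}\ge1-\alpha$ such that,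 whenever $\zeta\in\Xi_\alpha$, every such $\widehat\varphi$ satisfies $$\big\|\Delta^{2k_0}[x-\widehat\varphi*y]\big\|_{n,2}^2\le C\sigma^2\big[\varrho^2(1+\ln(1/\alpha))+E_0\big],$$ $$\big|[x-\widehat\varphi*y]_t\big|^2\le C\,\frac{\sigma^2\varrho}{n+1}\big[\varrho^2(1+\ln(1/\alpha))+E_0\big]\quad\text{for all integers } t\in[m-3k_0,\,n-3k_0],$$ where $$E_0=\varrho\ln\frac{2n}{\alpha}+\varrho\varkappa\sqrt{\ln\frac{16}{\alpha}}+s.$$ -/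

import Mathlib

open MeasureTheory ProbabilityTheory

namespace SignalDenoising

/-- Two-sided complex sequences, the space `ℂ(ℤ)`. -/
abbrev Signal : Type := ℤ → ℂ

/-- The shift `Δ^k`, where `(Δ x)_t = x_{t-1}`; `k` may be any integer. -/
def shift (k : ℤ) (x : Signal) : Signal := fun t => x (t - k)

/-- The convolution `(u * v)_t = ∑_{τ ∈ ℤ} u_τ v_{t-τ}`. It is used only for a finitely
supported `u`, so that the sum has finitely many nonzero terms. -/
noncomputable def conv (u v : Signal) : Signal := fun t => ∑' τ : ℤ, u τ * v (t - τ)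

/-- `u` belongs to `ℂ(ℤ_{a,b})`, i.e. `u_t = 0` for `t ∉ [a, b]`. -/
def SupportedOn (a b : ℤ) (u : Signal) : Prop := ∀ t : ℤ, t ∉ Set.Icc a b → u t = 0

/-- `‖x‖_{n,2}`, the Euclidean norm of `(x_0, …, x_n)`. -/
noncomputable def l2Norm (n : ℕ) (x : Signal) : ℝ :=
  Real.sqrt (∑ t ∈ Finset.range (n + 1), ‖x (t : ℤ)‖ ^ 2)

/-- The `k`-th entry of the unitary discrete Fourier transform of `(x_0, …, x_n)`. -/
noncomputable def dft (n : ℕ) (x : Signal) (k : ℕ) : ℂ :=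
  ((Real.sqrt ((n : ℝ) + 1))⁻¹ : ℂ) *
    ∑ t ∈ Finset.range (n + 1),
      x (t : ℤ) * Complex.exp (2 * Real.pi * Complex.I * (k : ℂ) * (t : ℂ) / ((n : ℂ) + 1))

/-- `‖x‖^F_{n,1}`, the `ℓ₁`-norm of the unitary discrete Fourier transform of
`(x_0, …, x_n)`. -/
noncomputable def fourierL1Norm (n : ℕ) (x : Signal) : ℝ :=
  ∑ k ∈ Finset.range (n + 1), ‖dft n x k‖

/-- The law of `ξ₁ + i ξ₂` with `ξ₁, ξ₂` independent real standard normal. -/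
noncomputable def stdComplexGaussian : Measure ℂ :=
  ((gaussianReal 0 1).prod (gaussianReal 0 1)).map
    (fun p : ℝ × ℝ => (p.1 : ℂ) + (p.2 : ℂ) * Complex.I)

/-- `ζ = (ζ_t)_{t ∈ ℤ}` is a sequence of i.i.d. standard complex Gaussian variables. -/
structure IsStdComplexNoise {Ω : Type*} [MeasurableSpace Ω] (P : Measure Ω)
    (ζ : ℤ → Ω → ℂ) : Prop where
  measurable : ∀ t, Measurable (ζ t)
  indep : iIndepFun ζ P
  law : ∀ t, P.map (ζ t) = stdComplexGaussian

/-- The observations `y_t = x_t + σ z_t` for a noise realization `z`. -/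
def observe (x : Signal) (σ : ℝ) (z : Signal) : Signal := fun t => x t + (σ : ℂ) * z t

/-- `x` is `(m, n, k, ρ)`-interpolable: `ρ ≥ 1`, `0 ≤ k ≤ m`, and some filter
`φ ∈ ℂ(ℤ_{-k,m-k})` satisfies `E |x_t - (φ * y)_t|² ≤ ρ σ² / (m + 1)` for all
`-m - k ≤ t ≤ n - k`. -/
def Interpolable {Ω : Type*} [MeasurableSpace Ω] (P : Measure Ω) (ζ : ℤ → Ω → ℂ) (σ : ℝ)
    (m n k : ℕ) (ρ : ℝ) (x : Signal) : Prop :=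
  1 ≤ ρ ∧ k ≤ m ∧
    ∃ φ : Signal, SupportedOn (-(k : ℤ)) ((m : ℤ) - k) φ ∧
      ∀ t : ℤ, -(m : ℤ) - k ≤ t → t ≤ (n : ℤ) - k →
        ∫ ω, ‖x t - conv φ (observe x σ (fun u => ζ u ω)) t‖ ^ 2 ∂P
          ≤ ρ * σ ^ 2 / ((m : ℝ) + 1)

/-- Closeness of `x` to a shift-invariant subspace, for filters of bandwidth `m` and
validation length `n`: `x = xS + ε`, where `xS` lies in an `s`-dimensional complex subspace
`S` of `ℂ(ℤ)` with `Δ S ⊆ S`, `1 ≤ s ≤ n + 1`, and `‖Δ^τ ε‖_{n,2} ≤ κ σ` for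
`0 ≤ τ ≤ m`. -/
def NearShiftInvariant (m n : ℕ) (σ : ℝ) (s : ℕ) (κ : ℝ) (x : Signal) : Prop :=
  1 ≤ s ∧ s ≤ n + 1 ∧ 0 ≤ κ ∧
    ∃ S : Submodule ℂ Signal,
      (∀ u ∈ S, shift 1 u ∈ S) ∧ Module.finrank ℂ S = s ∧
      ∃ xS ε : Signal, xS ∈ S ∧ x = xS + ε ∧
        ∀ τ : ℕ, τ ≤ m → l2Norm n (shift τ ε) ≤ κ * σ

/-- The feasible set of the `k`-interpolating constrained least-squares problem. -/
def feasibleFilters (n k : ℕ) (ρbar : ℝ) : Set Signal :=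
  {φ | SupportedOn (-(k : ℤ)) ((n : ℤ) - k) φ ∧
    fourierL1Norm n (shift k φ) ≤ ρbar / Real.sqrt ((n : ℝ) + 1)}

/-- `φ` is an optimal solution of the `k`-interpolating constrained least-squares problem
with observations `y`. -/
def IsInterpolatingLS (n k : ℕ) (ρbar : ℝ) (y φ : Signal) : Prop :=
  φ ∈ feasibleFilters n k ρbar ∧
    ∀ ψ ∈ feasibleFilters n k ρbar,
      l2Norm n (shift k (y - conv φ y)) ^ 2 ≤ l2Norm n (shift k (y - conv ψ y)) ^ 2

/-- The remainder term for filters of bandwidth `m` and validation length `n`; here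
`(n + 1) / (m + 1)` is the squared skewness factor, equal to `1` when `m = n`. -/
noncomputable def remainder (m n : ℕ) (ρ : ℝ) (s : ℕ) (κ α : ℝ) : ℝ :=
  ρ * (((n : ℝ) + 1) / ((m : ℝ) + 1)) * Real.log (((m : ℝ) + n) / α)
    + ρ * κ * Real.sqrt (Real.log (16 / α)) + s

end SignalDenoising

namespace SignalDenoising

open scoped ComplexConjugate ENNReal

/-! The proof compares the estimator with one competitor and makes every noise term uniform over
feasible filters. The bias-variance identity gives the interpolating filter `φ` small energy,
2(m+1)‖φ‖² ≤ ρ, and pointwise bias at most (ρσ²/(m+1))^(1/2). The competitor is `φ * φ`. It is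
supported on [-2k₀, n-2k₀], and the moduli of its Fourier coefficients are √(n+1) times the squared
moduli of those of `φ`. By Parseval its Fourier ℓ₁-norm is therefore √(n+1)‖φ‖², which makes it
feasible. Its bias is u + φ * u with u = x - φ * x, hence still small.

Write d = x - φhat * y and d₀ = x - φ * φ * y on the window. Optimality gives ‖d‖² ≤ ‖d₀‖² + 2σ|⟨z,
d₀⟩| + 2σ|⟨z, d⟩|. The last term is the hard one, because φhat depends on z. Split z along V, the
windowed copy of `S`. The part in V has squared norm of order s + ln(1/α) and is absorbed by the
quadratic term. Off V, the component (1 - φhat) * xS disappears because `S` is shift-invariant,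
which leaves ε - φhat * ε and σ φhat * z. The product with φhat * ε is expanded over shifts of ε and
bounded by Cauchy-Schwarz, since ‖φhat‖² ≤ 4ρ²/(n+1). For φhat * z, a feasible filter is a
combination of n+1 fixed Fourier atoms with coefficients of total modulus at most 2ρ/√(n+1). It then
suffices to control n+1 fixed Gaussian quadratic forms by a union bound, which costs the logarithm
of n. Their trace after projection off V contributes ρ√s, hence ρ² + s.

The probabilistic input is `lintegral_exp_sum_inner_sq_div_le` and `lintegral_exp_sum_inner_sq_le`
for squared linear forms, and `lintegral_exp_quadratic_le` for quadratic forms, obtained by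
decoupling through a rotation. The risk bound is `l2_risk_le`.

The pointwise bound writes the error e = x - φhat * y as φ * e plus (1 - φ) * e
(`sub_conv_observe_decomposition`). The first summand is an average of the ℓ₂-error with weight ‖φ‖²
≤ ρ/(n+1). The second consists of a filtered bias and two filtered noises. -/

/-! ### Moments of the complex Gaussian on the line -/

lemma measurable_ofReal_add_mul_I :
    Measurable (fun p : ℝ × ℝ => (p.1 : ℂ) + (p.2 : ℂ) * Complex.I) := by fun_prop

instance : IsProbabilityMeasure stdComplexGaussian :=
  Measure.isProbabilityMeasure_map measurable_ofReal_add_mul_I.aemeasurable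

instance : IsGaussian stdComplexGaussian := by
  let L : ℝ × ℝ →L[ℝ] ℂ :=
    Complex.ofRealCLM.comp (ContinuousLinearMap.fst ℝ ℝ ℝ)
      + (ContinuousLinearMap.mul ℝ ℂ).flip Complex.I ∘L
        Complex.ofRealCLM.comp (ContinuousLinearMap.snd ℝ ℝ ℝ)
  exact isGaussian_map (μ := (gaussianReal 0 1).prod (gaussianReal 0 1)) L

lemma integral_exp_mul_gaussianReal (c : ℝ) :
    ∫ x, Real.exp (c * x) ∂(gaussianReal 0 1) = Real.exp (c ^ 2 / 2) := by
  have h := congrFun (mgf_id_gaussianReal (μ := 0) (v := 1)) c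
  simpa [mgf] using h

lemma integral_exp_sq_gaussianReal :
    ∫ x, Real.exp (x ^ 2 / 4) ∂(gaussianReal 0 1) = Real.sqrt 2 := by
  rw [integral_gaussianReal_eq_integral_smul one_ne_zero]
  have h : ∀ x : ℝ, gaussianPDFReal 0 1 x • Real.exp (x ^ 2 / 4)
      = (Real.sqrt (2 * Real.pi))⁻¹ * Real.exp (-(1 / 4) * x ^ 2) := by
    intro x
    rw [gaussianPDFReal_def, smul_eq_mul]
    simp only [NNReal.coe_one, mul_one, sub_zero]
    rw [mul_assoc, ← Real.exp_add]
    congr 2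
    ring
  simp_rw [h]
  rw [integral_const_mul, integral_gaussian, ← Real.sqrt_inv, ← Real.sqrt_mul (by positivity)]
  congr 1
  field_simp
  norm_num

lemma integral_exp_re_mul_stdComplexGaussian (c : ℂ) :
    ∫ z, Real.exp ((c * z).re) ∂stdComplexGaussian = Real.exp (‖c‖ ^ 2 / 2) := by
  rw [stdComplexGaussian, integral_map measurable_ofReal_add_mul_I.aemeasurable
    (by fun_prop)]
  have h : ∀ p : ℝ × ℝ, Real.exp ((c * ((p.1 : ℂ) + (p.2 : ℂ) * Complex.I)).re)
      = Real.exp (c.re * p.1) * Real.exp (-c.im * p.2) := by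
    intro p
    rw [← Real.exp_add]
    congr 1
    simp
    ring
  simp_rw [h]
  rw [integral_prod_mul (fun x => Real.exp (c.re * x)) (fun x => Real.exp (-c.im * x)),
    integral_exp_mul_gaussianReal, integral_exp_mul_gaussianReal, ← Real.exp_add,
    Complex.sq_norm, Complex.normSq_apply]
  congr 1
  ring

/-- Each real coordinate contributes √2 at the exponent 1/4. The resulting 2 per complex coordinate
is the source of the factor 2 in log(2/δ) and of the power of 2 in the projection bound. -/
lemma integral_exp_norm_sq_stdComplexGaussian :
    ∫ z, Real.exp (‖z‖ ^ 2 / 4) ∂stdComplexGaussian = 2 := by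
  rw [stdComplexGaussian, integral_map measurable_ofReal_add_mul_I.aemeasurable
    (by fun_prop)]
  have h : ∀ p : ℝ × ℝ, Real.exp (‖(p.1 : ℂ) + (p.2 : ℂ) * Complex.I‖ ^ 2 / 4)
      = Real.exp (p.1 ^ 2 / 4) * Real.exp (p.2 ^ 2 / 4) := by
    intro p
    rw [← Real.exp_add, Complex.sq_norm, Complex.normSq_apply]
    congr 1
    simp
    ring
  simp_rw [h]
  rw [integral_prod_mul (fun x => Real.exp (x ^ 2 / 4)) (fun x => Real.exp (x ^ 2 / 4)),
    integral_exp_sq_gaussianReal]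
  norm_num

lemma integral_id_stdComplexGaussian : ∫ z, z ∂stdComplexGaussian = 0 := by
  have hi : Integrable (fun z : ℂ => z) stdComplexGaussian := IsGaussian.integrable_id
  rw [stdComplexGaussian, integral_map measurable_ofReal_add_mul_I.aemeasurable
    (by fun_prop)]
  have h1 : Integrable (fun x : ℝ => x) (gaussianReal 0 1) := IsGaussian.integrable_id
  have hf : Integrable (fun p : ℝ × ℝ => (p.1 : ℂ))
      ((gaussianReal 0 1).prod (gaussianReal 0 1)) := (h1.comp_fst _).ofReal
  have hs : Integrable (fun p : ℝ × ℝ => (p.2 : ℂ) * Complex.I)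
      ((gaussianReal 0 1).prod (gaussianReal 0 1)) := (h1.comp_snd _).ofReal.mul_const _
  rw [integral_add hf hs, integral_mul_const, integral_complex_ofReal, integral_complex_ofReal,
    integral_fun_fst (fun x : ℝ => x), integral_fun_snd (fun x : ℝ => x)]
  simp

/-- Both coordinates have variance 1, so the second moment is 2 rather than 1. This is the factor 2
in front of traces and of the variance of a filter. -/
lemma integral_norm_sq_stdComplexGaussian : ∫ z, ‖z‖ ^ 2 ∂stdComplexGaussian = 2 := by
  rw [stdComplexGaussian, integral_map measurable_ofReal_add_mul_I.aemeasurable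
    (by fun_prop)]
  have h : ∀ p : ℝ × ℝ, ‖(p.1 : ℂ) + (p.2 : ℂ) * Complex.I‖ ^ 2 = p.1 ^ 2 + p.2 ^ 2 := by
    intro p
    rw [Complex.sq_norm, Complex.normSq_apply]
    simp
    ring
  simp_rw [h]
  have h1 : Integrable (fun x : ℝ => x ^ 2) (gaussianReal 0 1) :=
    (IsGaussian.memLp_two_id (μ := gaussianReal 0 1)).integrable_sq
  have hv : ∫ x, x ^ 2 ∂(gaussianReal 0 1) = 1 := by
    have := variance_fun_id_gaussianReal (μ := 0) (v := 1)
    rw [variance_of_integral_eq_zero (by fun_prop) (by simp)] at this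
    simpa using this
  rw [integral_add (h1.comp_fst _) (h1.comp_snd _), integral_fun_fst (fun x : ℝ => x ^ 2),
    integral_fun_snd (fun x : ℝ => x ^ 2), hv]
  simp
  norm_num

/-- The law of a vector of i.i.d. standard complex Gaussian variables, on Euclidean space. -/
noncomputable def complexGaussian (ι : Type*) [Fintype ι] : Measure (EuclideanSpace ℂ ι) :=
  (Measure.pi fun _ : ι => stdComplexGaussian).map (WithLp.toLp 2)

/-! ### Gaussian vectors with independent complex coordinates -/

section Vector

variable {ι : Type*} [Fintype ι]

lemma measurable_toLp_complex {ι : Type*} : Measurable (WithLp.toLp 2 : (ι → ℂ) → EuclideanSpace ℂ ι) := by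
  fun_prop

instance : IsProbabilityMeasure (complexGaussian ι) :=
  Measure.isProbabilityMeasure_map measurable_toLp_complex.aemeasurable

/-- Gaussianity as a real vector, together with mean zero, yields the invariance of the product law
under rotations used for decoupling. -/
instance : IsGaussian (complexGaussian ι) := by
  have h : ∀ i : ι, HasGaussianLaw (fun z : ι → ℂ => z i)
      (Measure.pi fun _ : ι => stdComplexGaussian) := by
    intro i
    constructor
    rw [(measurePreserving_eval (fun _ : ι => stdComplexGaussian) i).map_eq]
    infer_instance
  have hind : iIndepFun (fun (i : ι) (z : ι → ℂ) => z i)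
      (Measure.pi fun _ : ι => stdComplexGaussian) :=
    iIndepFun_pi (X := fun _ => id) (fun _ => aemeasurable_id)
  exact ((iIndepFun.hasGaussianLaw h hind).toLp_pi 2).isGaussian_map

lemma integral_complexGaussian {E : Type*} [NormedAddCommGroup E] [NormedSpace ℝ E]
    {f : EuclideanSpace ℂ ι → E} (hf : AEStronglyMeasurable f (complexGaussian ι)) :
    ∫ z, f z ∂complexGaussian ι
      = ∫ z, f (WithLp.toLp 2 z) ∂(Measure.pi fun _ : ι => stdComplexGaussian) :=
  integral_map measurable_toLp_complex.aemeasurable hf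

lemma integral_exp_re_inner_complexGaussian (a : EuclideanSpace ℂ ι) :
    ∫ z, Real.exp (inner ℂ a z).re ∂complexGaussian ι = Real.exp (‖a‖ ^ 2 / 2) := by
  rw [integral_complexGaussian (by fun_prop)]
  have h : ∀ z : ι → ℂ, Real.exp (inner ℂ a (WithLp.toLp 2 z : EuclideanSpace ℂ ι)).re
      = ∏ i, Real.exp ((conj (a i) * z i).re) := by
    intro z
    rw [← Real.exp_sum, PiLp.inner_apply, Complex.re_sum]
    simp [mul_comm]
  simp_rw [h]
  rw [integral_fintype_prod_eq_prod (f := fun i x => Real.exp ((conj (a i) * x).re))]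
  simp_rw [integral_exp_re_mul_stdComplexGaussian]
  rw [← Real.exp_sum, EuclideanSpace.norm_sq_eq, Finset.sum_div]
  simp

lemma integrable_exp_re_inner_complexGaussian (a : EuclideanSpace ℂ ι) :
    Integrable (fun z => Real.exp (inner ℂ a z).re) (complexGaussian ι) := by
  -- A non-integrable function would have Bochner integral 0, whereas the product formula gives a
  -- positive value.
  by_contra h
  have := integral_exp_re_inner_complexGaussian a
  rw [integral_undef h] at this
  exact (Real.exp_pos _).ne this

lemma integral_exp_norm_sq_complexGaussian :
    ∫ z, Real.exp (‖z‖ ^ 2 / 4) ∂complexGaussian ι = 2 ^ Fintype.card ι := by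
  rw [integral_complexGaussian (by fun_prop)]
  have h : ∀ z : ι → ℂ, Real.exp (‖(WithLp.toLp 2 z : EuclideanSpace ℂ ι)‖ ^ 2 / 4)
      = ∏ i, Real.exp (‖z i‖ ^ 2 / 4) := by
    intro z
    rw [← Real.exp_sum, EuclideanSpace.norm_sq_eq, Finset.sum_div]
  simp_rw [h]
  rw [integral_fintype_prod_eq_prod (f := fun i x => Real.exp (‖x‖ ^ 2 / 4))]
  simp [integral_exp_norm_sq_stdComplexGaussian]

lemma integrable_exp_norm_sq_complexGaussian :
    Integrable (fun z => Real.exp (‖z‖ ^ 2 / 4)) (complexGaussian ι) := by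
  by_contra h
  have := integral_exp_norm_sq_complexGaussian (ι := ι)
  rw [integral_undef h] at this
  have : (0 : ℝ) < 2 ^ Fintype.card ι := by positivity
  linarith

lemma integral_coord_complexGaussian (i : ι) : ∫ z, z i ∂complexGaussian ι = 0 := by
  rw [integral_complexGaussian (f := fun z => z i) (by fun_prop)]
  exact (integral_comp_eval (μ := fun _ : ι => stdComplexGaussian) (i := i) (f := fun z : ℂ => z)
    (by fun_prop)).trans integral_id_stdComplexGaussian

lemma integral_id_complexGaussian : ∫ z, id z ∂complexGaussian ι = 0 := by
  ext i
  have := (ContinuousLinearMap.integral_comp_comm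
    ((EuclideanSpace.proj i : EuclideanSpace ℂ ι →L[ℂ] ℂ).restrictScalars ℝ)
    (IsGaussian.integrable_id (μ := complexGaussian ι))).symm
  exact this.trans (integral_coord_complexGaussian i)

lemma memLp_coord_complexGaussian (i : ι) : MemLp (fun z => z i) 2 (complexGaussian ι) :=
  ((EuclideanSpace.proj i : EuclideanSpace ℂ ι →L[ℂ] ℂ).restrictScalars ℝ).comp_memLp'
    (IsGaussian.memLp_two_id (μ := complexGaussian ι))

lemma integral_conj_mul_coord_complexGaussian [DecidableEq ι] (i j : ι) :
    ∫ z, conj (z i) * z j ∂complexGaussian ι = if i = j then 2 else 0 := by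
  rw [integral_complexGaussian (f := fun z => conj (z i) * z j) (by fun_prop)]
  split_ifs with hij
  · subst hij
    have : ∀ z : ι → ℂ, conj (z i) * z i = ((‖z i‖ ^ 2 : ℝ) : ℂ) := by
      intro z; rw [Complex.conj_mul']; push_cast; rfl
    simp_rw [this]
    rw [integral_complex_ofReal]
    have : ∫ z : ι → ℂ, ‖z i‖ ^ 2 ∂(Measure.pi fun _ : ι => stdComplexGaussian) = 2 :=
      (integral_comp_eval (μ := fun _ : ι => stdComplexGaussian) (i := i)
        (f := fun z : ℂ => ‖z‖ ^ 2) (by fun_prop)).trans integral_norm_sq_stdComplexGaussian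
    rw [this]; norm_num
  · have hind : iIndepFun (fun (i : ι) (z : ι → ℂ) => z i)
        (Measure.pi fun _ : ι => stdComplexGaussian) :=
      iIndepFun_pi (X := fun _ => id) (fun _ => aemeasurable_id)
    have h2 : IndepFun (fun z : ι → ℂ => conj (z i)) (fun z : ι → ℂ => z j)
        (Measure.pi fun _ : ι => stdComplexGaussian) :=
      (hind.indepFun hij).comp (φ := fun w : ℂ => conj w) (ψ := id) (by fun_prop) measurable_id
    have h3 := h2.integral_mul_eq_mul_integral
      (Complex.continuous_conj.measurable.comp (measurable_pi_apply i)).aestronglyMeasurable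
      (measurable_pi_apply j).aestronglyMeasurable
    have h4 : ∫ z : ι → ℂ, z j ∂(Measure.pi fun _ : ι => stdComplexGaussian) = 0 := by
      exact (integral_comp_eval (μ := fun _ : ι => stdComplexGaussian) (i := j)
        (f := fun z : ℂ => z) (by fun_prop)).trans integral_id_stdComplexGaussian
    rw [h4, mul_zero] at h3
    exact h3

end Vector

/-! ### Exponential moments and tails of squared linear forms -/

section Tails

variable {ι : Type*} [Fintype ι]

lemma lintegral_exp_re_inner_complexGaussian (a : EuclideanSpace ℂ ι) :
    ∫⁻ z, ENNReal.ofReal (Real.exp (inner ℂ a z).re) ∂complexGaussian ι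
      = ENNReal.ofReal (Real.exp (‖a‖ ^ 2 / 2)) := by
  rw [← ofReal_integral_eq_lintegral_ofReal (integrable_exp_re_inner_complexGaussian a)
    (ae_of_all _ fun _ => (Real.exp_pos _).le), integral_exp_re_inner_complexGaussian]

lemma lintegral_exp_norm_sq_complexGaussian :
    ∫⁻ z, ENNReal.ofReal (Real.exp (‖z‖ ^ 2 / 4)) ∂complexGaussian ι
      = ENNReal.ofReal (2 ^ Fintype.card ι) := by
  rw [← ofReal_integral_eq_lintegral_ofReal integrable_exp_norm_sq_complexGaussian
    (ae_of_all _ fun _ => (Real.exp_pos _).le), integral_exp_norm_sq_complexGaussian]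

/-- Exponential moment of a sum of squared linear forms whose synthesis operator is a
contraction. -/
lemma lintegral_exp_sum_inner_sq_le {κ : Type*} [Fintype κ] (c : κ → EuclideanSpace ℂ ι)
    (hc : ∀ g : EuclideanSpace ℂ κ, ‖∑ i, g i • c i‖ ≤ ‖g‖) :
    ∫⁻ z, ENNReal.ofReal (Real.exp ((∑ i, ‖inner ℂ (c i) z‖ ^ 2) / 4)) ∂complexGaussian ι
      ≤ ENNReal.ofReal (2 ^ Fintype.card κ) := by
  set r : ℝ := (Real.sqrt 2)⁻¹ with hr
  have hr2 : r ^ 2 = 1 / 2 := by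
    rw [hr, inv_pow, Real.sq_sqrt (by norm_num)]; norm_num
  -- Linearisation by an auxiliary Gaussian vector g: the exponential of the sum of squares is the
  -- mean over g of exp Re⟨S g, z⟩. After exchanging the integrals, the mean over z is exp(‖S g‖²/2)
  -- ≤ exp(‖g‖²/4). The factor 1/√2 in `S` yields this last exponent.
  let S : EuclideanSpace ℂ κ → EuclideanSpace ℂ ι := fun g => (r : ℂ) • ∑ i, g i • c i
  have hS : Continuous S := by fun_prop
  have key : ∀ z : EuclideanSpace ℂ ι,
      ENNReal.ofReal (Real.exp ((∑ i, ‖inner ℂ (c i) z‖ ^ 2) / 4))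
        = ∫⁻ g, ENNReal.ofReal (Real.exp (inner ℂ (S g) z).re) ∂complexGaussian κ := by
    intro z
    let v : EuclideanSpace ℂ κ := WithLp.toLp 2 fun i => (r : ℂ) * inner ℂ (c i) z
    have h1 : ‖v‖ ^ 2 / 2 = (∑ i, ‖inner ℂ (c i) z‖ ^ 2) / 4 := by
      rw [EuclideanSpace.norm_sq_eq]
      simp only [v, norm_mul, mul_pow, Complex.norm_real, Real.norm_eq_abs, sq_abs, hr2]
      rw [← Finset.mul_sum]; ring
    have h2 : ∀ g : EuclideanSpace ℂ κ, (inner ℂ (S g) z).re = (inner ℂ v g).re := by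
      intro g
      rw [← inner_conj_symm v g, Complex.conj_re]
      congr 1
      simp only [S, v]
      rw [inner_smul_left, sum_inner, PiLp.inner_apply, Finset.mul_sum]
      refine Finset.sum_congr rfl fun i _ => ?_
      rw [inner_smul_left]
      simp
      ring
    simp_rw [h2]
    rw [lintegral_exp_re_inner_complexGaussian, h1]
  simp_rw [key]
  rw [lintegral_lintegral_swap]
  · rw [← lintegral_exp_norm_sq_complexGaussian]
    refine lintegral_mono fun g => ?_
    rw [lintegral_exp_re_inner_complexGaussian]
    refine ENNReal.ofReal_le_ofReal (Real.exp_le_exp.mpr ?_)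
    have h3 : ‖S g‖ ^ 2 ≤ ‖g‖ ^ 2 / 2 := by
      simp only [S]
      rw [norm_smul, mul_pow, Complex.norm_real, Real.norm_eq_abs, sq_abs, hr2]
      have := pow_le_pow_left₀ (norm_nonneg _) (hc g) 2
      linarith
    linarith
  · refine Measurable.aemeasurable ?_
    have : Continuous fun p : EuclideanSpace ℂ ι × EuclideanSpace ℂ κ =>
        Real.exp (inner ℂ (S p.2) p.1).re := by
      refine Real.continuous_exp.comp (Complex.continuous_re.comp ?_)
      exact (hS.comp continuous_snd).inner continuous_fst
    exact ENNReal.measurable_ofReal.comp this.measurable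

lemma lintegral_exp_inner_sq_le (e : EuclideanSpace ℂ ι) (he : ‖e‖ ≤ 1) :
    ∫⁻ z, ENNReal.ofReal (Real.exp (‖inner ℂ e z‖ ^ 2 / 4)) ∂complexGaussian ι ≤ 2 := by
  have h := lintegral_exp_sum_inner_sq_le (κ := Unit) (fun _ => e) (fun g => by
    simp only [Finset.univ_unique, Finset.sum_singleton, norm_smul]
    have : ‖g default‖ ≤ ‖g‖ := PiLp.norm_apply_le g default
    calc ‖g default‖ * ‖e‖ ≤ ‖g default‖ * 1 := by gcongr
      _ ≤ ‖g‖ := by simpa using this)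
  simpa using h

/-- Exponential moment of a sum of squared linear forms, by convexity. -/
lemma lintegral_exp_sum_inner_sq_div_le {κ : Type*} (s : Finset κ)
    (c : κ → EuclideanSpace ℂ ι) {V : ℝ} (hc : ∑ i ∈ s, ‖c i‖ ^ 2 ≤ V) :
    ∫⁻ z, ENNReal.ofReal (Real.exp ((∑ i ∈ s, ‖inner ℂ (c i) z‖ ^ 2) / (4 * V)))
      ∂complexGaussian ι ≤ 2 := by
  set W := ∑ i ∈ s, ‖c i‖ ^ 2 with hW
  have hW0 : 0 ≤ W := Finset.sum_nonneg fun i _ => by positivity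
  -- After normalisation the exponent is at most an average of ‖⟨e i, z⟩‖²/4 with weights ‖c i‖²/W,
  -- so Jensen reduces to one form. A zero vector stays zero and has weight 0.
  let e : κ → EuclideanSpace ℂ ι := fun i => ((‖c i‖⁻¹ : ℝ) : ℂ) • c i
  have he : ∀ i, ‖e i‖ ≤ 1 := by
    intro i
    simp only [e, norm_smul, Complex.norm_real, norm_inv, norm_norm]
    exact inv_mul_le_one
  have hce : ∀ i z, ‖inner ℂ (c i) z‖ ^ 2 = ‖c i‖ ^ 2 * ‖inner ℂ (e i) z‖ ^ 2 := by
    intro i z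
    simp only [e, inner_smul_left, norm_mul, Complex.conj_ofReal, Complex.norm_real, norm_inv,
      norm_norm]
    by_cases h : c i = 0
    · simp [h]
    · have : ‖c i‖ ≠ 0 := norm_ne_zero_iff.mpr h
      field_simp
  rcases hW0.eq_or_lt with h0 | hpos
  · have hz : ∀ i ∈ s, ‖c i‖ ^ 2 = 0 :=
      (Finset.sum_eq_zero_iff_of_nonneg fun i _ => by positivity).mp h0.symm
    have : ∀ z, (∑ i ∈ s, ‖inner ℂ (c i) z‖ ^ 2) = 0 := fun z =>
      Finset.sum_eq_zero fun i hi => by rw [hce, hz i hi, zero_mul]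
    simp [this]
  · have hpt : ∀ z, ENNReal.ofReal (Real.exp ((∑ i ∈ s, ‖inner ℂ (c i) z‖ ^ 2) / (4 * V)))
        ≤ ∑ i ∈ s, ENNReal.ofReal (‖c i‖ ^ 2 / W)
            * ENNReal.ofReal (Real.exp (‖inner ℂ (e i) z‖ ^ 2 / 4)) := by
      intro z
      have h1 : (∑ i ∈ s, ‖inner ℂ (c i) z‖ ^ 2) / (4 * V)
          ≤ ∑ i ∈ s, (‖c i‖ ^ 2 / W) • (‖inner ℂ (e i) z‖ ^ 2 / 4) := by
        have h2 : ∑ i ∈ s, (‖c i‖ ^ 2 / W) • (‖inner ℂ (e i) z‖ ^ 2 / 4)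
            = (∑ i ∈ s, ‖inner ℂ (c i) z‖ ^ 2) / (4 * W) := by
          rw [Finset.sum_div]
          refine Finset.sum_congr rfl fun i _ => ?_
          rw [hce, smul_eq_mul]
          field_simp
        rw [h2]
        have : 0 ≤ ∑ i ∈ s, ‖inner ℂ (c i) z‖ ^ 2 :=
          Finset.sum_nonneg fun i _ => by positivity
        gcongr
      have h3 := convexOn_exp.map_sum_le (t := s) (w := fun i => ‖c i‖ ^ 2 / W)
        (p := fun i => ‖inner ℂ (e i) z‖ ^ 2 / 4) (fun i _ => by positivity)
        (by rw [← Finset.sum_div, ← hW, div_self hpos.ne']) (fun i _ => Set.mem_univ _)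
      refine (ENNReal.ofReal_le_ofReal ((Real.exp_le_exp.mpr h1).trans h3)).trans_eq ?_
      rw [ENNReal.ofReal_sum_of_nonneg (fun i _ => by positivity)]
      refine Finset.sum_congr rfl fun i _ => ?_
      rw [smul_eq_mul, ENNReal.ofReal_mul (by positivity)]
    refine (lintegral_mono hpt).trans ?_
    rw [lintegral_finsetSum' _ (fun i _ => by fun_prop)]
    calc _ ≤ ∑ i ∈ s, ENNReal.ofReal (‖c i‖ ^ 2 / W) * 2 := by
          refine Finset.sum_le_sum fun i _ => ?_
          rw [lintegral_const_mul' _ _ ENNReal.ofReal_ne_top]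
          gcongr
          exact lintegral_exp_inner_sq_le _ (he i)
      _ = 2 := by
          rw [← Finset.sum_mul, ← ENNReal.ofReal_sum_of_nonneg (fun i _ => by positivity),
            ← Finset.sum_div, ← hW, div_self hpos.ne']
          simp

/-- Markov's inequality for the exponential of f at level M/δ. -/
lemma measure_log_lt_le_of_lintegral_exp_le {E : Type*} [MeasurableSpace E] {μ : Measure E}
    {f : E → ℝ} (hf : Measurable f) {M δ : ℝ} (hM : 0 < M) (hδ : 0 < δ)
    (h : ∫⁻ z, ENNReal.ofReal (Real.exp (f z)) ∂μ ≤ ENNReal.ofReal M) :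
    μ {z | Real.log (M / δ) < f z} ≤ ENNReal.ofReal δ := by
  have h1 := mul_meas_ge_le_lintegral (μ := μ)
    (f := fun z => ENNReal.ofReal (Real.exp (f z))) (by fun_prop) (ENNReal.ofReal (M / δ))
  have h2 : {z | Real.log (M / δ) < f z}
      ⊆ {z | ENNReal.ofReal (M / δ) ≤ ENNReal.ofReal (Real.exp (f z))} := by
    intro z hz
    refine ENNReal.ofReal_le_ofReal ?_
    rw [← Real.exp_log (div_pos hM hδ)]
    exact Real.exp_le_exp.mpr (le_of_lt hz)
  have h3 : ENNReal.ofReal (M / δ) * μ {z | Real.log (M / δ) < f z} ≤ ENNReal.ofReal M :=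
    ((mul_le_mul_right (measure_mono h2) _).trans h1).trans h
  have h4 : ENNReal.ofReal (M / δ) ≠ 0 := by simpa using div_pos hM hδ
  calc μ {z | Real.log (M / δ) < f z}
      ≤ ENNReal.ofReal M / ENNReal.ofReal (M / δ) := by
        rw [ENNReal.le_div_iff_mul_le (Or.inl h4) (Or.inl ENNReal.ofReal_ne_top), mul_comm]
        exact h3
    _ = ENNReal.ofReal δ := by
        rw [← ENNReal.ofReal_div_of_pos (div_pos hM hδ)]
        congr 1
        field_simp

lemma measure_sum_inner_sq_gt_le {κ : Type*} (s : Finset κ)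
    (c : κ → EuclideanSpace ℂ ι) {V : ℝ} (hV : 0 ≤ V) (hc : ∑ i ∈ s, ‖c i‖ ^ 2 ≤ V)
    {δ : ℝ} (hδ : 0 < δ) :
    complexGaussian ι {z | 4 * V * Real.log (2 / δ) < ∑ i ∈ s, ‖inner ℂ (c i) z‖ ^ 2}
      ≤ ENNReal.ofReal δ := by
  -- For V = 0 all forms vanish. This case is separate because the exponential moment is taken after
  -- division by V.
  rcases hV.eq_or_lt with h0 | hpos
  · have hz : ∀ i ∈ s, ‖c i‖ ^ 2 = 0 :=
      (Finset.sum_eq_zero_iff_of_nonneg fun i _ => by positivity).mp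
        (le_antisymm (hc.trans h0.symm.le) (Finset.sum_nonneg fun i _ => by positivity))
    have : ∀ z, (∑ i ∈ s, ‖inner ℂ (c i) z‖ ^ 2) = 0 := fun z =>
      Finset.sum_eq_zero fun i hi => by
        have : c i = 0 := by simpa using hz i hi
        simp [this]
    simp [this, ← h0]
  · have h := measure_log_lt_le_of_lintegral_exp_le (μ := complexGaussian ι)
      (f := fun z => (∑ i ∈ s, ‖inner ℂ (c i) z‖ ^ 2) / (4 * V)) (by fun_prop)
      (M := 2) two_pos hδ (by simpa using lintegral_exp_sum_inner_sq_div_le s c hc)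
    refine (measure_mono fun z hz => ?_).trans h
    rw [Set.mem_ofPred_eq, lt_div_iff₀ (by positivity), mul_comm]
    exact hz

lemma measure_sum_inner_sq_gt_le_of_contraction {κ : Type*} [Fintype κ]
    (c : κ → EuclideanSpace ℂ ι) (hc : ∀ g : EuclideanSpace ℂ κ, ‖∑ i, g i • c i‖ ≤ ‖g‖)
    {δ : ℝ} (hδ : 0 < δ) :
    complexGaussian ι {z | 4 * Real.log (2 ^ Fintype.card κ / δ)
      < ∑ i, ‖inner ℂ (c i) z‖ ^ 2} ≤ ENNReal.ofReal δ := by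
  have h := measure_log_lt_le_of_lintegral_exp_le (μ := complexGaussian ι)
    (f := fun z => (∑ i, ‖inner ℂ (c i) z‖ ^ 2) / 4) (by fun_prop)
    (M := 2 ^ Fintype.card κ) (by positivity) hδ (lintegral_exp_sum_inner_sq_le c hc)
  refine (measure_mono fun z hz => ?_).trans h
  rw [Set.mem_ofPred_eq, lt_div_iff₀ (by positivity), mul_comm]
  exact hz

end Tails

/-! ### Gaussian quadratic forms by decoupling -/

section Chaos

variable {ι : Type*} [Fintype ι]

lemma integrable_conj_mul_coord (t s : ι) :
    Integrable (fun z => conj (z t) * z s) (complexGaussian ι) := by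
  have h : MemLp (fun z : EuclideanSpace ℂ ι => conj (z t)) 2 (complexGaussian ι) :=
    (memLp_coord_complexGaussian t).star
  exact h.integrable_mul (memLp_coord_complexGaussian s)

/-- Polarisation: in rotated coordinates the pure terms in u and in v cancel, and only a bilinear
form in (u, v) survives. -/
lemma re_inner_apply_rotation (K : EuclideanSpace ℂ ι →L[ℂ] EuclideanSpace ℂ ι)
    (u v : EuclideanSpace ℂ ι) {r : ℝ} (hr : r ^ 2 = 1 / 2) :
    (inner ℂ (r • u + r • v) (K (r • u + r • v))).re
      - (inner ℂ (-r • u + r • v) (K (-r • u + r • v))).re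
      = (inner ℂ ((K + ContinuousLinearMap.adjoint K) u) v).re := by
  have hK : ∀ (a : ℝ) (x : EuclideanSpace ℂ ι), K (a • x) = a • K x := fun a x =>
    map_real_smul K K.continuous a x
  have hl : ∀ (a : ℝ) (x y : EuclideanSpace ℂ ι), inner ℂ (a • x) y = (a : ℂ) * inner ℂ x y := by
    intro a x y
    rw [← Complex.coe_smul, inner_smul_left, Complex.conj_ofReal]
  have hrr : ∀ (a : ℝ) (x y : EuclideanSpace ℂ ι), inner ℂ x (a • y) = (a : ℂ) * inner ℂ x y := by
    intro a x y
    rw [← Complex.coe_smul, inner_smul_right]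
  have h1 : (inner ℂ v (K u)).re = (inner ℂ (K u) v).re := by
    rw [← inner_conj_symm, Complex.conj_re]
  simp only [map_add, hK, inner_add_left, inner_add_right, hl, hrr, Complex.add_re,
    Complex.re_ofReal_mul, h1, add_apply,
    ContinuousLinearMap.adjoint_inner_left]
  linear_combination (2 * ((inner ℂ (K u) v).re + (inner ℂ u (K v)).re)) * hr

variable [DecidableEq ι]

lemma sum_coord_smul_single (z : EuclideanSpace ℂ ι) :
    ∑ s, z s • EuclideanSpace.single s (1 : ℂ) = z := by
  have := (EuclideanSpace.basisFun ι ℂ).sum_repr z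
  simpa using this

lemma norm_sq_eq_sum_inner_single (z : EuclideanSpace ℂ ι) :
    ‖z‖ ^ 2 = ∑ s, ‖inner ℂ (EuclideanSpace.single s (1 : ℂ)) z‖ ^ 2 := by
  rw [EuclideanSpace.norm_sq_eq]
  simp [EuclideanSpace.inner_single_left]

lemma sum_norm_sq_adjoint_single (K : EuclideanSpace ℂ ι →L[ℂ] EuclideanSpace ℂ ι) :
    ∑ s, ‖ContinuousLinearMap.adjoint K (EuclideanSpace.single s (1 : ℂ))‖ ^ 2
      = ∑ s, ‖K (EuclideanSpace.single s (1 : ℂ))‖ ^ 2 := by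
  simp_rw [norm_sq_eq_sum_inner_single, ContinuousLinearMap.adjoint_inner_right]
  rw [Finset.sum_comm]
  refine Finset.sum_congr rfl fun s _ => Finset.sum_congr rfl fun t _ => ?_
  rw [← norm_inner_symm]

lemma inner_apply_eq_sum (K : EuclideanSpace ℂ ι →L[ℂ] EuclideanSpace ℂ ι)
    (z : EuclideanSpace ℂ ι) :
    inner ℂ z (K z) = ∑ t, ∑ s, (conj (z t) * z s)
      * inner ℂ (EuclideanSpace.single t (1 : ℂ)) (K (EuclideanSpace.single s (1 : ℂ))) := by
  conv_lhs => rw [← sum_coord_smul_single z]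
  simp_rw [map_sum, map_smul, sum_inner, inner_sum, inner_smul_left, inner_smul_right]
  refine Finset.sum_congr rfl fun t _ => Finset.sum_congr rfl fun s _ => ?_
  ring

lemma integrable_inner_apply (K : EuclideanSpace ℂ ι →L[ℂ] EuclideanSpace ℂ ι) :
    Integrable (fun z => inner ℂ z (K z)) (complexGaussian ι) := by
  simp_rw [inner_apply_eq_sum]
  exact integrable_finsetSum _ fun t _ => integrable_finsetSum _ fun s _ =>
    (integrable_conj_mul_coord t s).mul_const _

lemma integral_inner_apply (K : EuclideanSpace ℂ ι →L[ℂ] EuclideanSpace ℂ ι) :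
    ∫ z, inner ℂ z (K z) ∂complexGaussian ι
      = 2 * ∑ s, inner ℂ (EuclideanSpace.single s (1 : ℂ))
          (K (EuclideanSpace.single s (1 : ℂ))) := by
  simp_rw [inner_apply_eq_sum]
  rw [integral_finsetSum _ fun t _ => integrable_finsetSum _ fun s _ =>
    (integrable_conj_mul_coord t s).mul_const _, Finset.mul_sum]
  refine Finset.sum_congr rfl fun t _ => ?_
  rw [integral_finsetSum _ fun s _ => (integrable_conj_mul_coord t s).mul_const _]
  simp_rw [integral_mul_const, integral_conj_mul_coord_complexGaussian]
  simp

lemma integral_re_inner_apply (K : EuclideanSpace ℂ ι →L[ℂ] EuclideanSpace ℂ ι) :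
    ∫ z, (inner ℂ z (K z)).re ∂complexGaussian ι
      = 2 * (∑ s, inner ℂ (EuclideanSpace.single s (1 : ℂ))
          (K (EuclideanSpace.single s (1 : ℂ)))).re := by
  have h := integral_re (integrable_inner_apply K)
  simp only [RCLike.re_eq_complex_re] at h
  rw [h, integral_inner_apply]
  simp

/-- Jensen's inequality through 1 + f ≤ exp f. If exp f is not integrable, its lower integral is
infinite and the bound is trivial. -/
lemma one_le_lintegral_exp_of_integral_eq_zero {E : Type*} [MeasurableSpace E] {μ : Measure E}
    [IsProbabilityMeasure μ] {f : E → ℝ} (hf : Integrable f μ) (h0 : ∫ z, f z ∂μ = 0) :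
    1 ≤ ∫⁻ z, ENNReal.ofReal (Real.exp (f z)) ∂μ := by
  by_cases hi : Integrable (fun z => Real.exp (f z)) μ
  · rw [← ofReal_integral_eq_lintegral_ofReal hi (ae_of_all _ fun _ => (Real.exp_pos _).le),
      ← ENNReal.ofReal_one]
    refine ENNReal.ofReal_le_ofReal ?_
    calc (1 : ℝ) = ∫ z, (f z + 1) ∂μ := by
          rw [integral_add hf (integrable_const _), h0]; simp
      _ ≤ _ := integral_mono (hf.add (integrable_const _)) hi fun z => Real.add_one_le_exp _
  · have hm : AEStronglyMeasurable (fun z => Real.exp (f z)) μ :=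
      Real.continuous_exp.comp_aestronglyMeasurable hf.aestronglyMeasurable
    by_contra hlt
    refine hi ((lintegral_ofReal_ne_top_iff_integrable hm
      (ae_of_all _ fun _ => (Real.exp_pos _).le)).mp ?_)
    exact ((not_le.mp hlt).trans ENNReal.one_lt_top).ne

/-- Exponential moment of a centred Gaussian quadratic form. -/
lemma lintegral_exp_quadratic_le (K : EuclideanSpace ℂ ι →L[ℂ] EuclideanSpace ℂ ι) {V lam : ℝ}
    (hV : 0 < V) (hK : ∑ s, ‖K (EuclideanSpace.single s (1 : ℂ))‖ ^ 2 ≤ V)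
    (hlam : lam ^ 2 * (8 * V) = 1) :
    ∫⁻ z, ENNReal.ofReal (Real.exp (lam * ((inner ℂ z (K z)).re
      - 2 * (∑ s, inner ℂ (EuclideanSpace.single s (1 : ℂ))
          (K (EuclideanSpace.single s (1 : ℂ)))).re))) ∂complexGaussian ι ≤ 2 := by
  set τ := 2 * (∑ s, inner ℂ (EuclideanSpace.single s (1 : ℂ))
          (K (EuclideanSpace.single s (1 : ℂ)))).re with hτ
  set γ := complexGaussian ι
  let Q : EuclideanSpace ℂ ι → ℝ := fun z => (inner ℂ z (K z)).re
  have hQc : Continuous Q := by fun_prop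
  have hQi : Integrable Q γ := (integrable_inner_apply K).re
  have hQ : ∫ z, Q z ∂γ = τ := integral_re_inner_apply K
  -- Symmetrisation: multiplying by this factor, taken over an independent copy, only increases the
  -- moment and replaces the centring τ by Q of the copy.
  have hone : 1 ≤ ∫⁻ z, ENNReal.ofReal (Real.exp (-lam * (Q z - τ))) ∂γ := by
    refine one_le_lintegral_exp_of_integral_eq_zero
      ((hQi.sub (integrable_const _)).const_mul _) ?_
    rw [integral_const_mul, integral_sub hQi (integrable_const _), hQ]
    simp
  let F : EuclideanSpace ℂ ι × EuclideanSpace ℂ ι → ℝ≥0∞ :=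
    fun p => ENNReal.ofReal (Real.exp (lam * (Q p.1 - Q p.2)))
  have hF : Measurable F := by
    refine ENNReal.measurable_ofReal.comp (Continuous.measurable ?_)
    fun_prop
  have h1 : ∫⁻ z, ENNReal.ofReal (Real.exp (lam * (Q z - τ))) ∂γ ≤ ∫⁻ p, F p ∂(γ.prod γ) := by
    calc _ ≤ (∫⁻ z, ENNReal.ofReal (Real.exp (lam * (Q z - τ))) ∂γ)
          * ∫⁻ z, ENNReal.ofReal (Real.exp (-lam * (Q z - τ))) ∂γ := le_mul_of_one_le_right' hone
      _ = ∫⁻ p, F p ∂(γ.prod γ) := by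
          rw [← lintegral_prod_mul (by fun_prop) (by fun_prop)]
          refine lintegral_congr fun p => ?_
          rw [← ENNReal.ofReal_mul (Real.exp_pos _).le, ← Real.exp_add]
          congr 2
          ring
  -- The rotation by π/4 preserves the law of the pair and turns Q(z) - Q(z') into Re⟨A u, v⟩ with A
  -- = K + K*. Conditionally on u this is linear in v.
  have hrot := IsGaussian.map_rotation_eq_self (μ := γ) integral_id_complexGaussian (Real.pi / 4)
  set r := Real.sqrt 2 / 2 with hr
  have hr2 : r ^ 2 = 1 / 2 := by
    rw [hr, div_pow, Real.sq_sqrt (by norm_num)]; norm_num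
  set A := K + ContinuousLinearMap.adjoint K with hA
  have h2 : ∫⁻ p, F p ∂(γ.prod γ)
      = ∫⁻ u, ∫⁻ v, ENNReal.ofReal (Real.exp (inner ℂ ((lam : ℂ) • A u) v).re) ∂γ ∂γ := by
    rw [← hrot, lintegral_map hF (by fun_prop), lintegral_prod _ (by fun_prop)]
    refine lintegral_congr fun u => lintegral_congr fun v => ?_
    simp only [F, Q, ContinuousLinearMap.rotation_apply, Real.cos_pi_div_four,
      Real.sin_pi_div_four]
    rw [← hr, re_inner_apply_rotation K u v hr2, inner_smul_left, Complex.conj_ofReal,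
      Complex.re_ofReal_mul]
  have hAs : ∀ u, ‖A u‖ ^ 2 = ∑ s, ‖inner ℂ (A (EuclideanSpace.single s (1 : ℂ))) u‖ ^ 2 := by
    intro u
    rw [norm_sq_eq_sum_inner_single]
    refine Finset.sum_congr rfl fun s _ => ?_
    have : ContinuousLinearMap.adjoint A = A := by
      rw [hA, map_add, ContinuousLinearMap.adjoint_adjoint, add_comm]
    rw [← ContinuousLinearMap.adjoint_inner_left, this]
  have hAV : ∑ s, ‖A (EuclideanSpace.single s (1 : ℂ))‖ ^ 2 ≤ 4 * V := by
    calc _ ≤ ∑ s, (2 * ‖K (EuclideanSpace.single s (1 : ℂ))‖ ^ 2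
          + 2 * ‖ContinuousLinearMap.adjoint K (EuclideanSpace.single s (1 : ℂ))‖ ^ 2) := by
          refine Finset.sum_le_sum fun s _ => ?_
          have := norm_add_le (K (EuclideanSpace.single s (1 : ℂ)))
            (ContinuousLinearMap.adjoint K (EuclideanSpace.single s (1 : ℂ)))
          have h3 : ‖A (EuclideanSpace.single s (1 : ℂ))‖
            ≤ ‖K (EuclideanSpace.single s (1 : ℂ))‖
              + ‖ContinuousLinearMap.adjoint K (EuclideanSpace.single s (1 : ℂ))‖ := this
          have h4 := pow_le_pow_left₀ (norm_nonneg _) h3 2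
          nlinarith [sq_nonneg (‖K (EuclideanSpace.single s (1 : ℂ))‖
              - ‖ContinuousLinearMap.adjoint K (EuclideanSpace.single s (1 : ℂ))‖)]
      _ ≤ 4 * V := by
          rw [Finset.sum_add_distrib, ← Finset.mul_sum, ← Finset.mul_sum,
            sum_norm_sq_adjoint_single]
          linarith
  -- Integration over v leaves exp(lam²‖A u‖²/2). The choice lam² = 1/(8V) makes the exponent ‖A
  -- u‖²/(4·4V), the form required by the bound for squared linear forms of energy 4V.
  refine (h1.trans_eq h2).trans ?_
  refine (lintegral_mono fun u => ?_).trans (lintegral_exp_sum_inner_sq_div_le Finset.univ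
    (fun s => A (EuclideanSpace.single s (1 : ℂ))) hAV)
  rw [lintegral_exp_re_inner_complexGaussian]
  refine ENNReal.ofReal_le_ofReal (Real.exp_le_exp.mpr (le_of_eq ?_))
  rw [← hAs, norm_smul, mul_pow, Complex.norm_real, Real.norm_eq_abs, sq_abs]
  field_simp
  linear_combination (2 * ‖A u‖ ^ 2) * hlam

lemma measure_quadratic_gt_le (K : EuclideanSpace ℂ ι →L[ℂ] EuclideanSpace ℂ ι) {V δ : ℝ}
    (hV : 0 < V) (hK : ∑ s, ‖K (EuclideanSpace.single s (1 : ℂ))‖ ^ 2 ≤ V) (hδ : 0 < δ) :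
    complexGaussian ι {z | Real.sqrt (8 * V) * Real.log (2 / δ) < (inner ℂ z (K z)).re
      - 2 * (∑ s, inner ℂ (EuclideanSpace.single s (1 : ℂ))
          (K (EuclideanSpace.single s (1 : ℂ)))).re} ≤ ENNReal.ofReal δ := by
  have hs : 0 < Real.sqrt (8 * V) := Real.sqrt_pos.mpr (by positivity)
  have h := measure_log_lt_le_of_lintegral_exp_le (μ := complexGaussian ι)
    (f := fun z => (Real.sqrt (8 * V))⁻¹ * ((inner ℂ z (K z)).re
      - 2 * (∑ s, inner ℂ (EuclideanSpace.single s (1 : ℂ))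
          (K (EuclideanSpace.single s (1 : ℂ)))).re)) (by fun_prop)
    (M := 2) two_pos hδ (by
      simpa using lintegral_exp_quadratic_le K hV hK (lam := (Real.sqrt (8 * V))⁻¹) (by
        rw [inv_pow, Real.sq_sqrt (by positivity)]
        field_simp))
  refine (measure_mono fun z hz => ?_).trans h
  rw [Set.mem_ofPred_eq, inv_mul_eq_div, lt_div_iff₀ hs, mul_comm]
  exact hz

/-- Deviation bound for the modulus of a Gaussian quadratic form. -/
lemma measure_norm_quadratic_gt_le (K : EuclideanSpace ℂ ι →L[ℂ] EuclideanSpace ℂ ι)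
    {V T δ : ℝ} (hV : 0 < V) (hK : ∑ s, ‖K (EuclideanSpace.single s (1 : ℂ))‖ ^ 2 ≤ V)
    (hT : ‖∑ s, inner ℂ (EuclideanSpace.single s (1 : ℂ))
          (K (EuclideanSpace.single s (1 : ℂ)))‖ ≤ T) (hδ : 0 < δ) :
    complexGaussian ι {z | 2 * (Real.sqrt (8 * V) * Real.log (2 / δ) + 2 * T)
      < ‖inner ℂ z (K z)‖} ≤ 4 * ENNReal.ofReal δ := by
  set B := Real.sqrt (8 * V) * Real.log (2 / δ) with hB
  let G : ℂ → Set (EuclideanSpace ℂ ι) := fun c => {z | B < (inner ℂ z ((c • K) z)).re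
      - 2 * (∑ s, inner ℂ (EuclideanSpace.single s (1 : ℂ))
          ((c • K) (EuclideanSpace.single s (1 : ℂ)))).re}
  have hG : ∀ c : ℂ, ‖c‖ = 1 → complexGaussian ι (G c) ≤ ENNReal.ofReal δ := by
    intro c hc
    refine measure_quadratic_gt_le (c • K) hV ?_ hδ
    simpa [norm_smul, hc] using hK
  have hout : ∀ c : ℂ, ‖c‖ = 1 → ∀ z, z ∉ G c → (c * inner ℂ z (K z)).re ≤ B + 2 * T := by
    intro c hc z hz
    have h1 : (inner ℂ z ((c • K) z)).re - 2 * (∑ s, inner ℂ (EuclideanSpace.single s (1 : ℂ))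
          ((c • K) (EuclideanSpace.single s (1 : ℂ)))).re ≤ B := not_lt.mp hz
    simp only [smul_apply, inner_smul_right, ← Finset.mul_sum] at h1
    have h2 := (Complex.re_le_norm (c * ∑ s, inner ℂ (EuclideanSpace.single s (1 : ℂ))
          (K (EuclideanSpace.single s (1 : ℂ)))))
    rw [norm_mul, hc, one_mul] at h2
    linarith
  -- One-sided bounds in the four directions 1, -1, i, -i control the real and imaginary parts,
  -- whence the factors 2 in the threshold and 4 in the probability.
  have hsub : {z | 2 * (B + 2 * T) < ‖inner ℂ z (K z)‖}
      ⊆ (G 1 ∪ G (-1)) ∪ (G Complex.I ∪ G (-Complex.I)) := by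
    intro z hz
    by_contra hn
    simp only [Set.mem_union, not_or] at hn
    obtain ⟨⟨h1, h2⟩, h3, h4⟩ := hn
    have h1 := hout 1 (by simp) z h1
    have h2 := hout (-1) (by simp) z h2
    have h3 := hout Complex.I (by simp) z h3
    have h4 := hout (-Complex.I) (by simp) z h4
    simp at h1 h2 h3 h4
    have h5 := Complex.norm_le_abs_re_add_abs_im (inner ℂ z (K z))
    have h6 : |(inner ℂ z (K z)).re| ≤ B + 2 * T := abs_le.mpr ⟨by linarith, by linarith⟩
    have h7 : |(inner ℂ z (K z)).im| ≤ B + 2 * T := abs_le.mpr ⟨by linarith, by linarith⟩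
    have h8 : 2 * (B + 2 * T) < ‖inner ℂ z (K z)‖ := hz
    linarith
  refine (measure_mono hsub).trans ?_
  calc _ ≤ (complexGaussian ι (G 1) + complexGaussian ι (G (-1)))
        + (complexGaussian ι (G Complex.I) + complexGaussian ι (G (-Complex.I))) :=
        (measure_union_le _ _).trans
          (add_le_add (measure_union_le _ _) (measure_union_le _ _))
    _ ≤ (ENNReal.ofReal δ + ENNReal.ofReal δ) + (ENNReal.ofReal δ + ENNReal.ofReal δ) := by
        gcongr <;> exact hG _ (by simp)
    _ = 4 * ENNReal.ofReal δ := by ring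

/-- Second moment of an affine functional of a Gaussian vector. -/
lemma integral_norm_sq_add_inner (b : ℂ) (a : EuclideanSpace ℂ ι) :
    ∫ z, ‖b + inner ℂ a z‖ ^ 2 ∂complexGaussian ι = ‖b‖ ^ 2 + 2 * ‖a‖ ^ 2 := by
  have hLc : ∀ z : EuclideanSpace ℂ ι, inner ℂ a z = ∑ s, conj (a s) * z s := by
    intro z; simp [PiLp.inner_apply, mul_comm]
  let f : EuclideanSpace ℂ ι → ℂ := fun z => conj b * inner ℂ a z
  have hpt : ∀ z : EuclideanSpace ℂ ι, ((‖b + inner ℂ a z‖ ^ 2 : ℝ) : ℂ)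
      = ((‖b‖ ^ 2 : ℝ) : ℂ) + f z + conj (f z)
        + inner ℂ z ((InnerProductSpace.rankOne ℂ a a) z) := by
    intro z
    rw [InnerProductSpace.rankOne_apply, inner_smul_right, ← inner_conj_symm z a]
    push_cast
    rw [← Complex.conj_mul', ← Complex.conj_mul']
    simp only [f, map_add, map_mul, Complex.conj_conj]
    ring
  have hi : ∀ s, Integrable (fun z : EuclideanSpace ℂ ι => z s) (complexGaussian ι) := fun s =>
    (memLp_coord_complexGaussian s).integrable (by norm_num)
  have hli : Integrable f (complexGaussian ι) := by
    simp only [f, hLc]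
    exact (integrable_finsetSum _ fun s _ => (hi s).const_mul _).const_mul _
  have hl0 : ∫ z, f z ∂complexGaussian ι = 0 := by
    simp only [f, hLc]
    rw [integral_const_mul, integral_finsetSum _ fun s _ => (hi s).const_mul _]
    simp [integral_const_mul, integral_coord_complexGaussian]
  have hli' : Integrable (fun z => conj (f z)) (complexGaussian ι) :=
    (Complex.conjCLE.integrable_comp_iff).mpr hli
  have hl0' : ∫ z, conj (f z) ∂complexGaussian ι = 0 := by
    rw [integral_conj, hl0, map_zero]
  have htr : ∑ s, inner ℂ (EuclideanSpace.single s (1 : ℂ))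
      ((InnerProductSpace.rankOne ℂ a a) (EuclideanSpace.single s (1 : ℂ)))
      = ((‖a‖ ^ 2 : ℝ) : ℂ) := by
    rw [EuclideanSpace.norm_sq_eq]
    push_cast
    refine Finset.sum_congr rfl fun s _ => ?_
    rw [InnerProductSpace.rankOne_apply, inner_smul_right, EuclideanSpace.inner_single_left,
      EuclideanSpace.inner_single_right, ← Complex.conj_mul']
    simp
  have : ((∫ z, ‖b + inner ℂ a z‖ ^ 2 ∂complexGaussian ι : ℝ) : ℂ)
      = ((‖b‖ ^ 2 + 2 * ‖a‖ ^ 2 : ℝ) : ℂ) := by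
    rw [← integral_complex_ofReal]
    simp_rw [hpt]
    have hadd := integral_add (((integrable_const ((‖b‖ ^ 2 : ℝ) : ℂ)).add hli).add hli')
      (integrable_inner_apply (InnerProductSpace.rankOne ℂ a a))
    have hadd' := integral_add ((integrable_const ((‖b‖ ^ 2 : ℝ) : ℂ)).add hli) hli'
    simp only [Pi.add_apply] at hadd hadd'
    rw [hadd, hadd', integral_add (integrable_const _) hli, hl0, hl0', integral_inner_apply, htr]
    simp
  exact_mod_cast this

end Chaos

/-! ### Convolution with finitely supported filters -/

section Convolution

variable {a b c d : ℤ} {φ ψ : Signal}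

lemma conv_eq_sum_of_subset (v : Signal) (t : ℤ) (s : Finset ℤ) (h : ∀ τ ∉ s, ψ τ = 0) :
    conv ψ v t = ∑ τ ∈ s, ψ τ * v (t - τ) :=
  tsum_eq_sum fun τ hτ => by rw [h τ hτ, zero_mul]

lemma SupportedOn.conv_apply (h : SupportedOn a b ψ) (v : Signal) (t : ℤ) :
    conv ψ v t = ∑ τ ∈ Finset.Icc a b, ψ τ * v (t - τ) :=
  conv_eq_sum_of_subset v t _ fun τ hτ => h τ (by simpa using hτ)

lemma conv_eq_sum_sub (v : Signal) (t r : ℤ) (s : Finset ℤ) (h : ∀ u ∉ s, ψ (u - r) = 0) :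
    conv ψ v t = ∑ u ∈ s, ψ (u - r) * v (t + r - u) := by
  have : conv ψ v t = ∑' u : ℤ, ψ (u - r) * v (t + r - u) := by
    rw [conv, ← (Equiv.subRight r).tsum_eq]
    refine tsum_congr fun u => ?_
    simp only [Equiv.subRight_apply]
    congr 2
    ring
  rw [this]
  exact tsum_eq_sum fun u hu => by rw [h u hu, zero_mul]

/-- Summation over input times rather than lags, so that one fixed set of noise coordinates can
serve all outputs. -/
lemma conv_eq_sum_window (v : Signal) (t : ℤ) (s : Finset ℤ) (h : ∀ u ∉ s, ψ (t - u) = 0) :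
    conv ψ v t = ∑ u ∈ s, ψ (t - u) * v u := by
  have : conv ψ v t = ∑' u : ℤ, ψ (t - u) * v u := by
    rw [conv, ← (Equiv.subLeft t).tsum_eq]
    refine tsum_congr fun u => ?_
    simp only [Equiv.subLeft_apply]
    congr 2
    ring
  rw [this]
  exact tsum_eq_sum fun u hu => by rw [h u hu, zero_mul]

lemma SupportedOn.conv_add (h : SupportedOn a b ψ) (u v : Signal) :
    conv ψ (u + v) = conv ψ u + conv ψ v := by
  ext t
  simp only [h.conv_apply, Pi.add_apply, mul_add, Finset.sum_add_distrib]

lemma SupportedOn.conv_sub (h : SupportedOn a b ψ) (u v : Signal) :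
    conv ψ (u - v) = conv ψ u - conv ψ v := by
  ext t
  simp only [h.conv_apply, Pi.sub_apply, mul_sub, Finset.sum_sub_distrib]

lemma SupportedOn.conv_smul (h : SupportedOn a b ψ) (r : ℂ) (v : Signal) :
    conv ψ (r • v) = r • conv ψ v := by
  ext t
  simp only [h.conv_apply, Pi.smul_apply, smul_eq_mul, Finset.mul_sum]
  exact Finset.sum_congr rfl fun τ _ => by ring

lemma SupportedOn.conv_observe (h : SupportedOn a b ψ) (x z : Signal) (σ : ℝ) :
    conv ψ (observe x σ z) = conv ψ x + (σ : ℂ) • conv ψ z := by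
  rw [← h.conv_smul, ← h.conv_add]
  rfl

lemma SupportedOn.conv_left_comm (hφ : SupportedOn a b φ) (hψ : SupportedOn c d ψ) (v : Signal) :
    conv φ (conv ψ v) = conv ψ (conv φ v) := by
  ext t
  simp only [hφ.conv_apply, hψ.conv_apply, Finset.mul_sum]
  rw [Finset.sum_comm]
  refine Finset.sum_congr rfl fun τ _ => Finset.sum_congr rfl fun u _ => ?_
  rw [show t - u - τ = t - τ - u by ring]
  ring

lemma SupportedOn.conv (hφ : SupportedOn a b φ) (hψ : SupportedOn c d ψ) :
    SupportedOn (a + c) (b + d) (conv φ ψ) := by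
  intro t ht
  rw [hφ.conv_apply]
  refine Finset.sum_eq_zero fun τ hτ => ?_
  rw [hψ (t - τ), mul_zero]
  rw [Finset.mem_Icc] at hτ
  rw [Set.mem_Icc] at ht ⊢
  omega

lemma SupportedOn.conv_assoc (hφ : SupportedOn a b φ) (hψ : SupportedOn c d ψ) (v : Signal) :
    SignalDenoising.conv (SignalDenoising.conv φ ψ) v
      = SignalDenoising.conv φ (SignalDenoising.conv ψ v) := by
  ext t
  rw [(hφ.conv hψ).conv_apply, hφ.conv_apply]
  simp_rw [hφ.conv_apply ψ, Finset.sum_mul]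
  rw [Finset.sum_comm]
  refine Finset.sum_congr rfl fun τ hτ => ?_
  rw [conv_eq_sum_sub v (t - τ) τ (Finset.Icc (a + c) (b + d)) ?_, Finset.mul_sum]
  · refine Finset.sum_congr rfl fun u _ => ?_
    rw [sub_add_cancel, mul_assoc]
  · intro u hu
    refine hψ _ ?_
    rw [Finset.mem_Icc] at hτ hu
    rw [Set.mem_Icc]
    omega

lemma SupportedOn.mono (h : SupportedOn a b ψ) (h1 : c ≤ a) (h2 : b ≤ d) : SupportedOn c d ψ := by
  intro t ht
  refine h t ?_
  rw [Set.mem_Icc] at ht ⊢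
  omega

lemma SupportedOn.sum_norm_sq_sub_le (h : SupportedOn a b ψ) (t : ℤ) (s : Finset ℤ) :
    ∑ u ∈ s, ‖ψ (t - u)‖ ^ 2 ≤ ∑ τ ∈ Finset.Icc a b, ‖ψ τ‖ ^ 2 := by
  rw [← Finset.sum_image (s := s) (g := fun u => t - u) (f := fun τ => ‖ψ τ‖ ^ 2)
    (fun u _ v _ huv => by simpa using huv)]
  calc _ ≤ ∑ τ ∈ s.image (fun u => t - u) ∪ Finset.Icc a b, ‖ψ τ‖ ^ 2 :=
        Finset.sum_le_sum_of_subset_of_nonneg Finset.subset_union_left fun _ _ _ => by positivity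
    _ = _ := (Finset.sum_subset Finset.subset_union_right fun τ _ hτ => by
        rw [h τ (by simpa using hτ)]; simp).symm

lemma conv_finset_sum {κ : Type*} (s : Finset κ) (r : κ → ℂ) (f : κ → Signal)
    (h : ∀ j, SupportedOn a b (f j)) (v : Signal) (t : ℤ) :
    conv (∑ j ∈ s, r j • f j) v t = ∑ j ∈ s, r j * conv (f j) v t := by
  have hs : SupportedOn a b (∑ j ∈ s, r j • f j) := by
    intro t ht
    rw [Finset.sum_apply]
    exact Finset.sum_eq_zero fun j _ => by simp [h j t ht]
  rw [hs.conv_apply]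
  simp_rw [(h _).conv_apply, Finset.sum_apply, Finset.sum_mul, Finset.mul_sum]
  rw [Finset.sum_comm]
  refine Finset.sum_congr rfl fun j _ => Finset.sum_congr rfl fun τ _ => ?_
  simp [mul_assoc]

end Convolution

/-! ### Discrete Fourier transform and Fourier atoms -/

section Fourier

variable {n : ℕ}

/-- The character `t ↦ exp (2 π i j t / (n + 1))` of `ℤ`. -/
noncomputable def character (n j : ℕ) (t : ℤ) : ℂ :=
  Complex.exp (2 * Real.pi * Complex.I * j * t / ((n : ℂ) + 1))

lemma character_add (j : ℕ) (s t : ℤ) :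
    character n j (s + t) = character n j s * character n j t := by
  rw [character, character, character, ← Complex.exp_add]
  congr 1
  push_cast
  ring

lemma norm_character (j : ℕ) (t : ℤ) : ‖character n j t‖ = 1 := by
  have : (2 * Real.pi * Complex.I * j * t / ((n : ℂ) + 1) : ℂ)
      = ((2 * Real.pi * j * t / ((n : ℝ) + 1) : ℝ) : ℂ) * Complex.I := by
    push_cast
    ring
  rw [character, this, Complex.norm_exp_ofReal_mul_I]

lemma conj_character (j : ℕ) (t : ℤ) : conj (character n j t) = character n j (-t) := by
  have h : character n j t * character n j (-t) = 1 := by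
    rw [← character_add, add_neg_cancel, character]
    simp
  have h2 : conj (character n j t) * character n j t = 1 := by
    rw [Complex.conj_mul', norm_character]
    simp
  calc conj (character n j t) = conj (character n j t)
        * (character n j t * character n j (-t)) := by rw [h, mul_one]
    _ = character n j (-t) := by rw [← mul_assoc, h2, one_mul]

/-- A geometric sum over powers of a root of unity of order dividing n + 1. That root equals 1 only
if n + 1 divides t, which forces t = 0 in the range |t| ≤ n. -/
lemma sum_character (t : ℤ) (h1 : -(n : ℤ) ≤ t) (h2 : t ≤ n) :
    ∑ j ∈ Finset.range (n + 1), character n j t = if t = 0 then (n : ℂ) + 1 else 0 := by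
  have hN : ((n : ℂ) + 1) ≠ 0 := Nat.cast_add_one_ne_zero n
  split_ifs with h
  · subst h
    simp [character]
  · set w := Complex.exp (2 * Real.pi * Complex.I * t / ((n : ℂ) + 1)) with hw
    have hp : ∀ j : ℕ, character n j t = w ^ j := by
      intro j
      rw [hw, ← Complex.exp_nat_mul, character]
      congr 1
      ring
    simp_rw [hp]
    have hw1 : w ≠ 1 := by
      intro hc
      obtain ⟨q, hq⟩ := Complex.exp_eq_one_iff.mp hc
      have hpi : (2 * Real.pi * Complex.I : ℂ) ≠ 0 := Complex.two_pi_I_ne_zero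
      have h3 : (t : ℂ) = q * ((n : ℂ) + 1) := by
        field_simp at hq
        rw [hq, mul_comm]
      have h4 : t = q * (n + 1) := by exact_mod_cast h3
      rcases lt_trichotomy q 0 with hq0 | hq0 | hq0
      · nlinarith
      · exact h (by rw [h4, hq0, zero_mul])
      · nlinarith
    have hwN : w ^ (n + 1) = 1 := by
      rw [hw, ← Complex.exp_nat_mul]
      refine Complex.exp_eq_one_iff.mpr ⟨t, ?_⟩
      push_cast
      field_simp
    have := geom_sum_mul w (n + 1)
    rw [hwN, sub_self] at this
    exact (mul_eq_zero.mp this).resolve_right (sub_ne_zero.mpr hw1)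

lemma dft_eq (x : Signal) (j : ℕ) : dft n x j = ((Real.sqrt ((n : ℝ) + 1))⁻¹ : ℂ) *
    ∑ t ∈ Finset.range (n + 1), x (t : ℤ) * character n j t := by
  simp [dft, character]

lemma ofReal_sqrt_inv_mul_self :
    ((Real.sqrt ((n : ℝ) + 1))⁻¹ : ℂ) * ((Real.sqrt ((n : ℝ) + 1))⁻¹ : ℂ)
      = ((n : ℂ) + 1)⁻¹ := by
  rw [← mul_inv, ← Complex.ofReal_mul, Real.mul_self_sqrt (by positivity)]
  push_cast
  rfl

lemma dft_inversion (x : Signal) {s : ℕ} (hs : s ∈ Finset.range (n + 1)) :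
    ∑ j ∈ Finset.range (n + 1), dft n x j
      * (((Real.sqrt ((n : ℝ) + 1))⁻¹ : ℂ) * character n j (-(s : ℤ))) = x s := by
  have hN : ((n : ℂ) + 1) ≠ 0 := Nat.cast_add_one_ne_zero n
  have h : ∀ j ∈ Finset.range (n + 1), dft n x j
      * (((Real.sqrt ((n : ℝ) + 1))⁻¹ : ℂ) * character n j (-(s : ℤ)))
      = ∑ t ∈ Finset.range (n + 1), ((n : ℂ) + 1)⁻¹ * x (t : ℤ)
          * character n j ((t : ℤ) - s) := by
    intro j _
    rw [dft_eq, mul_mul_mul_comm, ofReal_sqrt_inv_mul_self, Finset.sum_mul, Finset.mul_sum]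
    refine Finset.sum_congr rfl fun t _ => ?_
    rw [sub_eq_add_neg, character_add]
    ring
  rw [Finset.sum_congr rfl h, Finset.sum_comm]
  simp_rw [← Finset.mul_sum]
  rw [Finset.sum_eq_single_of_mem s hs]
  · rw [sub_self, sum_character _ (by omega) (by omega), if_pos rfl]
    field_simp
  · intro t ht hts
    rw [Finset.mem_range] at hs ht
    rw [sum_character _ (by omega) (by omega), if_neg (by omega), mul_zero]

lemma parseval_dft (x : Signal) :
    ∑ j ∈ Finset.range (n + 1), ‖dft n x j‖ ^ 2 = ∑ t ∈ Finset.range (n + 1), ‖x (t : ℤ)‖ ^ 2 := by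
  have h : ((∑ j ∈ Finset.range (n + 1), ‖dft n x j‖ ^ 2 : ℝ) : ℂ)
      = ((∑ t ∈ Finset.range (n + 1), ‖x (t : ℤ)‖ ^ 2 : ℝ) : ℂ) := by
    push_cast
    simp_rw [← Complex.conj_mul']
    calc ∑ j ∈ Finset.range (n + 1), conj (dft n x j) * dft n x j
        = ∑ j ∈ Finset.range (n + 1), ∑ t ∈ Finset.range (n + 1), conj (x (t : ℤ)) *
          (dft n x j * (((Real.sqrt ((n : ℝ) + 1))⁻¹ : ℂ) * character n j (-(t : ℤ)))) := by
          refine Finset.sum_congr rfl fun j _ => ?_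
          have hc : conj (dft n x j) = ∑ t ∈ Finset.range (n + 1),
              ((Real.sqrt ((n : ℝ) + 1))⁻¹ : ℂ) * (conj (x (t : ℤ)) * character n j (-(t : ℤ))) := by
            rw [dft_eq, map_mul, map_sum, Finset.mul_sum]
            refine Finset.sum_congr rfl fun t _ => ?_
            rw [map_mul, conj_character, map_inv₀, Complex.conj_ofReal]
          rw [hc, Finset.sum_mul]
          exact Finset.sum_congr rfl fun t _ => by ring
      _ = _ := by
          rw [Finset.sum_comm]
          refine Finset.sum_congr rfl fun t ht => ?_
          rw [← Finset.mul_sum, dft_inversion x ht]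
  exact_mod_cast h

/-- The Fourier atoms supported on `[-k, n - k]`, of unit `ℓ₂`-norm. -/
noncomputable def atom (n k j : ℕ) : Signal := fun τ =>
  if τ ∈ Finset.Icc (-(k : ℤ)) ((n : ℤ) - k) then
    ((Real.sqrt ((n : ℝ) + 1))⁻¹ : ℂ) * character n j (-(τ + k)) else 0

lemma supportedOn_atom (k j : ℕ) : SupportedOn (-(k : ℤ)) ((n : ℤ) - k) (atom n k j) := by
  intro t ht
  rw [atom, if_neg]
  simpa using ht

lemma norm_atom_sq_le (k j : ℕ) (τ : ℤ) : ‖atom n k j τ‖ ^ 2 ≤ 1 / ((n : ℝ) + 1) := by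
  rw [atom]
  split_ifs
  · rw [norm_mul, norm_character, mul_one, norm_inv, Complex.norm_real, Real.norm_eq_abs,
      inv_pow, sq_abs, Real.sq_sqrt (by positivity), one_div]
  · simp
    positivity

lemma card_window (n k : ℕ) : (Finset.Icc (-(k : ℤ)) ((n : ℤ) - k)).card = n + 1 := by
  rw [Int.card_Icc]
  omega

lemma sum_norm_atom_sq_le (k j : ℕ) :
    ∑ τ ∈ Finset.Icc (-(k : ℤ)) ((n : ℤ) - k), ‖atom n k j τ‖ ^ 2 ≤ 1 := by
  refine (Finset.sum_le_card_nsmul _ _ _ fun τ _ => norm_atom_sq_le k j τ).trans ?_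
  rw [card_window, nsmul_eq_mul]
  push_cast
  rw [mul_one_div_cancel (by positivity)]

/-- Fourier inversion on the window. It turns the constraint on the Fourier ℓ₁-norm into a bound on
the coefficients over n + 1 deterministic filters. -/
lemma SupportedOn.eq_sum_atom {k : ℕ} {ψ : Signal}
    (h : SupportedOn (-(k : ℤ)) ((n : ℤ) - k) ψ) :
    ψ = ∑ j ∈ Finset.range (n + 1), dft n (shift k ψ) j • atom n k j := by
  ext τ
  rw [Finset.sum_apply]
  simp only [Pi.smul_apply, smul_eq_mul, atom]
  split_ifs with hτ
  · rw [Finset.mem_Icc] at hτ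
    obtain ⟨s, hs⟩ := Int.eq_ofNat_of_zero_le (show 0 ≤ τ + k by omega)
    rw [hs, dft_inversion (shift k ψ) (Finset.mem_range.mpr (by omega)), shift, ← hs]
    congr 1
    ring
  · rw [h τ (by simpa using hτ)]
    simp

lemma sum_range_eq_sum_window {M : Type*} [AddCommMonoid M] (n k : ℕ) (f : ℤ → M) :
    ∑ t ∈ Finset.range (n + 1), f ((t : ℤ) - k)
      = ∑ τ ∈ Finset.Icc (-(k : ℤ)) ((n : ℤ) - k), f τ := by
  refine Finset.sum_nbij (fun t : ℕ => (t : ℤ) - k) ?_ ?_ ?_ (fun _ _ => rfl)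
  · intro t ht
    simp only [Finset.mem_range, Finset.mem_Icc] at ht ⊢
    omega
  · intro s _ t _ h
    simpa using h
  · intro τ hτ
    simp only [Finset.coe_Icc, Set.mem_Icc] at hτ
    refine ⟨(τ + k).toNat, ?_, ?_⟩
    · simp only [Finset.coe_range, Set.mem_Iio]
      omega
    · simp only
      omega

lemma norm_dft_shift {k : ℕ} {ψ : Signal} (h : SupportedOn (-(k : ℤ)) ((n : ℤ) - k) ψ) (j : ℕ) :
    ‖dft n (shift k ψ) j‖
      = (Real.sqrt ((n : ℝ) + 1))⁻¹ * ‖conv ψ (fun t => character n j (-t)) 0‖ := by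
  have h1 : ∑ t ∈ Finset.range (n + 1), shift k ψ (t : ℤ) * character n j t
      = character n j k * conv ψ (fun t => character n j (-t)) 0 := by
    rw [h.conv_apply, Finset.mul_sum, ← sum_range_eq_sum_window]
    refine Finset.sum_congr rfl fun t _ => ?_
    rw [shift, mul_left_comm, ← character_add]
    congr 2
    ring
  rw [dft_eq, h1, norm_mul, norm_mul, norm_character, one_mul, norm_inv, Complex.norm_real,
    Real.norm_eq_abs, abs_of_nonneg (Real.sqrt_nonneg _)]

/-- Characters are eigenvectors of convolution. The eigenvalue, up to a phase and the factor
(n+1)^(-1/2), is the Fourier coefficient of the filter. -/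
lemma SupportedOn.conv_character {a b : ℤ} {ψ : Signal} (h : SupportedOn a b ψ) (j : ℕ) :
    SignalDenoising.conv ψ (fun t => character n j (-t))
      = SignalDenoising.conv ψ (fun t => character n j (-t)) 0
        • (fun t => character n j (-t) : Signal) := by
  ext t
  rw [Pi.smul_apply, smul_eq_mul, h.conv_apply, h.conv_apply, Finset.sum_mul]
  refine Finset.sum_congr rfl fun τ _ => ?_
  rw [mul_assoc, ← character_add]
  congr 2
  ring

/-- The `ℓ₁`-norm of the Fourier transform of a self-convolution. -/
lemma fourierL1Norm_shift_conv_self {k : ℕ} {φ : Signal} {a b : ℤ} (h : SupportedOn a b φ)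
    (h1 : -(k : ℤ) ≤ a) (h2 : b ≤ (n : ℤ) - k) (h3 : -(k : ℤ) ≤ a + a)
    (h4 : b + b ≤ (n : ℤ) - k) :
    fourierL1Norm n (shift k (conv φ φ))
      = Real.sqrt ((n : ℝ) + 1) * ∑ τ ∈ Finset.Icc a b, ‖φ τ‖ ^ 2 := by
  have hφ : SupportedOn (-(k : ℤ)) ((n : ℤ) - k) φ := h.mono h1 h2
  have hs : ∑ τ ∈ Finset.Icc a b, ‖φ τ‖ ^ 2
      = ∑ j ∈ Finset.range (n + 1), ‖dft n (shift k φ) j‖ ^ 2 := by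
    rw [parseval_dft]
    simp only [shift]
    rw [sum_range_eq_sum_window n k (fun τ => ‖φ τ‖ ^ 2)]
    refine Finset.sum_subset (Finset.Icc_subset_Icc h1 h2) fun τ _ hτ => ?_
    rw [h τ (by simpa using hτ)]
    simp
  rw [hs, fourierL1Norm, Finset.mul_sum]
  refine Finset.sum_congr rfl fun j _ => ?_
  have hN : 0 < Real.sqrt ((n : ℝ) + 1) := Real.sqrt_pos.mpr (by positivity)
  have h0 : character n j (-0) = 1 := by simp [character]
  -- Convolving twice squares the eigenvalue. The support of `conv φ φ` fits in the window, so there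
  -- is no aliasing and the squared eigenvalue really gives its Fourier coefficient.
  have hc : conv (conv φ φ) (fun t => character n j (-t)) 0
      = conv φ (fun t => character n j (-t)) 0 * conv φ (fun t => character n j (-t)) 0 := by
    calc _ = conv φ (conv φ (fun t => character n j (-t)) 0
          • (fun t => character n j (-t) : Signal)) 0 := by
          rw [h.conv_assoc h, ← h.conv_character j]
      _ = _ := by rw [h.conv_smul, Pi.smul_apply, smul_eq_mul]
  rw [norm_dft_shift ((h.conv h).mono h3 h4), norm_dft_shift hφ, hc, norm_mul]
  field_simp

end Fourier

/-! ### Reduction to finitely many noise coordinates -/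

section NoiseSpace

/-- The Euclidean space of the values of a sequence on `[-n, n]`. -/
abbrev NoiseSpace (n : ℕ) : Type := EuclideanSpace ℂ (Finset.Icc (-(n : ℤ)) (n : ℤ))

/-- Restriction of a sequence to `[-n, n]`. -/
noncomputable def restr (n : ℕ) : Signal →ₗ[ℂ] NoiseSpace n where
  toFun u := WithLp.toLp 2 fun t => u t
  map_add' _ _ := rfl
  map_smul' _ _ := rfl

/-- Restriction of a sequence to `[-k, n - k]`, as a vector indexed by `[-n, n]`. -/
noncomputable def window (n k : ℕ) : Signal →ₗ[ℂ] NoiseSpace n where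
  toFun u := WithLp.toLp 2 fun t =>
    if (t : ℤ) ∈ Finset.Icc (-(k : ℤ)) ((n : ℤ) - k) then u t else 0
  map_add' u v := by
    ext t
    simp only [PiLp.add_apply, Pi.add_apply]
    split_ifs <;> simp
  map_smul' r u := by
    ext t
    simp only [PiLp.smul_apply, Pi.smul_apply]
    split_ifs <;> simp

/-- The matrix of `z ↦ window n k (conv ψ z)` in the coordinates `[-n, n]`. -/
noncomputable def filterOp (n k : ℕ) (ψ : Signal) : NoiseSpace n →L[ℂ] NoiseSpace n :=
  LinearMap.toContinuousLinearMap
    { toFun := fun z => WithLp.toLp 2 fun t =>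
        if (t : ℤ) ∈ Finset.Icc (-(k : ℤ)) ((n : ℤ) - k) then
          ∑ s : Finset.Icc (-(n : ℤ)) (n : ℤ), ψ ((t : ℤ) - (s : ℤ)) * z s
        else 0
      map_add' := fun u v => by
        ext t
        simp only [PiLp.add_apply, mul_add, Finset.sum_add_distrib]
        split_ifs <;> simp
      map_smul' := fun r u => by
        ext t
        simp only [PiLp.smul_apply, smul_eq_mul, RingHom.id_apply]
        split_ifs
        · rw [Finset.mul_sum]
          exact Finset.sum_congr rfl fun s _ => by ring
        · simp }

variable {n k : ℕ}

lemma restr_apply (u : Signal) (t : Finset.Icc (-(n : ℤ)) (n : ℤ)) : restr n u t = u t := rfl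

lemma window_apply (u : Signal) (t : Finset.Icc (-(n : ℤ)) (n : ℤ)) : window n k u t =
    if (t : ℤ) ∈ Finset.Icc (-(k : ℤ)) ((n : ℤ) - k) then u t else 0 := rfl

lemma filterOp_apply (ψ : Signal) (z : NoiseSpace n) (t : Finset.Icc (-(n : ℤ)) (n : ℤ)) :
    filterOp n k ψ z t = if (t : ℤ) ∈ Finset.Icc (-(k : ℤ)) ((n : ℤ) - k) then
      ∑ s : Finset.Icc (-(n : ℤ)) (n : ℤ), ψ ((t : ℤ) - (s : ℤ)) * z s else 0 := rfl

lemma inner_window_left (u : Signal) {q : NoiseSpace n}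
    (hq : ∀ t : Finset.Icc (-(n : ℤ)) (n : ℤ),
      (t : ℤ) ∉ Finset.Icc (-(k : ℤ)) ((n : ℤ) - k) → q t = 0) :
    inner ℂ (window n k u) q = inner ℂ (restr n u) q := by
  simp only [PiLp.inner_apply]
  refine Finset.sum_congr rfl fun t _ => ?_
  rw [window_apply, restr_apply]
  split_ifs with h
  · rfl
  · simp [hq t h]

lemma sum_window_subtype {M : Type*} [AddCommMonoid M] (hk : k ≤ n) (f : ℤ → M) :
    ∑ t : Finset.Icc (-(n : ℤ)) (n : ℤ),
      (if (t : ℤ) ∈ Finset.Icc (-(k : ℤ)) ((n : ℤ) - k) then f t else 0)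
      = ∑ t ∈ Finset.Icc (-(k : ℤ)) ((n : ℤ) - k), f t := by
  rw [Finset.sum_coe_sort (Finset.Icc (-(n : ℤ)) (n : ℤ))
    (fun t => if t ∈ Finset.Icc (-(k : ℤ)) ((n : ℤ) - k) then f t else 0), Finset.sum_ite_mem]
  congr 1
  exact Finset.inter_eq_right.mpr (Finset.Icc_subset_Icc (by omega) (by omega))

lemma norm_window_sq (hk : k ≤ n) (u : Signal) :
    ‖window n k u‖ ^ 2 = ∑ t ∈ Finset.Icc (-(k : ℤ)) ((n : ℤ) - k), ‖u t‖ ^ 2 := by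
  rw [EuclideanSpace.norm_sq_eq, ← sum_window_subtype hk]
  refine Finset.sum_congr rfl fun t _ => ?_
  rw [window_apply]
  split_ifs <;> simp

lemma l2Norm_shift_eq (hk : k ≤ n) (u : Signal) : l2Norm n (shift k u) = ‖window n k u‖ := by
  rw [← Real.sqrt_sq (norm_nonneg (window n k u)), norm_window_sq hk, l2Norm,
    ← sum_range_eq_sum_window]
  rfl

lemma filterOp_restr {ψ : Signal} (h : SupportedOn (-(k : ℤ)) ((n : ℤ) - k) ψ) (z : Signal) :
    filterOp n k ψ (restr n z) = window n k (conv ψ z) := by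
  ext t
  rw [filterOp_apply, window_apply]
  split_ifs with ht
  -- If the output time t and the lag t - u both lie in [-k, n - k], then u lies in [-n, n]. This is
  -- why these 2n + 1 coordinates suffice.
  · rw [conv_eq_sum_window z t (Finset.Icc (-(n : ℤ)) (n : ℤ)),
      ← Finset.sum_coe_sort (Finset.Icc (-(n : ℤ)) (n : ℤ))]
    · rfl
    · intro u hu
      refine h _ ?_
      rw [Finset.mem_Icc] at hu ht
      rw [Set.mem_Icc]
      omega
  · rfl

lemma filterOp_single (ψ : Signal) (s t : Finset.Icc (-(n : ℤ)) (n : ℤ)) :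
    filterOp n k ψ (EuclideanSpace.single s (1 : ℂ)) t
      = if (t : ℤ) ∈ Finset.Icc (-(k : ℤ)) ((n : ℤ) - k) then ψ ((t : ℤ) - (s : ℤ)) else 0 := by
  rw [filterOp_apply]
  split_ifs
  · rw [Finset.sum_eq_single s]
    · simp
    · intro u _ hus
      simp [hus]
    · simp
  · rfl

/-- The squared Hilbert-Schmidt norm: each of the n + 1 nonzero rows is a translate of part of the
filter. -/
lemma sum_norm_sq_filterOp_single_le (hk : k ≤ n) {ψ : Signal} {a b : ℤ}
    (h : SupportedOn a b ψ) :
    ∑ s, ‖filterOp n k ψ (EuclideanSpace.single s (1 : ℂ))‖ ^ 2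
      ≤ ((n : ℝ) + 1) * ∑ τ ∈ Finset.Icc a b, ‖ψ τ‖ ^ 2 := by
  simp_rw [EuclideanSpace.norm_sq_eq, filterOp_single]
  rw [Finset.sum_comm]
  calc _ ≤ ∑ t : Finset.Icc (-(n : ℤ)) (n : ℤ),
        (if (t : ℤ) ∈ Finset.Icc (-(k : ℤ)) ((n : ℤ) - k) then
          ∑ τ ∈ Finset.Icc a b, ‖ψ τ‖ ^ 2 else 0) := by
        refine Finset.sum_le_sum fun t _ => ?_
        split_ifs
        · rw [Finset.sum_coe_sort (Finset.Icc (-(n : ℤ)) (n : ℤ))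
            (fun s => ‖ψ ((t : ℤ) - s)‖ ^ 2)]
          exact h.sum_norm_sq_sub_le _ _
        · simp
    _ = _ := by
        rw [sum_window_subtype hk (fun _ => ∑ τ ∈ Finset.Icc a b, ‖ψ τ‖ ^ 2), Finset.sum_const,
          card_window, nsmul_eq_mul]
        push_cast
        rfl

lemma trace_filterOp (hk : k ≤ n) (ψ : Signal) :
    ∑ s, inner ℂ (EuclideanSpace.single s (1 : ℂ))
      (filterOp n k ψ (EuclideanSpace.single s (1 : ℂ))) = ((n : ℂ) + 1) * ψ 0 := by
  simp_rw [EuclideanSpace.inner_single_left, filterOp_single]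
  simp only [map_one, one_mul, sub_self]
  rw [sum_window_subtype hk (fun _ => ψ 0), Finset.sum_const, card_window, nsmul_eq_mul]
  push_cast
  rfl

/-- The linear form `z ↦ [ψ * z]_t`. -/
noncomputable def convForm (n : ℕ) (ψ : Signal) (t : ℤ) : NoiseSpace n :=
  WithLp.toLp 2 fun s => conj (ψ (t - (s : ℤ)))

/-- The two conditions on t say that t - τ stays in [-n, n] for every lag τ in [a, b]. -/
lemma inner_convForm {a b : ℤ} {ψ : Signal} (h : SupportedOn a b ψ) (z : Signal) {t : ℤ}
    (h1 : t ≤ n + a) (h2 : b - n ≤ t) :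
    inner ℂ (convForm n ψ t) (restr n z) = conv ψ z t := by
  rw [conv_eq_sum_window z t (Finset.Icc (-(n : ℤ)) (n : ℤ)),
    ← Finset.sum_coe_sort (Finset.Icc (-(n : ℤ)) (n : ℤ)), PiLp.inner_apply]
  · refine Finset.sum_congr rfl fun s _ => ?_
    simp [convForm, restr_apply, mul_comm]
  · intro u hu
    refine h _ ?_
    rw [Finset.mem_Icc] at hu
    rw [Set.mem_Icc]
    omega

lemma norm_convForm_sq_le {a b : ℤ} {ψ : Signal} (h : SupportedOn a b ψ) (t : ℤ) :
    ‖convForm n ψ t‖ ^ 2 ≤ ∑ τ ∈ Finset.Icc a b, ‖ψ τ‖ ^ 2 := by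
  rw [EuclideanSpace.norm_sq_eq]
  refine le_trans (le_of_eq ?_) (h.sum_norm_sq_sub_le t (Finset.Icc (-(n : ℤ)) (n : ℤ)))
  rw [← Finset.sum_coe_sort (Finset.Icc (-(n : ℤ)) (n : ℤ))]
  simp [convForm]

lemma norm_convForm_sq {a b : ℤ} {ψ : Signal} (h : SupportedOn a b ψ) {t : ℤ}
    (h1 : t ≤ n + a) (h2 : b - n ≤ t) :
    ‖convForm n ψ t‖ ^ 2 = ∑ τ ∈ Finset.Icc a b, ‖ψ τ‖ ^ 2 := by
  have : ∑ τ ∈ Finset.Icc a b, ‖ψ τ‖ ^ 2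
      = ∑ s ∈ Finset.Icc (t - b) (t - a), ‖ψ (t - s)‖ ^ 2 := by
    refine Finset.sum_nbij' (fun τ => t - τ) (fun s => t - s) ?_ ?_ ?_ ?_ ?_
    · intro τ hτ
      rw [Finset.mem_Icc] at hτ ⊢
      omega
    · intro τ hτ
      rw [Finset.mem_Icc] at hτ ⊢
      omega
    · intro τ _; ring
    · intro τ _; ring
    · intro τ _; simp
  rw [this, EuclideanSpace.norm_sq_eq]
  have h3 : ∑ s ∈ Finset.Icc (t - b) (t - a), ‖ψ (t - s)‖ ^ 2
      = ∑ s ∈ Finset.Icc (-(n : ℤ)) (n : ℤ), ‖ψ (t - s)‖ ^ 2 := by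
    refine Finset.sum_subset (Finset.Icc_subset_Icc (by omega) (by omega)) fun s _ hs => ?_
    rw [h (t - s)]
    · simp
    · rw [Finset.mem_Icc] at hs
      rw [Set.mem_Icc]
      omega
  rw [h3, ← Finset.sum_coe_sort (Finset.Icc (-(n : ℤ)) (n : ℤ))]
  simp [convForm]

lemma measurable_restr : Measurable (restr n) := by
  have : Measurable fun u : Signal => fun t : Finset.Icc (-(n : ℤ)) (n : ℤ) => u t :=
    measurable_pi_lambda _ fun t => measurable_pi_apply _
  exact measurable_toLp_complex.comp this

variable {Ω : Type*} [MeasurableSpace Ω] {P : Measure Ω} {ζ : ℤ → Ω → ℂ}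

lemma IsStdComplexNoise.measurable_path (hζ : IsStdComplexNoise P ζ) :
    Measurable fun ω t => ζ t ω :=
  measurable_pi_lambda _ hζ.measurable

lemma IsStdComplexNoise.map_restr [IsProbabilityMeasure P] (hζ : IsStdComplexNoise P ζ) :
    P.map (fun ω => restr n fun t => ζ t ω) = complexGaussian (Finset.Icc (-(n : ℤ)) (n : ℤ)) := by
  have hind : iIndepFun (fun t : Finset.Icc (-(n : ℤ)) (n : ℤ) => ζ (t : ℤ)) P :=
    hζ.indep.precomp Subtype.val_injective
  have h := (iIndepFun_iff_map_fun_eq_pi_map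
    (fun t : Finset.Icc (-(n : ℤ)) (n : ℤ) => (hζ.measurable t).aemeasurable)).mp hind
  simp_rw [hζ.law] at h
  have hm : Measurable fun ω => fun t : Finset.Icc (-(n : ℤ)) (n : ℤ) => ζ (t : ℤ) ω :=
    measurable_pi_lambda _ fun t => hζ.measurable t
  rw [complexGaussian, ← h, Measure.map_map measurable_toLp_complex hm]
  rfl

end NoiseSpace

/-! ### Orthogonal projections of Gaussian vectors -/

section Projection

variable {ι : Type*} [Fintype ι]

lemma norm_sq_starProjection_eq_sum (V : Submodule ℂ (EuclideanSpace ℂ ι))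
    (z : EuclideanSpace ℂ ι) :
    ‖V.starProjection z‖ ^ 2
      = ∑ i, ‖inner ℂ (stdOrthonormalBasis ℂ V i : EuclideanSpace ℂ ι) z‖ ^ 2 := by
  have h1 : ‖V.starProjection z‖ = ‖V.orthogonalProjectionOnto z‖ := rfl
  rw [h1, ← (stdOrthonormalBasis ℂ V).sum_sq_norm_inner_right]
  refine Finset.sum_congr rfl fun i _ => ?_
  rw [Submodule.coe_inner, ← Submodule.starProjection_apply]
  congr 2
  rw [← Submodule.inner_starProjection_left_eq_right, Submodule.starProjection_eq_self_iff.mpr]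
  exact Submodule.coe_mem _

lemma sum_norm_sq_starProjection_single [DecidableEq ι]
    (V : Submodule ℂ (EuclideanSpace ℂ ι)) :
    ∑ s, ‖V.starProjection (EuclideanSpace.single s (1 : ℂ))‖ ^ 2 = Module.finrank ℂ V := by
  simp_rw [norm_sq_starProjection_eq_sum]
  rw [Finset.sum_comm]
  have : ∀ i, ∑ s, ‖inner ℂ (stdOrthonormalBasis ℂ V i : EuclideanSpace ℂ ι)
      (EuclideanSpace.single s (1 : ℂ))‖ ^ 2 = 1 := by
    intro i
    have h1 : ‖(stdOrthonormalBasis ℂ V i : EuclideanSpace ℂ ι)‖ = 1 :=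
      (stdOrthonormalBasis ℂ V).orthonormal.1 i
    have h2 := norm_sq_eq_sum_inner_single (stdOrthonormalBasis ℂ V i : EuclideanSpace ℂ ι)
    rw [h1, one_pow] at h2
    rw [h2]
    exact Finset.sum_congr rfl fun s _ => by rw [norm_inner_symm]
  simp [this]

lemma measure_norm_sq_starProjection_gt_le (V : Submodule ℂ (EuclideanSpace ℂ ι)) {s : ℕ}
    (hs : Module.finrank ℂ V ≤ s) {δ : ℝ} (hδ : 0 < δ) :
    complexGaussian ι {z | 4 * Real.log (2 ^ s / δ) < ‖V.starProjection z‖ ^ 2}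
      ≤ ENNReal.ofReal δ := by
  have h := measure_sum_inner_sq_gt_le_of_contraction
    (fun i => (stdOrthonormalBasis ℂ V i : EuclideanSpace ℂ ι)) (fun g => by
      have h1 : ∑ i, g i • (stdOrthonormalBasis ℂ V i : EuclideanSpace ℂ ι)
          = (((stdOrthonormalBasis ℂ V).repr.symm g : V) : EuclideanSpace ℂ ι) := by
        rw [← OrthonormalBasis.sum_repr_symm]
        simp
      rw [h1]
      exact ((stdOrthonormalBasis ℂ V).repr.symm.norm_map g).le) hδ
  refine (measure_mono fun z hz => ?_).trans h
  rw [Set.mem_ofPred_eq, ← norm_sq_starProjection_eq_sum, Fintype.card_fin]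
  refine lt_of_le_of_lt ?_ hz
  have h2 : (2 : ℝ) ^ Module.finrank ℂ V ≤ 2 ^ s := pow_le_pow_right₀ one_le_two hs
  have h3 : Real.log (2 ^ Module.finrank ℂ V / δ) ≤ Real.log (2 ^ s / δ) :=
    Real.log_le_log (by positivity) (by gcongr)
  linarith

lemma norm_sub_starProjection_le (V : Submodule ℂ (EuclideanSpace ℂ ι))
    (z : EuclideanSpace ℂ ι) : ‖z - V.starProjection z‖ ≤ ‖z‖ := by
  rw [← Submodule.starProjection_orthogonal_val]
  exact Submodule.norm_starProjection_apply_le _ _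

lemma inner_sub_starProjection (V : Submodule ℂ (EuclideanSpace ℂ ι))
    (w q : EuclideanSpace ℂ ι) :
    inner ℂ (w - V.starProjection w) q = inner ℂ w (q - V.starProjection q) := by
  rw [inner_sub_left, inner_sub_right, Submodule.inner_starProjection_left_eq_right]

/-- Deviation bound for a Gaussian quadratic form composed with an orthogonal projection. -/
lemma measure_norm_inner_sub_starProjection_gt_le [DecidableEq ι]
    (V : Submodule ℂ (EuclideanSpace ℂ ι))
    {s : ℕ} (hs : Module.finrank ℂ V ≤ s) (M : EuclideanSpace ℂ ι →L[ℂ] EuclideanSpace ℂ ι)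
    {B T δ : ℝ} (hB : 0 < B) (hM : ∑ s, ‖M (EuclideanSpace.single s (1 : ℂ))‖ ^ 2 ≤ B)
    (hT : ‖∑ s, inner ℂ (EuclideanSpace.single s (1 : ℂ))
          (M (EuclideanSpace.single s (1 : ℂ)))‖ ≤ T) (hδ : 0 < δ) :
    complexGaussian ι {z | 2 * (Real.sqrt (8 * B) * Real.log (2 / δ)
        + 2 * (T + Real.sqrt s * Real.sqrt B)) < ‖inner ℂ z (M z - V.starProjection (M z))‖}
      ≤ 4 * ENNReal.ofReal δ := by
  refine measure_norm_quadratic_gt_le (M - V.starProjection ∘L M) hB ?_ ?_ hδ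
  · refine le_trans (Finset.sum_le_sum fun t _ => ?_) hM
    exact pow_le_pow_left₀ (norm_nonneg _) (norm_sub_starProjection_le V _) 2
  -- The projection changes the trace by tr(PM). Cauchy-Schwarz in the Hilbert-Schmidt inner product
  -- bounds it by √s √B, since the squared Hilbert-Schmidt norm of P is its rank.
  · have h1 : ∑ t, inner ℂ (EuclideanSpace.single t (1 : ℂ))
        ((M - V.starProjection ∘L M) (EuclideanSpace.single t (1 : ℂ)))
        = ∑ t, inner ℂ (EuclideanSpace.single t (1 : ℂ)) (M (EuclideanSpace.single t (1 : ℂ)))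
          - ∑ t, inner ℂ (V.starProjection (EuclideanSpace.single t (1 : ℂ)))
              (M (EuclideanSpace.single t (1 : ℂ))) := by
      rw [← Finset.sum_sub_distrib]
      refine Finset.sum_congr rfl fun t _ => ?_
      rw [Submodule.inner_starProjection_left_eq_right, ← inner_sub_right]
      rfl
    rw [h1]
    refine (norm_sub_le _ _).trans (add_le_add hT ?_)
    calc _ ≤ ∑ t, ‖V.starProjection (EuclideanSpace.single t (1 : ℂ))‖
          * ‖M (EuclideanSpace.single t (1 : ℂ))‖ :=
          (norm_sum_le _ _).trans (Finset.sum_le_sum fun t _ => norm_inner_le_norm _ _)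
      _ ≤ Real.sqrt (∑ t, ‖V.starProjection (EuclideanSpace.single t (1 : ℂ))‖ ^ 2)
          * Real.sqrt (∑ t, ‖M (EuclideanSpace.single t (1 : ℂ))‖ ^ 2) :=
          Real.sum_mul_le_sqrt_mul_sqrt _ _ _
      _ ≤ _ := by
          rw [sum_norm_sq_starProjection_single]
          gcongr

end Projection

/-! ### The windowed subspace -/

section Window

variable {n k : ℕ}

lemma window_apply_of_notMem (u : Signal) (t : Finset.Icc (-(n : ℤ)) (n : ℤ))
    (ht : (t : ℤ) ∉ Finset.Icc (-(k : ℤ)) ((n : ℤ) - k)) : window n k u t = 0 := by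
  rw [window_apply, if_neg ht]

/-- The windows of the members of a subspace of sequences. -/
noncomputable def windowSpace (n k : ℕ) (S : Submodule ℂ Signal) : Submodule ℂ (NoiseSpace n) :=
  S.map (window n k)

lemma windowSpace_apply_of_notMem (S : Submodule ℂ Signal) {q : NoiseSpace n}
    (hq : q ∈ windowSpace n k S) (t : Finset.Icc (-(n : ℤ)) (n : ℤ))
    (ht : (t : ℤ) ∉ Finset.Icc (-(k : ℤ)) ((n : ℤ) - k)) : q t = 0 := by
  obtain ⟨u, _, rfl⟩ := hq
  exact window_apply_of_notMem u t ht

/-- Every element of the windowed subspace vanishes off the window, so the projection does not see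
the other coordinates. -/
lemma starProjection_window (S : Submodule ℂ Signal) (u : Signal) :
    (windowSpace n k S).starProjection (window n k u)
      = (windowSpace n k S).starProjection (restr n u) := by
  rw [← sub_eq_zero, ← map_sub, Submodule.starProjection_apply_eq_zero_iff,
    Submodule.mem_orthogonal']
  intro q hq
  rw [inner_sub_left, inner_window_left u (windowSpace_apply_of_notMem S hq), sub_self]

/-- Moves the projection and the cut-off onto the second argument. With v a filtered noise, the
product becomes a quadratic form in the full noise vector. -/
lemma inner_window_sub_starProjection (S : Submodule ℂ Signal) (u v : Signal) :
    inner ℂ (window n k u - (windowSpace n k S).starProjection (window n k u)) (window n k v)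
      = inner ℂ (restr n u)
        (window n k v - (windowSpace n k S).starProjection (window n k v)) := by
  rw [inner_sub_starProjection]
  refine inner_window_left u fun t ht => ?_
  rw [PiLp.sub_apply, window_apply_of_notMem v t ht,
    windowSpace_apply_of_notMem S (Submodule.starProjection_apply_mem _ _) t ht, sub_zero]

lemma finrank_windowSpace_le (S : Submodule ℂ Signal) [FiniteDimensional ℂ S] :
    Module.finrank ℂ (windowSpace n k S) ≤ Module.finrank ℂ S :=
  Submodule.finrank_map_le _ _

lemma norm_atom_zero_le (j : ℕ) : ‖((n : ℂ) + 1) * atom n k j 0‖ ≤ Real.sqrt ((n : ℝ) + 1) := by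
  have h1 : ‖(n : ℂ) + 1‖ = (n : ℝ) + 1 := by
    rw [← Nat.cast_add_one, Complex.norm_natCast]
    push_cast
    rfl
  rw [norm_mul, h1]
  refine Real.le_sqrt_of_sq_le ?_
  rw [mul_pow]
  calc _ ≤ ((n : ℝ) + 1) ^ 2 * (1 / ((n : ℝ) + 1)) := by
        gcongr
        exact norm_atom_sq_le k j 0
    _ = _ := by field_simp

lemma measure_atom_quadratic_gt_le (hk : k ≤ n) (V : Submodule ℂ (NoiseSpace n)) {s : ℕ}
    (hs : Module.finrank ℂ V ≤ s) (j : ℕ) {δ : ℝ} (hδ : 0 < δ) :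
    complexGaussian _ {z | 2 * (Real.sqrt (8 * ((n : ℝ) + 1)) * Real.log (2 / δ)
        + 2 * (Real.sqrt ((n : ℝ) + 1) + Real.sqrt s * Real.sqrt ((n : ℝ) + 1)))
        < ‖inner ℂ z (filterOp n k (atom n k j) z
            - V.starProjection (filterOp n k (atom n k j) z))‖}
      ≤ 4 * ENNReal.ofReal δ := by
  refine measure_norm_inner_sub_starProjection_gt_le V hs _ (by positivity) ?_ ?_ hδ
  · refine (sum_norm_sq_filterOp_single_le hk (supportedOn_atom k j)).trans ?_
    exact mul_le_of_le_one_right (by positivity) (sum_norm_atom_sq_le k j)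
  · rw [trace_filterOp hk]
    exact norm_atom_zero_le j

end Window

/-! ### Union bounds -/

section GoodSet

/-- The budget of 16 events leaves room for the nine that are used, and matches the constant in
log(16/α). -/
lemma exists_good_set {E : Type*} [MeasurableSpace E] {μ : Measure E} [IsProbabilityMeasure μ]
    {α : ℝ} (hα : 0 < α) {N : ℕ} (hN : N ≤ 16) (B : Fin N → Set E)
    (hm : ∀ i, MeasurableSet (B i)) (hB : ∀ i, μ (B i) ≤ ENNReal.ofReal (α / 16)) :
    ∃ G : Set E, MeasurableSet G ∧ ENNReal.ofReal (1 - α) ≤ μ G ∧ ∀ z ∈ G, ∀ i, z ∉ B i := by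
  refine ⟨(⋃ i, B i)ᶜ, (MeasurableSet.iUnion hm).compl, ?_, ?_⟩
  · have h1 : μ (⋃ i, B i) ≤ ENNReal.ofReal α := by
      calc μ (⋃ i, B i) ≤ ∑ i, μ (B i) := measure_iUnion_fintype_le _ _
        _ ≤ ∑ _ : Fin N, ENNReal.ofReal (α / 16) := Finset.sum_le_sum fun i _ => hB i
        _ = ENNReal.ofReal (N * (α / 16)) := by
            rw [Finset.sum_const, Finset.card_univ, Fintype.card_fin, nsmul_eq_mul,
              ENNReal.ofReal_mul (by positivity), ENNReal.ofReal_natCast]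
        _ ≤ ENNReal.ofReal α := by
            refine ENNReal.ofReal_le_ofReal ?_
            have : (N : ℝ) ≤ 16 := by exact_mod_cast hN
            nlinarith
    rw [measure_compl (MeasurableSet.iUnion hm) (measure_ne_top _ _), measure_univ,
      ENNReal.ofReal_sub _ hα.le, ENNReal.ofReal_one]
    exact tsub_le_tsub_left h1 1
  · intro z hz i hi
    exact hz (Set.mem_iUnion.mpr ⟨i, hi⟩)

lemma measure_biUnion_le_mul {E κ : Type*} [MeasurableSpace E] {μ : Measure E} (s : Finset κ)
    (B : κ → Set E) {c : ℝ} {δ : ℝ} (hB : ∀ i ∈ s, μ (B i) ≤ ENNReal.ofReal c)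
    (hs : s.card * c ≤ δ) : μ (⋃ i ∈ s, B i) ≤ ENNReal.ofReal δ := by
  calc μ (⋃ i ∈ s, B i) ≤ ∑ i ∈ s, μ (B i) := measure_biUnion_finset_le _ _
    _ ≤ ∑ _ ∈ s, ENNReal.ofReal c := Finset.sum_le_sum hB
    _ = ENNReal.ofReal (s.card * c) := by
        rw [Finset.sum_const, nsmul_eq_mul, ENNReal.ofReal_mul (by positivity),
          ENNReal.ofReal_natCast]
    _ ≤ ENNReal.ofReal δ := ENNReal.ofReal_le_ofReal hs

end GoodSet

/-! ### The simultaneous noise event -/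

section Events

variable {n k : ℕ}

/-- The event that a sum of squared linear forms of total energy `v` is large. -/
def squareExcess {κ : Type*} (s : Finset κ) (c : κ → NoiseSpace n) (v δ : ℝ) :
    Set (NoiseSpace n) :=
  {z | 4 * v * Real.log (2 / δ) < ∑ i ∈ s, ‖inner ℂ (c i) z‖ ^ 2}

/-- The event that the quadratic form of a Fourier atom, projected off `V`, is large. -/
def atomExcess (n k : ℕ) (V : Submodule ℂ (NoiseSpace n)) (s : ℕ) (δ : ℝ) (j : ℕ) :
    Set (NoiseSpace n) :=
  {z | 2 * (Real.sqrt (8 * ((n : ℝ) + 1)) * Real.log (2 / δ)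
        + 2 * (Real.sqrt ((n : ℝ) + 1) + Real.sqrt s * Real.sqrt ((n : ℝ) + 1)))
        < ‖inner ℂ z (filterOp n k (atom n k j) z
            - V.starProjection (filterOp n k (atom n k j) z))‖}

/-- The event that the projection onto `V` is large. -/
def projectionExcess (V : Submodule ℂ (NoiseSpace n)) (s : ℕ) (δ : ℝ) : Set (NoiseSpace n) :=
  {z | 4 * Real.log (2 ^ s / δ) < ‖V.starProjection z‖ ^ 2}

lemma notMem_squareExcess {κ : Type*} {s : Finset κ} {c : κ → NoiseSpace n} {v δ : ℝ}
    {z : NoiseSpace n} : z ∉ squareExcess s c v δ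
      ↔ ∑ i ∈ s, ‖inner ℂ (c i) z‖ ^ 2 ≤ 4 * v * Real.log (2 / δ) := by
  rw [squareExcess, Set.mem_ofPred_eq, not_lt]

lemma notMem_atomExcess {V : Submodule ℂ (NoiseSpace n)} {s : ℕ} {δ : ℝ} {j : ℕ}
    {z : NoiseSpace n} : z ∉ atomExcess n k V s δ j
      ↔ ‖inner ℂ z (filterOp n k (atom n k j) z
            - V.starProjection (filterOp n k (atom n k j) z))‖
        ≤ 2 * (Real.sqrt (8 * ((n : ℝ) + 1)) * Real.log (2 / δ)
          + 2 * (Real.sqrt ((n : ℝ) + 1) + Real.sqrt s * Real.sqrt ((n : ℝ) + 1))) := by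
  rw [atomExcess, Set.mem_ofPred_eq, not_lt]

lemma measurableSet_squareExcess {κ : Type*} (s : Finset κ) (c : κ → NoiseSpace n) (v δ : ℝ) :
    MeasurableSet (squareExcess s c v δ) :=
  measurableSet_lt measurable_const (Continuous.measurable (by fun_prop))

lemma measurableSet_atomExcess (V : Submodule ℂ (NoiseSpace n)) (s : ℕ) (δ : ℝ) (j : ℕ) :
    MeasurableSet (atomExcess n k V s δ j) :=
  measurableSet_lt measurable_const (Continuous.measurable (by fun_prop))

lemma measurableSet_projectionExcess (V : Submodule ℂ (NoiseSpace n)) (s : ℕ) (δ : ℝ) :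
    MeasurableSet (projectionExcess V s δ) :=
  measurableSet_lt measurable_const (Continuous.measurable (by fun_prop))

/-- The n + 1 atoms cost 4δ each. The quadratic power of n + 1 in δ is more than needed here; it
serves the family of linear forms indexed by pairs of a time and an atom. -/
lemma measure_biUnion_atomExcess_le (hk : k ≤ n) (V : Submodule ℂ (NoiseSpace n)) {s : ℕ}
    (hs : Module.finrank ℂ V ≤ s) {α : ℝ} (hα : 0 < α) :
    complexGaussian _ (⋃ j ∈ Finset.range (n + 1),
      atomExcess n k V s (α / (64 * ((n : ℝ) + 1) ^ 2)) j) ≤ ENNReal.ofReal (α / 16) := by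
  have hδ : 0 < α / (64 * ((n : ℝ) + 1) ^ 2) := by positivity
  refine measure_biUnion_le_mul _ _ (c := 4 * (α / (64 * ((n : ℝ) + 1) ^ 2)))
    (fun j _ => ?_) ?_
  · rw [ENNReal.ofReal_mul (by norm_num)]
    rw [ENNReal.ofReal_ofNat]
    exact measure_atom_quadratic_gt_le hk V hs j hδ
  · rw [Finset.card_range]
    push_cast
    have h1 : (1 : ℝ) ≤ (n : ℝ) + 1 := by linarith [n.cast_nonneg (α := ℝ)]
    calc _ = α / 16 * (1 / ((n : ℝ) + 1)) := by field_simp; norm_num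
      _ ≤ α / 16 * 1 := by
          gcongr
          rw [div_le_one (by positivity)]
          exact h1
      _ = _ := mul_one _

lemma measure_biUnion_squareExcess_le {κ : Type*} (T : Finset κ)
    (hT : T.card ≤ (n + 1) ^ 2) (c : κ → NoiseSpace n) (hc : ∀ i, ‖c i‖ ^ 2 ≤ 1)
    {α : ℝ} (hα : 0 < α) :
    complexGaussian _ (⋃ i ∈ T, squareExcess {i} c 1 (α / (64 * ((n : ℝ) + 1) ^ 2)))
      ≤ ENNReal.ofReal (α / 16) := by
  have hδ : 0 < α / (64 * ((n : ℝ) + 1) ^ 2) := by positivity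
  refine measure_biUnion_le_mul _ _ (c := α / (64 * ((n : ℝ) + 1) ^ 2))
    (fun i _ => ?_) ?_
  · exact measure_sum_inner_sq_gt_le {i} c zero_le_one (by simpa using hc i) hδ
  · have h1 : (T.card : ℝ) ≤ ((n : ℝ) + 1) ^ 2 := by exact_mod_cast hT
    calc _ ≤ ((n : ℝ) + 1) ^ 2 * (α / (64 * ((n : ℝ) + 1) ^ 2)) := by gcongr
      _ = α / 64 := by field_simp
      _ ≤ _ := by linarith

/-- The simultaneous noise bounds used in the analysis of the estimator. -/
structure NoiseBounds (n k : ℕ) (S : Submodule ℂ Signal) (s : ℕ) (α : ℝ)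
    (T₁ T₂ T₃ : Finset ℤ) (c₁ c₂ c₃ : ℤ → NoiseSpace n) (v₁ v₂ v₃ : ℝ)
    (b q : NoiseSpace n) (e : ℝ) (T : Finset ℤ) (z : Signal) : Prop where
  family₁ : ∑ t ∈ T₁, ‖inner ℂ (c₁ t) (restr n z)‖ ^ 2 ≤ 4 * v₁ * Real.log (2 / (α / 16))
  family₂ : ∑ t ∈ T₂, ‖inner ℂ (c₂ t) (restr n z)‖ ^ 2 ≤ 4 * v₂ * Real.log (2 / (α / 16))
  family₃ : ∑ t ∈ T₃, ‖inner ℂ (c₃ t) (restr n z)‖ ^ 2 ≤ 4 * v₃ * Real.log (2 / (α / 16))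
  bias : ‖inner ℂ b (restr n z)‖ ^ 2 ≤ 4 * ‖b‖ ^ 2 * Real.log (2 / (α / 16))
  residual : ‖inner ℂ q (restr n z)‖ ^ 2 ≤ 4 * e * Real.log (2 / (α / 16))
  projection : ‖(windowSpace n k S).starProjection (window n k z)‖ ^ 2
    ≤ 4 * Real.log (2 ^ s / (α / 16))
  atom_quadratic : ∀ j ∈ Finset.range (n + 1),
    ‖inner ℂ (window n k z) (window n k (conv (atom n k j) z))‖
      ≤ 2 * (Real.sqrt (8 * ((n : ℝ) + 1))
          * Real.log (2 / (α / (64 * ((n : ℝ) + 1) ^ 2)))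
        + 2 * Real.sqrt ((n : ℝ) + 1))
  atom_quadratic_sub : ∀ j ∈ Finset.range (n + 1),
    ‖inner ℂ (window n k z - (windowSpace n k S).starProjection (window n k z))
        (window n k (conv (atom n k j) z))‖
      ≤ 2 * (Real.sqrt (8 * ((n : ℝ) + 1))
          * Real.log (2 / (α / (64 * ((n : ℝ) + 1) ^ 2)))
        + 2 * (Real.sqrt ((n : ℝ) + 1) + Real.sqrt s * Real.sqrt ((n : ℝ) + 1)))
  atom_linear : ∀ t ∈ T, ∀ j ∈ Finset.range (n + 1),
    ‖conv (atom n k j) z t‖ ^ 2 ≤ 4 * Real.log (2 / (α / (64 * ((n : ℝ) + 1) ^ 2)))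

lemma exists_noiseBounds {Ω : Type*} [MeasurableSpace Ω] {P : Measure Ω}
    [IsProbabilityMeasure P] {ζ : ℤ → Ω → ℂ} (hζ : IsStdComplexNoise P ζ) (hk : k ≤ n)
    (S : Submodule ℂ Signal) {s : ℕ} (hs : Module.finrank ℂ (windowSpace n k S) ≤ s)
    {α : ℝ} (hα : 0 < α) (T₁ T₂ T₃ : Finset ℤ) (c₁ c₂ c₃ : ℤ → NoiseSpace n) {v₁ v₂ v₃ : ℝ}
    (hv₁ : 0 ≤ v₁) (hv₂ : 0 ≤ v₂) (hv₃ : 0 ≤ v₃)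
    (h₁ : ∑ t ∈ T₁, ‖c₁ t‖ ^ 2 ≤ v₁) (h₂ : ∑ t ∈ T₂, ‖c₂ t‖ ^ 2 ≤ v₂)
    (h₃ : ∑ t ∈ T₃, ‖c₃ t‖ ^ 2 ≤ v₃) (b q : NoiseSpace n) {e : ℝ} (hq : ‖q‖ ^ 2 ≤ e)
    (T : Finset ℤ) (hT : T.card ≤ n + 1)
    (hTk : ∀ t ∈ T, -(k : ℤ) ≤ t ∧ t ≤ (n : ℤ) - k) :
    ∃ Ξ : Set Signal, MeasurableSet Ξ ∧ ENNReal.ofReal (1 - α) ≤ P {ω | (fun t => ζ t ω) ∈ Ξ} ∧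
      ∀ z ∈ Ξ, NoiseBounds n k S s α T₁ T₂ T₃ c₁ c₂ c₃ v₁ v₂ v₃ b q e T z := by
  set δ := α / (64 * ((n : ℝ) + 1) ^ 2) with hδ
  set γ := complexGaussian (Finset.Icc (-(n : ℤ)) (n : ℤ)) with hγ
  have hα16 : 0 < α / 16 := by positivity
  have he : 0 ≤ e := (sq_nonneg _).trans hq
  let cf : ℤ × ℕ → NoiseSpace n := fun p => convForm n (atom n k p.2) p.1
  have hcf : ∀ p, ‖cf p‖ ^ 2 ≤ 1 := fun p =>
    (norm_convForm_sq_le (supportedOn_atom k p.2) p.1).trans (sum_norm_atom_sq_le k p.2)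
  have hcard : (T ×ˢ Finset.range (n + 1)).card ≤ (n + 1) ^ 2 := by
    rw [Finset.card_product, Finset.card_range, sq]
    exact Nat.mul_le_mul_right _ hT
  -- With V = ⊥ and s = 0 the projected bound specialises to the quadratic forms without projection.
  have hbot : Module.finrank ℂ (⊥ : Submodule ℂ (NoiseSpace n)) ≤ 0 := by simp
  let B : Fin 9 → Set (NoiseSpace n) := ![squareExcess T₁ c₁ v₁ (α / 16),
    squareExcess T₂ c₂ v₂ (α / 16), squareExcess T₃ c₃ v₃ (α / 16),
    squareExcess {()} (fun _ => b) (‖b‖ ^ 2) (α / 16), squareExcess {()} (fun _ => q) e (α / 16),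
    projectionExcess (windowSpace n k S) s (α / 16),
    ⋃ j ∈ Finset.range (n + 1), atomExcess n k ⊥ 0 δ j,
    ⋃ j ∈ Finset.range (n + 1), atomExcess n k (windowSpace n k S) s δ j,
    ⋃ p ∈ T ×ˢ Finset.range (n + 1), squareExcess {p} cf 1 δ]
  have hBm : ∀ i, MeasurableSet (B i) := by
    intro i
    fin_cases i
    · exact measurableSet_squareExcess _ _ _ _
    · exact measurableSet_squareExcess _ _ _ _
    · exact measurableSet_squareExcess _ _ _ _
    · exact measurableSet_squareExcess _ _ _ _
    · exact measurableSet_squareExcess _ _ _ _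
    · exact measurableSet_projectionExcess _ _ _
    · exact Finset.measurableSet_biUnion _ fun j _ => measurableSet_atomExcess _ _ _ _
    · exact Finset.measurableSet_biUnion _ fun j _ => measurableSet_atomExcess _ _ _ _
    · exact Finset.measurableSet_biUnion _ fun p _ => measurableSet_squareExcess _ _ _ _
  have hBγ : ∀ i, γ (B i) ≤ ENNReal.ofReal (α / 16) := by
    intro i
    fin_cases i
    · exact measure_sum_inner_sq_gt_le _ _ hv₁ h₁ hα16
    · exact measure_sum_inner_sq_gt_le _ _ hv₂ h₂ hα16
    · exact measure_sum_inner_sq_gt_le _ _ hv₃ h₃ hα16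
    · exact measure_sum_inner_sq_gt_le {()} (fun _ => b) (sq_nonneg ‖b‖) (by simp) hα16
    · exact measure_sum_inner_sq_gt_le {()} (fun _ => q) he (by simpa using hq) hα16
    · exact measure_norm_sq_starProjection_gt_le _ hs hα16
    · exact measure_biUnion_atomExcess_le hk _ hbot hα
    · exact measure_biUnion_atomExcess_le hk _ hs hα
    · exact measure_biUnion_squareExcess_le _ hcard cf hcf hα
  obtain ⟨G, hGm, hGγ, hG⟩ := exists_good_set (μ := γ) hα (by norm_num) B hBm hBγ
  refine ⟨restr n ⁻¹' G, measurable_restr hGm, ?_, ?_⟩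
  · have hm : Measurable fun ω => restr n fun t => ζ t ω :=
      measurable_restr.comp hζ.measurable_path
    have h1 : P {ω | (fun t => ζ t ω) ∈ restr n ⁻¹' G} = γ G := by
      rw [hγ, ← hζ.map_restr, Measure.map_apply hm hGm]
      rfl
    rw [h1]
    exact hGγ
  · intro z hz
    have hz : ∀ i, restr n z ∉ B i := hG _ hz
    have hz3 : restr n z ∉ squareExcess {()} (fun _ => b) (‖b‖ ^ 2) (α / 16) := hz 3
    have hz4 : restr n z ∉ squareExcess {()} (fun _ => q) e (α / 16) := hz 4
    have hz5 : restr n z ∉ projectionExcess (windowSpace n k S) s (α / 16) := hz 5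
    have hz6 : restr n z ∉ ⋃ j ∈ Finset.range (n + 1), atomExcess n k ⊥ 0 δ j := hz 6
    have hz7 : restr n z ∉ ⋃ j ∈ Finset.range (n + 1),
      atomExcess n k (windowSpace n k S) s δ j := hz 7
    have hz8 : restr n z ∉ ⋃ p ∈ T ×ˢ Finset.range (n + 1), squareExcess {p} cf 1 δ := hz 8
    simp only [Set.mem_iUnion, not_exists] at hz6 hz7 hz8
    refine ⟨not_lt.mp (hz 0), not_lt.mp (hz 1), not_lt.mp (hz 2), ?_, ?_, ?_, ?_, ?_, ?_⟩
    · simpa [notMem_squareExcess] using hz3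
    · simpa [notMem_squareExcess] using hz4
    · rw [starProjection_window]
      exact not_lt.mp hz5
    · intro j hj
      have h1 := notMem_atomExcess.mp (hz6 j hj)
      rw [filterOp_restr (supportedOn_atom k j)] at h1
      rw [inner_window_left z (window_apply_of_notMem _)]
      simpa using h1
    · intro j hj
      have h1 := notMem_atomExcess.mp (hz7 j hj)
      rw [filterOp_restr (supportedOn_atom k j)] at h1
      rw [inner_window_sub_starProjection]
      exact h1
    · intro t ht j hj
      have h1 := notMem_squareExcess.mp (hz8 (t, j) (Finset.mem_product.mpr ⟨ht, hj⟩))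
      obtain ⟨h2, h3⟩ := hTk t ht
      rw [Finset.sum_singleton, inner_convForm (supportedOn_atom k j) z (by omega) (by omega)]
        at h1
      simpa using h1

end Events

/-! ### Bounds uniform over feasible filters -/

section Filters

variable {n k : ℕ} {a b : ℤ} {ψ : Signal}

lemma SupportedOn.norm_conv_le (h : SupportedOn a b ψ) (v : Signal) (t : ℤ) {B : ℝ}
    (hv : ∀ τ ∈ Finset.Icc a b, ‖v (t - τ)‖ ≤ B) :
    ‖SignalDenoising.conv ψ v t‖ ≤ (∑ τ ∈ Finset.Icc a b, ‖ψ τ‖) * B := by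
  rw [h.conv_apply, Finset.sum_mul]
  refine (norm_sum_le _ _).trans (Finset.sum_le_sum fun τ hτ => ?_)
  rw [norm_mul]
  exact mul_le_mul_of_nonneg_left (hv τ hτ) (norm_nonneg _)

lemma SupportedOn.norm_conv_sq_le (h : SupportedOn a b ψ) (v : Signal) (t : ℤ) (U : Finset ℤ)
    (hU : Finset.Icc (t - b) (t - a) ⊆ U) :
    ‖SignalDenoising.conv ψ v t‖ ^ 2
      ≤ (∑ τ ∈ Finset.Icc a b, ‖ψ τ‖ ^ 2) * ∑ u ∈ U, ‖v u‖ ^ 2 := by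
  rw [conv_eq_sum_window v t U fun u hu => h _ fun hm => hu (hU (by
    rw [Set.mem_Icc] at hm
    rw [Finset.mem_Icc]
    omega))]
  calc _ ≤ (∑ u ∈ U, ‖ψ (t - u)‖ * ‖v u‖) ^ 2 := by
        gcongr
        exact (norm_sum_le _ _).trans_eq (Finset.sum_congr rfl fun u _ => norm_mul _ _)
    _ ≤ (∑ u ∈ U, ‖ψ (t - u)‖ ^ 2) * ∑ u ∈ U, ‖v u‖ ^ 2 :=
        Finset.sum_mul_sq_le_sq_mul_sq _ _ _
    _ ≤ _ := by
        gcongr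
        exact h.sum_norm_sq_sub_le t U

lemma SupportedOn.conv_eq_sum_shift (h : SupportedOn a b ψ) (v : Signal) :
    SignalDenoising.conv ψ v = ∑ τ ∈ Finset.Icc a b, ψ τ • shift τ v := by
  ext t
  rw [h.conv_apply, Finset.sum_apply]
  rfl

lemma sum_norm_le_of_sum_norm_sq_le (s : Finset ℤ) {B : ℝ} (hB : 0 ≤ B)
    (h : s.card * ∑ τ ∈ s, ‖ψ τ‖ ^ 2 ≤ B ^ 2) : ∑ τ ∈ s, ‖ψ τ‖ ≤ B := by
  have h1 := sq_sum_le_card_mul_sum_sq (s := s) (f := fun τ => ‖ψ τ‖)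
  exact le_of_sq_le_sq (h1.trans h) hB

variable {r : ℝ}

/-- The expression is linear in ψ, so expansion in atoms reduces it to the atoms. The bound
therefore also applies to filters that depend on the noise. -/
lemma norm_inner_window_conv_le (h : ψ ∈ feasibleFilters n k r) (u : NoiseSpace n) (z : Signal)
    {Q : ℝ} (hQ : ∀ j ∈ Finset.range (n + 1), ‖inner ℂ u (window n k (conv (atom n k j) z))‖ ≤ Q) :
    ‖inner ℂ u (window n k (conv ψ z))‖ ≤ r / Real.sqrt ((n : ℝ) + 1) * Q := by
  have hQ0 : 0 ≤ Q := (norm_nonneg _).trans (hQ 0 (by simp))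
  have h1 : conv ψ z = ∑ j ∈ Finset.range (n + 1),
      dft n (shift k ψ) j • conv (atom n k j) z := by
    ext t
    conv_lhs => rw [h.1.eq_sum_atom]
    rw [conv_finset_sum _ _ _ (fun j => supportedOn_atom k j), Finset.sum_apply]
    rfl
  rw [h1, map_sum, inner_sum]
  calc _ ≤ ∑ j ∈ Finset.range (n + 1), ‖dft n (shift k ψ) j‖ * Q := by
        refine (norm_sum_le _ _).trans (Finset.sum_le_sum fun j hj => ?_)
        rw [map_smul, inner_smul_right, norm_mul]
        exact mul_le_mul_of_nonneg_left (hQ j hj) (norm_nonneg _)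
    _ = fourierL1Norm n (shift k ψ) * Q := by rw [← Finset.sum_mul, fourierL1Norm]
    _ ≤ _ := mul_le_mul_of_nonneg_right h.2 hQ0

lemma norm_conv_le_of_atom (h : ψ ∈ feasibleFilters n k r) (z : Signal) (t : ℤ)
    {Q : ℝ} (hQ : ∀ j ∈ Finset.range (n + 1), ‖conv (atom n k j) z t‖ ≤ Q) :
    ‖conv ψ z t‖ ≤ r / Real.sqrt ((n : ℝ) + 1) * Q := by
  have hQ0 : 0 ≤ Q := (norm_nonneg _).trans (hQ 0 (by simp))
  rw [h.1.eq_sum_atom, conv_finset_sum _ _ _ (fun j => supportedOn_atom k j)]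
  calc _ ≤ ∑ j ∈ Finset.range (n + 1), ‖dft n (shift k ψ) j‖ * Q := by
        refine (norm_sum_le _ _).trans (Finset.sum_le_sum fun j hj => ?_)
        rw [norm_mul]
        exact mul_le_mul_of_nonneg_left (hQ j hj) (norm_nonneg _)
    _ = fourierL1Norm n (shift k ψ) * Q := by rw [← Finset.sum_mul, fourierL1Norm]
    _ ≤ _ := mul_le_mul_of_nonneg_right h.2 hQ0

/-- Atoms have norm at most 1, so the ℓ₂-norm is at most the Fourier ℓ₁-norm. -/
lemma feasible_sum_norm_sq_le (hk : k ≤ n) (h : ψ ∈ feasibleFilters n k r) :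
    ((n : ℝ) + 1) * ∑ τ ∈ Finset.Icc (-(k : ℤ)) ((n : ℤ) - k), ‖ψ τ‖ ^ 2 ≤ r ^ 2 := by
  have hN : 0 < Real.sqrt ((n : ℝ) + 1) := Real.sqrt_pos.mpr (by positivity)
  have h1 : ‖window n k ψ‖ ≤ r / Real.sqrt ((n : ℝ) + 1) := by
    refine le_trans ?_ h.2
    conv_lhs => rw [h.1.eq_sum_atom, map_sum]
    rw [fourierL1Norm]
    refine (norm_sum_le _ _).trans (Finset.sum_le_sum fun j _ => ?_)
    rw [map_smul, norm_smul]
    refine mul_le_of_le_one_right (norm_nonneg _) ?_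
    refine le_of_sq_le_sq ?_ zero_le_one
    rw [norm_window_sq hk, one_pow]
    exact sum_norm_atom_sq_le k j
  rw [← norm_window_sq hk]
  have h2 := pow_le_pow_left₀ (norm_nonneg _) h1 2
  rw [div_pow, Real.sq_sqrt (by positivity), le_div_iff₀ (by positivity)] at h2
  linarith

lemma feasible_sum_norm_le (hk : k ≤ n) (hr : 0 ≤ r) (h : ψ ∈ feasibleFilters n k r) :
    ∑ τ ∈ Finset.Icc (-(k : ℤ)) ((n : ℤ) - k), ‖ψ τ‖ ≤ r := by
  refine sum_norm_le_of_sum_norm_sq_le _ hr ?_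
  rw [card_window]
  exact_mod_cast feasible_sum_norm_sq_le hk h

end Filters

/-! ### Shift-invariant subspaces -/

section ShiftInvariant

variable {S : Submodule ℂ Signal}

/-- The shift is injective on a finite-dimensional space that it preserves, hence bijective there.
The backward shifts are needed because filters may have negative lags. -/
lemma shift_mem_of_shift_one_mem [FiniteDimensional ℂ S] (h : ∀ u ∈ S, shift 1 u ∈ S)
    (τ : ℤ) : ∀ u ∈ S, shift τ u ∈ S := by
  let T : S →ₗ[ℂ] S :=
    { toFun := fun u => ⟨shift 1 u, h u u.2⟩
      map_add' := fun _ _ => rfl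
      map_smul' := fun _ _ => rfl }
  have hinj : Function.Injective T := by
    intro u v huv
    have h1 : shift 1 (u : Signal) = shift 1 (v : Signal) := congrArg Subtype.val huv
    ext t
    have h2 := congrFun h1 (t + 1)
    simpa [shift] using h2
  have hsurj : Function.Surjective T := LinearMap.injective_iff_surjective.mp hinj
  have hneg : ∀ u ∈ S, shift (-1) u ∈ S := by
    intro u hu
    obtain ⟨v, hv⟩ := hsurj ⟨u, hu⟩
    have h1 : shift 1 (v : Signal) = u := congrArg Subtype.val hv
    have h2 : shift (-1) u = v := by
      rw [← h1]
      ext t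
      simp [shift]
    rw [h2]
    exact v.2
  have hadd : ∀ (p q : ℤ) (u : Signal), shift (p + q) u = shift p (shift q u) := by
    intro p q u
    ext t
    simp only [shift]
    congr 1
    ring
  induction τ using Int.induction_on with
  | zero =>
    intro u hu
    have : shift 0 u = u := by ext t; simp [shift]
    rwa [this]
  | succ i ih =>
    intro u hu
    rw [hadd]
    exact ih _ (h u hu)
  | pred i ih =>
    intro u hu
    rw [sub_eq_add_neg, hadd]
    exact ih _ (hneg u hu)

lemma conv_mem_of_shift_mem {a b : ℤ} {ψ : Signal} (hψ : SupportedOn a b ψ)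
    (h : ∀ τ : ℤ, ∀ u ∈ S, shift τ u ∈ S) {u : Signal} (hu : u ∈ S) : conv ψ u ∈ S := by
  rw [hψ.conv_eq_sum_shift]
  exact Submodule.sum_mem _ fun τ _ => S.smul_mem _ (h τ u hu)

end ShiftInvariant

/-! ### The oracle filter and its self-convolution -/

section Oracle

variable {Ω : Type*} [MeasurableSpace Ω] {P : Measure Ω} [IsProbabilityMeasure P]
  {ζ : ℤ → Ω → ℂ} {m n k₀ : ℕ} {ρ σ : ℝ} {x : Signal}

/-- Bias-variance decomposition of a filter. -/
lemma integral_norm_sq_sub_conv_observe (hζ : IsStdComplexNoise P ζ) {φ : Signal} {a b : ℤ}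
    (hφ : SupportedOn a b φ) {t : ℤ} (h1 : t ≤ n + a) (h2 : b - n ≤ t) :
    ∫ ω, ‖x t - conv φ (observe x σ (fun u => ζ u ω)) t‖ ^ 2 ∂P
      = ‖x t - conv φ x t‖ ^ 2 + 2 * (σ ^ 2 * ∑ τ ∈ Finset.Icc a b, ‖φ τ‖ ^ 2) := by
  have hm : Measurable fun ω => restr n fun t => ζ t ω :=
    measurable_restr.comp hζ.measurable_path
  have h := integral_norm_sq_add_inner (x t - conv φ x t) (-(σ : ℂ) • convForm n φ t)
  rw [← hζ.map_restr, integral_map hm.aemeasurable (by fun_prop)] at h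
  rw [norm_smul, mul_pow, norm_convForm_sq hφ h1 h2] at h
  simp only [norm_neg, Complex.norm_real, Real.norm_eq_abs, sq_abs] at h
  rw [← h]
  refine integral_congr_ae (ae_of_all _ fun ω => ?_)
  simp only
  rw [hφ.conv_observe, inner_smul_left, inner_convForm hφ _ h1 h2]
  simp only [Pi.add_apply, Pi.smul_apply, smul_eq_mul, map_neg, Complex.conj_ofReal]
  congr 2
  ring

/-- Squared bias and variance are both nonnegative, so each is bounded separately by the risk. -/
lemma Interpolable.exists_filter (hζ : IsStdComplexNoise P ζ) (hσ : 0 < σ) (hn : n = 2 * m)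
    (h : Interpolable P ζ σ m n k₀ ρ x) :
    ∃ φ : Signal, SupportedOn (-(k₀ : ℤ)) ((m : ℤ) - k₀) φ ∧
      2 * ((m : ℝ) + 1) * ∑ τ ∈ Finset.Icc (-(k₀ : ℤ)) ((m : ℤ) - k₀), ‖φ τ‖ ^ 2 ≤ ρ ∧
      ∀ t : ℤ, -(m : ℤ) - k₀ ≤ t → t ≤ (n : ℤ) - k₀ →
        ((m : ℝ) + 1) * ‖(x - conv φ x) t‖ ^ 2 ≤ ρ * σ ^ 2 := by
  obtain ⟨hρ, hk, φ, hφ, hb⟩ := h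
  have hm : (0 : ℝ) < (m : ℝ) + 1 := by positivity
  have key : ∀ t : ℤ, -(m : ℤ) - k₀ ≤ t → t ≤ (n : ℤ) - k₀ → ((m : ℝ) + 1)
      * (‖x t - conv φ x t‖ ^ 2
        + 2 * (σ ^ 2 * ∑ τ ∈ Finset.Icc (-(k₀ : ℤ)) ((m : ℤ) - k₀), ‖φ τ‖ ^ 2)) ≤ ρ * σ ^ 2 := by
    intro t h1 h2
    have h3 := hb t h1 h2
    rw [integral_norm_sq_sub_conv_observe (n := n) hζ hφ (by omega) (by omega),
      le_div_iff₀ hm] at h3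
    linarith
  have hE : 0 ≤ ∑ τ ∈ Finset.Icc (-(k₀ : ℤ)) ((m : ℤ) - k₀), ‖φ τ‖ ^ 2 :=
    Finset.sum_nonneg fun _ _ => by positivity
  refine ⟨φ, hφ, ?_, ?_⟩
  -- The variance does not depend on t, so one admissible time is enough.
  · have h1 := key (-k₀) (by omega) (by omega)
    have h2 : 0 ≤ ((m : ℝ) + 1) * ‖x (-(k₀ : ℤ)) - conv φ x (-(k₀ : ℤ))‖ ^ 2 := by positivity
    have h3 : 0 < σ ^ 2 := by positivity
    refine le_of_mul_le_mul_right ?_ h3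
    linarith
  · intro t h1 h2
    have h3 := key t h1 h2
    have h4 : 0 ≤ ((m : ℝ) + 1)
        * (2 * (σ ^ 2 * ∑ τ ∈ Finset.Icc (-(k₀ : ℤ)) ((m : ℤ) - k₀), ‖φ τ‖ ^ 2)) := by positivity
    rw [Pi.sub_apply]
    linarith

/-- The self-convolution of an oracle filter is feasible. -/
lemma conv_self_mem_feasibleFilters (hn : n = 2 * m) (hρ : 0 ≤ ρ) {φ : Signal} (hk : k₀ ≤ m)
    (hφ : SupportedOn (-(k₀ : ℤ)) ((m : ℤ) - k₀) φ)
    (hE : 2 * ((m : ℝ) + 1) * ∑ τ ∈ Finset.Icc (-(k₀ : ℤ)) ((m : ℤ) - k₀), ‖φ τ‖ ^ 2 ≤ ρ) :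
    conv φ φ ∈ feasibleFilters n (2 * k₀) (2 * ρ) := by
  have hN : 0 < Real.sqrt ((n : ℝ) + 1) := Real.sqrt_pos.mpr (by positivity)
  have hE0 : 0 ≤ ∑ τ ∈ Finset.Icc (-(k₀ : ℤ)) ((m : ℤ) - k₀), ‖φ τ‖ ^ 2 :=
    Finset.sum_nonneg fun _ _ => by positivity
  refine ⟨(hφ.conv hφ).mono (by push_cast; omega) (by push_cast; omega), ?_⟩
  -- What remains is (2m+1)‖φ‖² ≤ 2ρ, which the energy bound gives with a factor 2 to spare.
  rw [fourierL1Norm_shift_conv_self hφ (by push_cast; omega) (by push_cast; omega)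
    (by push_cast; omega) (by push_cast; omega), le_div_iff₀ hN, mul_right_comm,
    Real.mul_self_sqrt (by positivity), hn]
  push_cast
  linarith

/-- Bias of the self-convolution of an oracle filter. -/
lemma norm_sub_conv_self_le (hn : n = 2 * m) (hσ : 0 < σ) (hρ : 1 ≤ ρ) {φ : Signal}
    (hφ : SupportedOn (-(k₀ : ℤ)) ((m : ℤ) - k₀) φ)
    (hE : 2 * ((m : ℝ) + 1) * ∑ τ ∈ Finset.Icc (-(k₀ : ℤ)) ((m : ℤ) - k₀), ‖φ τ‖ ^ 2 ≤ ρ)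
    (hb : ∀ t : ℤ, -(m : ℤ) - k₀ ≤ t → t ≤ (n : ℤ) - k₀ →
        ((m : ℝ) + 1) * ‖(x - conv φ x) t‖ ^ 2 ≤ ρ * σ ^ 2)
    {t : ℤ} (h1 : -(2 * k₀ : ℤ) ≤ t) (h2 : t ≤ (n : ℤ) - 2 * k₀) (hk : k₀ ≤ m) :
    ((m : ℝ) + 1) * ‖(x - conv (conv φ φ) x) t‖ ^ 2 ≤ 4 * ρ ^ 2 * σ ^ 2 := by
  have hm : (0 : ℝ) < (m : ℝ) + 1 := by positivity
  set u := x - conv φ x with hu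
  set B := Real.sqrt (ρ * σ ^ 2 / ((m : ℝ) + 1)) with hB
  have hB2 : B ^ 2 = ρ * σ ^ 2 / ((m : ℝ) + 1) := Real.sq_sqrt (by positivity)
  have hub : ∀ t : ℤ, -(m : ℤ) - k₀ ≤ t → t ≤ (n : ℤ) - k₀ → ‖u t‖ ≤ B := by
    intro t h1 h2
    refine Real.le_sqrt_of_sq_le ?_
    rw [le_div_iff₀ hm, mul_comm]
    exact hb t h1 h2
  -- Factorisation 1 - φ * φ = (1 + φ) * (1 - φ). As the ℓ₁-norm of φ is at most √ρ, the bias grows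
  -- by a factor at most 1 + √ρ ≤ 2√ρ.
  have h3 : x - conv (conv φ φ) x = u + conv φ u := by
    rw [hu, hφ.conv_sub, hφ.conv_assoc hφ]
    abel
  have h4 : ∑ τ ∈ Finset.Icc (-(k₀ : ℤ)) ((m : ℤ) - k₀), ‖φ τ‖ ≤ Real.sqrt ρ := by
    refine sum_norm_le_of_sum_norm_sq_le _ (Real.sqrt_nonneg _) ?_
    rw [Real.sq_sqrt (by linarith), card_window]
    push_cast
    have : 0 ≤ ∑ τ ∈ Finset.Icc (-(k₀ : ℤ)) ((m : ℤ) - k₀), ‖φ τ‖ ^ 2 :=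
      Finset.sum_nonneg fun _ _ => by positivity
    nlinarith
  have h5 : ‖conv φ u t‖ ≤ Real.sqrt ρ * B := by
    refine (hφ.norm_conv_le u t (B := B) fun τ hτ => ?_).trans
      (mul_le_mul_of_nonneg_right h4 (Real.sqrt_nonneg _))
    rw [Finset.mem_Icc] at hτ
    exact hub _ (by omega) (by omega)
  have hs1 : 1 ≤ Real.sqrt ρ := Real.one_le_sqrt.mpr hρ
  have hB0 : 0 ≤ B := Real.sqrt_nonneg _
  have h6 : ‖(x - conv (conv φ φ) x) t‖ ≤ 2 * Real.sqrt ρ * B := by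
    rw [h3, Pi.add_apply]
    have := hub t (by omega) (by omega)
    refine (norm_add_le _ _).trans ?_
    nlinarith
  have h7 := pow_le_pow_left₀ (norm_nonneg _) h6 2
  rw [mul_pow, mul_pow, Real.sq_sqrt (by linarith), hB2] at h7
  calc _ ≤ ((m : ℝ) + 1) * (2 ^ 2 * ρ * (ρ * σ ^ 2 / ((m : ℝ) + 1))) := by gcongr
    _ = _ := by field_simp; norm_num

end Oracle

/-! ### Comparison of logarithmic factors -/

section Logarithms

variable {α : ℝ}

lemma log_two_div_sixteenth (hα : 0 < α) :
    Real.log (2 / (α / 16)) = 5 * Real.log 2 + Real.log (1 / α) := by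
  rw [show 2 / (α / 16) = 2 ^ 5 * (1 / α) by field_simp; norm_num,
    Real.log_mul (by norm_num) (by positivity), Real.log_pow]
  norm_num

lemma log_one_div_nonneg (hα : 0 < α) (hα1 : α < 1) : 0 ≤ Real.log (1 / α) :=
  Real.log_nonneg (by rw [le_div_iff₀ hα]; linarith)

lemma log_two_div_sixteenth_le (hα : 0 < α) (hα1 : α < 1) :
    Real.log (2 / (α / 16)) ≤ 4 * (1 + Real.log (1 / α)) := by
  rw [log_two_div_sixteenth hα]
  linarith [Real.log_two_lt_d9, log_one_div_nonneg hα hα1]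

lemma log_sixteen_div (hα : 0 < α) :
    Real.log (16 / α) = 4 * Real.log 2 + Real.log (1 / α) := by
  rw [show 16 / α = 2 ^ 4 * (1 / α) by field_simp; norm_num,
    Real.log_mul (by norm_num) (by positivity), Real.log_pow]
  norm_num

lemma log_two_div_sixteenth_le' (hα : 0 < α) (hα1 : α < 1) :
    Real.log (2 / (α / 16)) ≤ 2 * Real.log (16 / α) := by
  rw [log_two_div_sixteenth hα, log_sixteen_div hα]
  linarith [Real.log_two_gt_d9, log_one_div_nonneg hα hα1]

lemma log_two_pow_div_sixteenth_le (hα : 0 < α) (hα1 : α < 1) (s : ℕ) :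
    Real.log (2 ^ s / (α / 16)) ≤ s + 3 * (1 + Real.log (1 / α)) := by
  rw [show (2 : ℝ) ^ s / (α / 16) = 2 ^ s * (16 / α) by field_simp,
    Real.log_mul (by positivity) (by positivity), Real.log_pow, log_sixteen_div hα]
  have := s.cast_nonneg (α := ℝ)
  nlinarith [Real.log_two_lt_d9, log_one_div_nonneg hα hα1]

lemma log_add_div {n : ℕ} (hn : 2 ≤ n) (hα : 0 < α) :
    Real.log (((n : ℝ) + n) / α) = Real.log ((n : ℝ) + n) + Real.log (1 / α) := by
  have : (0 : ℝ) < n := by positivity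
  rw [← Real.log_mul (by positivity) (by positivity), mul_one_div]

lemma two_mul_log_two_le_log {n : ℕ} (hn : 2 ≤ n) : 2 * Real.log 2 ≤ Real.log ((n : ℝ) + n) := by
  have h : (2 : ℝ) ≤ n := by exact_mod_cast hn
  have : Real.log (2 ^ 2) ≤ Real.log ((n : ℝ) + n) :=
    Real.log_le_log (by norm_num) (by linarith)
  rwa [Real.log_pow] at this

lemma one_le_log_add_div {n : ℕ} (hn : 2 ≤ n) (hα : 0 < α) (hα1 : α < 1) :
    1 ≤ Real.log (((n : ℝ) + n) / α) := by
  rw [log_add_div hn hα]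
  linarith [two_mul_log_two_le_log hn, Real.log_two_gt_d9, log_one_div_nonneg hα hα1]

/-- The constant 7 log 2 and the term 2 log(n+1) are absorbed using log(2n) ≥ 2 log 2 for n ≥ 2. -/
lemma log_union_le {n : ℕ} (hn : 2 ≤ n) (hα : 0 < α) (hα1 : α < 1) :
    Real.log (2 / (α / (64 * ((n : ℝ) + 1) ^ 2))) ≤ 6 * Real.log (((n : ℝ) + n) / α) := by
  have h1 : Real.log (2 / (α / (64 * ((n : ℝ) + 1) ^ 2)))
      = 7 * Real.log 2 + 2 * Real.log ((n : ℝ) + 1) + Real.log (1 / α) := by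
    rw [show 2 / (α / (64 * ((n : ℝ) + 1) ^ 2)) = 2 ^ 7 * ((n : ℝ) + 1) ^ 2 * (1 / α) by
      field_simp; norm_num, Real.log_mul (by positivity) (by positivity),
      Real.log_mul (by positivity) (by positivity), Real.log_pow, Real.log_pow]
    norm_num
  have h2 : Real.log ((n : ℝ) + 1) ≤ Real.log ((n : ℝ) + n) := by
    have : (2 : ℝ) ≤ n := by exact_mod_cast hn
    exact Real.log_le_log (by positivity) (by linarith)
  rw [h1, log_add_div hn hα]
  linarith [two_mul_log_two_le_log hn, Real.log_two_gt_d9, log_one_div_nonneg hα hα1]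

end Logarithms

/-! ### The basic inequality of least squares -/

section LeastSquares

/-- The basic inequality for least squares, with the noise split along a subspace. -/
lemma norm_sq_le_of_norm_add_smul_sq_le {ι : Type*} [Fintype ι]
    (V : Submodule ℂ (EuclideanSpace ℂ ι)) {w d d₀ : EuclideanSpace ℂ ι} {σ : ℝ} (hσ : 0 < σ)
    (h : ‖d + (σ : ℂ) • w‖ ^ 2 ≤ ‖d₀ + (σ : ℂ) • w‖ ^ 2) :
    ‖d‖ ^ 2 ≤ ‖d₀‖ ^ 2 + 2 * σ * ‖inner ℂ w d₀‖
      + 2 * σ * (‖V.starProjection w‖ * ‖d‖) + 2 * σ * ‖inner ℂ (w - V.starProjection w) d‖ := by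
  have hre : ∀ u : EuclideanSpace ℂ ι,
      ‖u + (σ : ℂ) • w‖ ^ 2 = ‖u‖ ^ 2 + 2 * σ * (inner ℂ w u).re + ‖(σ : ℂ) • w‖ ^ 2 := by
    intro u
    rw [norm_add_sq (𝕜 := ℂ), inner_smul_right, RCLike.re_eq_complex_re, Complex.re_ofReal_mul,
      ← inner_conj_symm u w, Complex.conj_re]
    ring
  rw [hre, hre] at h
  have h1 : inner ℂ w d = inner ℂ (V.starProjection w) d
      + inner ℂ (w - V.starProjection w) d := by
    rw [← inner_add_left, add_sub_cancel]
  have h2 : -‖inner ℂ w d‖ ≤ (inner ℂ w d).re := (abs_le.mp (Complex.abs_re_le_norm _)).1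
  have h3 : ‖inner ℂ w d‖
      ≤ ‖V.starProjection w‖ * ‖d‖ + ‖inner ℂ (w - V.starProjection w) d‖ := by
    rw [h1]
    exact (norm_add_le _ _).trans (add_le_add_left (norm_inner_le_norm _ _) _)
  have h4 := Complex.re_le_norm (inner ℂ w d₀)
  nlinarith

/-- The cross term 2σpD is split as D²/2 + 2σ²p². Moving D²/2 to the left doubles the constant 320
that collects the other terms. -/
lemma quadratic_inequality_bound {D σ ρ L l K s d₀ w₀ p r : ℝ} (hσ : 0 < σ)
    (hρ : 1 ≤ ρ) (hL : 1 ≤ L) (hl : 0 ≤ l) (hK : 0 ≤ K) (hs : 0 ≤ s)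
    (h : D ^ 2 ≤ d₀ + 2 * σ * w₀ + 2 * σ * (p * D) + 2 * σ * r)
    (hd₀ : d₀ ≤ σ ^ 2 * (16 * ρ ^ 2 + 128 * (ρ ^ 2 * L)))
    (hw₀ : w₀ ≤ σ * (12 * (ρ * L) + 80 * (ρ * l)))
    (hp : p ^ 2 ≤ 4 * (s + 3 * L))
    (hr : r ≤ σ * (9 * (ρ * K) + (80 * (ρ * l) + 4 * ρ ^ 2 + 4 * s))) :
    D ^ 2 ≤ 640 * (σ ^ 2 * (ρ ^ 2 * L + (ρ * l + ρ * K + s))) := by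
  have h1 : 2 * σ * (p * D) ≤ D ^ 2 / 2 + 2 * σ ^ 2 * p ^ 2 := by
    nlinarith [sq_nonneg (D - 2 * σ * p)]
  have h2 : 2 * σ ^ 2 * p ^ 2 ≤ 2 * σ ^ 2 * (4 * (s + 3 * L)) := by gcongr
  have h3 : 2 * σ * w₀ ≤ 2 * σ * (σ * (12 * (ρ * L) + 80 * (ρ * l))) := by gcongr
  have h4 : 2 * σ * r ≤ 2 * σ * (σ * (9 * (ρ * K) + (80 * (ρ * l) + 4 * ρ ^ 2 + 4 * s))) := by
    gcongr
  have hρ2 : 1 ≤ ρ ^ 2 := one_le_pow₀ hρ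
  have hρρ : ρ ≤ ρ ^ 2 := by nlinarith
  have hL0 : 0 ≤ L := by linarith
  have h5 : ρ * L ≤ ρ ^ 2 * L := by gcongr
  have h6 : ρ ^ 2 ≤ ρ ^ 2 * L := by nlinarith
  have h7 : L ≤ ρ ^ 2 * L := by nlinarith
  have h8 : 0 ≤ ρ * l := by positivity
  have h9 : 0 ≤ ρ * K := by positivity
  have hX : 16 * ρ ^ 2 + 128 * (ρ ^ 2 * L) + 2 * (12 * (ρ * L) + 80 * (ρ * l))
      + 2 * (4 * (s + 3 * L)) + 2 * (9 * (ρ * K) + (80 * (ρ * l) + 4 * ρ ^ 2 + 4 * s))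
      ≤ 320 * (ρ ^ 2 * L + (ρ * l + ρ * K + s)) := by linarith
  have h10 := mul_le_mul_of_nonneg_left hX (sq_nonneg σ)
  nlinarith

end LeastSquares

/-! ### The ℓ₂-risk -/

section Risk

variable {m n k₀ s : ℕ} {ρ σ κ α : ℝ} {x xS ε φ φhat z : Signal} {S : Submodule ℂ Signal}

/-- The window of a sequence, projected off the windows of a subspace. -/
noncomputable def windowResidual (n k : ℕ) (S : Submodule ℂ Signal) (u : Signal) : NoiseSpace n :=
  window n k u - (windowSpace n k S).starProjection (window n k u)

/-- The noise bounds used for the estimator with oracle filter `φ` and residual `ε`. -/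
def EstimatorNoiseBounds (m n k₀ s : ℕ) (ρ σ κ α : ℝ) (x ε φ : Signal) (S : Submodule ℂ Signal)
    (z : Signal) : Prop :=
  NoiseBounds n (2 * k₀) S s α
    (Finset.Icc (-((2 * k₀ : ℕ) : ℤ)) ((n : ℤ) - (2 * k₀ : ℕ)))
    (Finset.Icc (-(m : ℤ) - k₀) ((n : ℤ) - k₀))
    (Finset.Icc (-((2 * k₀ : ℕ) : ℤ)) ((n : ℤ) - (2 * k₀ : ℕ)))
    (convForm n (conv φ φ)) (convForm n φ) (fun τ => windowResidual n (2 * k₀) S (shift τ ε))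
    (4 * ρ ^ 2) (3 / 2 * ρ) (((n : ℝ) + 1) * (κ * σ) ^ 2)
    (window n (2 * k₀) (x - conv (conv φ φ) x)) (windowResidual n (2 * k₀) S ε) ((κ * σ) ^ 2)
    (Finset.Icc ((m : ℤ) - 3 * k₀) ((n : ℤ) - 3 * k₀)) z

lemma norm_windowResidual_le (k : ℕ) (u : Signal) :
    ‖windowResidual n k S u‖ ≤ ‖window n k u‖ :=
  norm_sub_starProjection_le _ _

/-- The window itself is a shift by k, so the total shift τ + k runs over [0, n], the range in which
the residual is controlled. -/
lemma norm_window_shift_le {k : ℕ} (hk : k ≤ n)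
    (hε : ∀ τ : ℕ, τ ≤ n → l2Norm n (shift τ ε) ≤ κ * σ) {τ : ℤ} (h1 : -(k : ℤ) ≤ τ)
    (h2 : τ ≤ (n : ℤ) - k) : ‖window n k (shift τ ε)‖ ≤ κ * σ := by
  rw [← l2Norm_shift_eq hk]
  have h3 : shift k (shift τ ε) = shift ((τ + k).toNat : ℕ) ε := by
    ext t
    simp only [shift]
    congr 1
    omega
  rw [h3]
  exact hε _ (by omega)

lemma shift_zero (u : Signal) : shift 0 u = u := by
  ext t
  simp [shift]

lemma norm_window_bias_sq_le (hn : n = 2 * m) (hσ : 0 < σ) (hρ : 1 ≤ ρ) (hk : k₀ ≤ m)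
    (hφ : SupportedOn (-(k₀ : ℤ)) ((m : ℤ) - k₀) φ)
    (hE : 2 * ((m : ℝ) + 1) * ∑ τ ∈ Finset.Icc (-(k₀ : ℤ)) ((m : ℤ) - k₀), ‖φ τ‖ ^ 2 ≤ ρ)
    (hb : ∀ t : ℤ, -(m : ℤ) - k₀ ≤ t → t ≤ (n : ℤ) - k₀ →
        ((m : ℝ) + 1) * ‖(x - conv φ x) t‖ ^ 2 ≤ ρ * σ ^ 2) :
    ‖window n (2 * k₀) (x - conv (conv φ φ) x)‖ ^ 2 ≤ 8 * ρ ^ 2 * σ ^ 2 := by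
  have hm : (0 : ℝ) < (m : ℝ) + 1 := by positivity
  rw [norm_window_sq (by omega)]
  have h1 : ∀ t ∈ Finset.Icc (-((2 * k₀ : ℕ) : ℤ)) ((n : ℤ) - (2 * k₀ : ℕ)),
      ‖(x - conv (conv φ φ) x) t‖ ^ 2 ≤ 4 * ρ ^ 2 * σ ^ 2 / ((m : ℝ) + 1) := by
    intro t ht
    rw [Finset.mem_Icc] at ht
    rw [le_div_iff₀ hm, mul_comm]
    exact norm_sub_conv_self_le hn hσ hρ hφ hE hb (by omega) (by omega) hk
  refine (Finset.sum_le_card_nsmul _ _ _ h1).trans ?_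
  rw [card_window, nsmul_eq_mul, hn]
  push_cast
  rw [← mul_div_assoc, div_le_iff₀ hm]
  have : 0 ≤ ρ ^ 2 * σ ^ 2 := by positivity
  nlinarith

lemma exists_estimatorNoiseBounds {Ω : Type*} [MeasurableSpace Ω] {P : Measure Ω}
    [IsProbabilityMeasure P] {ζ : ℤ → Ω → ℂ} (hζ : IsStdComplexNoise P ζ) (hn : n = 2 * m)
    (hρ : 1 ≤ ρ) (hk : k₀ ≤ m) [FiniteDimensional ℂ S]
    (hs : Module.finrank ℂ S = s)
    (hφ : SupportedOn (-(k₀ : ℤ)) ((m : ℤ) - k₀) φ)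
    (hE : 2 * ((m : ℝ) + 1) * ∑ τ ∈ Finset.Icc (-(k₀ : ℤ)) ((m : ℤ) - k₀), ‖φ τ‖ ^ 2 ≤ ρ)
    (hε : ∀ τ : ℕ, τ ≤ n → l2Norm n (shift τ ε) ≤ κ * σ) (hα : 0 < α) :
    ∃ Ξ : Set Signal, MeasurableSet Ξ ∧ ENNReal.ofReal (1 - α) ≤ P {ω | (fun t => ζ t ω) ∈ Ξ} ∧
      ∀ z ∈ Ξ, EstimatorNoiseBounds m n k₀ s ρ σ κ α x ε φ S z := by
  have hkn : 2 * k₀ ≤ n := by omega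
  have hfeas := conv_self_mem_feasibleFilters hn (by linarith) hk hφ hE
  have hres : ∀ τ ∈ Finset.Icc (-((2 * k₀ : ℕ) : ℤ)) ((n : ℤ) - (2 * k₀ : ℕ)),
      ‖windowResidual n (2 * k₀) S (shift τ ε)‖ ^ 2 ≤ (κ * σ) ^ 2 := by
    intro τ hτ
    rw [Finset.mem_Icc] at hτ
    refine pow_le_pow_left₀ (norm_nonneg _) ((norm_windowResidual_le _ _).trans ?_) 2
    exact norm_window_shift_le hkn hε hτ.1 hτ.2
  refine exists_noiseBounds hζ hkn S ((finrank_windowSpace_le S).trans hs.le) hα _ _ _ _ _ _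
    (by positivity) (by positivity) (by positivity) ?_ ?_ ?_ _ _ ?_ _ ?_ ?_
  -- The energy 4ρ² is (n+1)‖φ * φ‖² ≤ (2ρ)², which follows from feasibility.
  · refine (Finset.sum_le_card_nsmul _ _ _ fun t _ => norm_convForm_sq_le hfeas.1 t).trans ?_
    rw [card_window, nsmul_eq_mul]
    push_cast
    have := feasible_sum_norm_sq_le hkn hfeas
    push_cast at this
    linarith
  -- There are 3m + 1 times and ‖φ‖² ≤ ρ/(2(m+1)), whence the energy 3ρ/2.
  · refine (Finset.sum_le_card_nsmul _ _ _ fun t _ => norm_convForm_sq_le hφ t).trans ?_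
    have hc : (Finset.Icc (-(m : ℤ) - k₀) ((n : ℤ) - k₀)).card = 3 * m + 1 := by
      rw [Int.card_Icc]
      omega
    rw [hc, nsmul_eq_mul]
    push_cast
    have : 0 ≤ ∑ τ ∈ Finset.Icc (-(k₀ : ℤ)) ((m : ℤ) - k₀), ‖φ τ‖ ^ 2 :=
      Finset.sum_nonneg fun _ _ => by positivity
    nlinarith
  · refine (Finset.sum_le_card_nsmul _ _ _ hres).trans ?_
    rw [card_window, nsmul_eq_mul]
    push_cast
    rfl
  · have := hres 0 (by rw [Finset.mem_Icc]; omega)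
    rwa [shift_zero] at this
  · rw [Int.card_Icc]
    omega
  · intro t ht
    rw [Finset.mem_Icc] at ht
    omega

/-- Decomposition of the residual of a filter. -/
lemma sub_conv_observe_eq {a b : ℤ} {ψ : Signal} (hψ : SupportedOn a b ψ) :
    x - conv ψ (observe x σ z) = (x - conv ψ x) - (σ : ℂ) • conv ψ z := by
  rw [hψ.conv_observe]
  abel

lemma observe_sub_conv_eq (ψ : Signal) :
    observe x σ z - conv ψ (observe x σ z)
      = (x - conv ψ (observe x σ z)) + (σ : ℂ) • z := by
  ext t
  simp only [observe, Pi.sub_apply, Pi.add_apply, Pi.smul_apply, smul_eq_mul]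
  ring

lemma norm_inner_window_sub_proj (u v : Signal) (k : ℕ) :
    ‖inner ℂ (window n k u - (windowSpace n k S).starProjection (window n k u))
      (window n k v)‖ = ‖inner ℂ (windowResidual n k S v) (restr n u)‖ := by
  rw [inner_window_sub_starProjection, norm_inner_symm]
  rfl

/-- Expansion over the shifts of ε separates the random coefficients of φhat from fixed linear forms
in the noise. In Cauchy-Schwarz the factor 1/(n+1) from ‖φhat‖² cancels the number of shifts. -/
lemma norm_inner_window_filtered_residual_le (hn : n = 2 * m) (hρ : 1 ≤ ρ) (hk : k₀ ≤ m)
    (hκσ : 0 ≤ κ * σ) (hz : EstimatorNoiseBounds m n k₀ s ρ σ κ α x ε φ S z)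
    (hfeas : φhat ∈ feasibleFilters n (2 * k₀) (2 * ρ)) {L : ℝ} (hL : 0 ≤ L)
    (hLα : Real.log (2 / (α / 16)) ≤ 2 * L ^ 2) :
    ‖inner ℂ (window n (2 * k₀) z
        - (windowSpace n (2 * k₀) S).starProjection (window n (2 * k₀) z))
        (window n (2 * k₀) (conv φhat ε))‖ ≤ 6 * (ρ * (κ * σ * L)) := by
  set W := Finset.Icc (-((2 * k₀ : ℕ) : ℤ)) ((n : ℤ) - (2 * k₀ : ℕ)) with hW
  rw [hfeas.1.conv_eq_sum_shift, map_sum, inner_sum]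
  have hN : (0 : ℝ) < (n : ℝ) + 1 := by positivity
  have h1 : ∑ τ ∈ W, ‖φhat τ‖ ^ 2 ≤ (2 * ρ) ^ 2 / ((n : ℝ) + 1) := by
    rw [le_div_iff₀ hN, mul_comm]
    exact feasible_sum_norm_sq_le (by omega) hfeas
  have h2 := hz.family₃
  refine le_of_sq_le_sq ?_ (by positivity)
  calc _ ≤ (∑ τ ∈ W, ‖φhat τ‖
        * ‖inner ℂ (windowResidual n (2 * k₀) S (shift τ ε)) (restr n z)‖) ^ 2 := by
        gcongr
        refine (norm_sum_le _ _).trans_eq (Finset.sum_congr rfl fun τ _ => ?_)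
        rw [map_smul, inner_smul_right, norm_mul, norm_inner_window_sub_proj]
    _ ≤ (∑ τ ∈ W, ‖φhat τ‖ ^ 2)
        * ∑ τ ∈ W, ‖inner ℂ (windowResidual n (2 * k₀) S (shift τ ε)) (restr n z)‖ ^ 2 :=
        Finset.sum_mul_sq_le_sq_mul_sq _ _ _
    _ ≤ (2 * ρ) ^ 2 / ((n : ℝ) + 1)
        * (4 * (((n : ℝ) + 1) * (κ * σ) ^ 2) * (2 * L ^ 2)) := by
        gcongr
        exact h2.trans (by gcongr)
    _ = 32 * (ρ * (κ * σ * L)) ^ 2 := by field_simp; ring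
    _ ≤ _ := by nlinarith [sq_nonneg (ρ * (κ * σ * L))]

lemma sqrt_mul_log_union_le (hn2 : 2 ≤ n) (hα : 0 < α) (hα1 : α < 1) :
    Real.sqrt (8 * ((n : ℝ) + 1)) * Real.log (2 / (α / (64 * ((n : ℝ) + 1) ^ 2)))
      ≤ 3 * Real.sqrt ((n : ℝ) + 1) * (6 * Real.log (((n : ℝ) + n) / α)) := by
  have h8 : Real.sqrt (8 * ((n : ℝ) + 1)) ≤ 3 * Real.sqrt ((n : ℝ) + 1) := by
    rw [Real.sqrt_mul (by norm_num)]
    gcongr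
    rw [Real.sqrt_le_left (by norm_num)]
    norm_num
  have hl1 := one_le_log_add_div hn2 hα hα1
  calc _ ≤ Real.sqrt (8 * ((n : ℝ) + 1)) * (6 * Real.log (((n : ℝ) + n) / α)) := by
        gcongr
        exact log_union_le hn2 hα hα1
    _ ≤ _ := by gcongr

lemma norm_inner_window_conv_feasible_le (hn2 : 2 ≤ n) (hρ : 1 ≤ ρ) (hα : 0 < α) (hα1 : α < 1)
    {ψ : Signal} (hψ : ψ ∈ feasibleFilters n (2 * k₀) (2 * ρ))
    (hz : EstimatorNoiseBounds m n k₀ s ρ σ κ α x ε φ S z) :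
    ‖inner ℂ (window n (2 * k₀) z) (window n (2 * k₀) (conv ψ z))‖
      ≤ 80 * (ρ * Real.log (((n : ℝ) + n) / α)) := by
  have hmain := sqrt_mul_log_union_le hn2 hα hα1
  have hl1 := one_le_log_add_div hn2 hα hα1
  set l := Real.log (((n : ℝ) + n) / α)
  have hN0 : 0 < Real.sqrt ((n : ℝ) + 1) := Real.sqrt_pos.mpr (by positivity)
  refine (norm_inner_window_conv_le hψ _ z hz.atom_quadratic).trans ?_
  have h2 : Real.sqrt ((n : ℝ) + 1) ≤ Real.sqrt ((n : ℝ) + 1) * l :=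
    le_mul_of_one_le_right hN0.le hl1
  calc _ ≤ 2 * ρ / Real.sqrt ((n : ℝ) + 1)
        * (2 * (3 * Real.sqrt ((n : ℝ) + 1) * (6 * l) + 2 * (Real.sqrt ((n : ℝ) + 1) * l))) := by
        gcongr
    _ = 80 * (ρ * l) := by field_simp; norm_num

/-- The trace correction due to the projection gives 8ρ√s, which is at most 4ρ² + 4s. -/
lemma norm_inner_sub_proj_window_conv_le (hn2 : 2 ≤ n) (hρ : 1 ≤ ρ) (hα : 0 < α) (hα1 : α < 1)
    {ψ : Signal} (hψ : ψ ∈ feasibleFilters n (2 * k₀) (2 * ρ))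
    (hz : EstimatorNoiseBounds m n k₀ s ρ σ κ α x ε φ S z) :
    ‖inner ℂ (window n (2 * k₀) z
        - (windowSpace n (2 * k₀) S).starProjection (window n (2 * k₀) z))
        (window n (2 * k₀) (conv ψ z))‖
      ≤ 80 * (ρ * Real.log (((n : ℝ) + n) / α)) + 4 * ρ ^ 2 + 4 * s := by
  have hmain := sqrt_mul_log_union_le hn2 hα hα1
  have hl1 := one_le_log_add_div hn2 hα hα1
  set l := Real.log (((n : ℝ) + n) / α)
  have hN0 : 0 < Real.sqrt ((n : ℝ) + 1) := Real.sqrt_pos.mpr (by positivity)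
  have hs0 : (0 : ℝ) ≤ s := s.cast_nonneg
  refine (norm_inner_window_conv_le hψ _ z hz.atom_quadratic_sub).trans ?_
  have h2 : Real.sqrt ((n : ℝ) + 1) ≤ Real.sqrt ((n : ℝ) + 1) * l :=
    le_mul_of_one_le_right hN0.le hl1
  calc _ ≤ 2 * ρ / Real.sqrt ((n : ℝ) + 1)
        * (2 * (3 * Real.sqrt ((n : ℝ) + 1) * (6 * l) + 2 * (Real.sqrt ((n : ℝ) + 1) * l
          + Real.sqrt s * Real.sqrt ((n : ℝ) + 1)))) := by
        gcongr
    _ = 80 * (ρ * l) + 8 * ρ * Real.sqrt s := by field_simp; ring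
    _ ≤ _ := by nlinarith [sq_nonneg (ρ - Real.sqrt s), Real.sq_sqrt hs0]

lemma log_two_div_sixteenth_le_sq (hα : 0 < α) (hα1 : α < 1) :
    Real.log (2 / (α / 16)) ≤ 2 * Real.sqrt (Real.log (16 / α)) ^ 2 := by
  rw [Real.sq_sqrt]
  · exact log_two_div_sixteenth_le' hα hα1
  · rw [log_sixteen_div hα]
    linarith [Real.log_two_gt_d9, log_one_div_nonneg hα hα1]

/-- Only ε, φhat * ε and σ φhat * z survive the projection. Their bounds carry the constants 3, 6
and 80, and 9 = 3 + 6. -/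
lemma norm_inner_sub_proj_residual_le (hm : 1 ≤ m) (hn : n = 2 * m) (hσ : 0 < σ) (hρ : 1 ≤ ρ)
    (hk : k₀ ≤ m) (hκ : 0 ≤ κ) (hα : 0 < α) (hα1 : α < 1)
    (hS : ∀ τ : ℤ, ∀ u ∈ S, shift τ u ∈ S) (hxS : xS ∈ S) (hx : x = xS + ε)
    (hz : EstimatorNoiseBounds m n k₀ s ρ σ κ α x ε φ S z)
    (hfeas : φhat ∈ feasibleFilters n (2 * k₀) (2 * ρ)) :
    ‖inner ℂ (window n (2 * k₀) z
        - (windowSpace n (2 * k₀) S).starProjection (window n (2 * k₀) z))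
        (window n (2 * k₀) (x - conv φhat (observe x σ z)))‖
      ≤ σ * (9 * (ρ * (κ * Real.sqrt (Real.log (16 / α))))
        + (80 * (ρ * Real.log (((n : ℝ) + n) / α)) + 4 * ρ ^ 2 + 4 * s)) := by
  have hRp := norm_inner_sub_proj_window_conv_le (by omega) hρ hα hα1 hfeas hz
  have hK0 : 0 ≤ Real.sqrt (Real.log (16 / α)) := Real.sqrt_nonneg _
  have hK2 := log_two_div_sixteenth_le_sq hα hα1
  set K := Real.sqrt (Real.log (16 / α))
  have hκσ : 0 ≤ κ * σ := by positivity
  have hRφε := norm_inner_window_filtered_residual_le hn hρ hk hκσ hz hfeas hK0 hK2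
  have hRε : ‖inner ℂ (window n (2 * k₀) z
      - (windowSpace n (2 * k₀) S).starProjection (window n (2 * k₀) z)) (window n (2 * k₀) ε)‖
      ≤ 3 * (κ * σ * K) := by
    rw [norm_inner_window_sub_proj]
    refine le_of_sq_le_sq (hz.residual.trans ?_) (by positivity)
    calc _ ≤ 4 * (κ * σ) ^ 2 * (2 * K ^ 2) := by gcongr
      _ ≤ _ := by nlinarith [sq_nonneg (κ * σ * K)]
  -- Shift-invariance keeps φhat * xS in `S` whatever the random filter, so this component lies in
  -- the projected-out subspace.
  have hzero : inner ℂ (window n (2 * k₀) z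
      - (windowSpace n (2 * k₀) S).starProjection (window n (2 * k₀) z))
      (window n (2 * k₀) (xS - conv φhat xS)) = 0 := by
    have hmem : window n (2 * k₀) (xS - conv φhat xS) ∈ windowSpace n (2 * k₀) S :=
      Submodule.mem_map_of_mem (S.sub_mem hxS (conv_mem_of_shift_mem hfeas.1 hS hxS))
    rw [inner_sub_starProjection, Submodule.starProjection_eq_self_iff.mpr hmem, sub_self,
      inner_zero_right]
  set R := window n (2 * k₀) z
    - (windowSpace n (2 * k₀) S).starProjection (window n (2 * k₀) z)
  have hdec : window n (2 * k₀) (x - conv φhat (observe x σ z))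
      = window n (2 * k₀) (xS - conv φhat xS)
      + (window n (2 * k₀) ε - window n (2 * k₀) (conv φhat ε))
      - (σ : ℂ) • window n (2 * k₀) (conv φhat z) := by
    rw [sub_conv_observe_eq hfeas.1, ← map_sub, ← map_add, ← map_smul, ← map_sub]
    congr 2
    conv_lhs => rw [hx]
    rw [hfeas.1.conv_add]
    abel
  rw [hdec, inner_sub_right, inner_add_right, hzero, zero_add, inner_sub_right, inner_smul_right]
  have h1 := norm_sub_le (inner ℂ R (window n (2 * k₀) ε)
    - inner ℂ R (window n (2 * k₀) (conv φhat ε)))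
    ((σ : ℂ) * inner ℂ R (window n (2 * k₀) (conv φhat z)))
  have h2 := norm_sub_le (inner ℂ R (window n (2 * k₀) ε))
    (inner ℂ R (window n (2 * k₀) (conv φhat ε)))
  rw [norm_mul, Complex.norm_real, Real.norm_of_nonneg hσ.le] at h1
  have h3 := mul_le_mul_of_nonneg_left hRp hσ.le
  have h4 : κ * σ * K ≤ ρ * (κ * σ * K) := le_mul_of_one_le_left (by positivity) hρ
  linarith

/-- Bounds for the residual of the oracle filter. -/
lemma oracle_residual_le (hm : 1 ≤ m) (hn : n = 2 * m) (hσ : 0 < σ) (hρ : 1 ≤ ρ) (hk : k₀ ≤ m)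
    (hα : 0 < α) (hα1 : α < 1)
    (hφ : SupportedOn (-(k₀ : ℤ)) ((m : ℤ) - k₀) φ)
    (hE : 2 * ((m : ℝ) + 1) * ∑ τ ∈ Finset.Icc (-(k₀ : ℤ)) ((m : ℤ) - k₀), ‖φ τ‖ ^ 2 ≤ ρ)
    (hb : ∀ t : ℤ, -(m : ℤ) - k₀ ≤ t → t ≤ (n : ℤ) - k₀ →
        ((m : ℝ) + 1) * ‖(x - conv φ x) t‖ ^ 2 ≤ ρ * σ ^ 2)
    (hz : EstimatorNoiseBounds m n k₀ s ρ σ κ α x ε φ S z) :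
    ‖window n (2 * k₀) (x - conv (conv φ φ) (observe x σ z))‖ ^ 2
        ≤ σ ^ 2 * (16 * ρ ^ 2 + 128 * (ρ ^ 2 * (1 + Real.log (1 / α)))) ∧
      ‖inner ℂ (window n (2 * k₀) z)
          (window n (2 * k₀) (x - conv (conv φ φ) (observe x σ z)))‖
        ≤ σ * (12 * (ρ * (1 + Real.log (1 / α)))
          + 80 * (ρ * Real.log (((n : ℝ) + n) / α))) := by
  have hkn : 2 * k₀ ≤ n := by omega
  have hfeas := conv_self_mem_feasibleFilters hn (by linarith) hk hφ hE
  have hwp := norm_inner_window_conv_feasible_le (by omega) hρ hα hα1 hfeas hz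
  have hlog16 := log_two_div_sixteenth_le hα hα1
  have hlog0 : 0 ≤ Real.log (2 / (α / 16)) := by
    rw [log_two_div_sixteenth hα]
    linarith [Real.log_two_gt_d9, log_one_div_nonneg hα hα1]
  have hL1 : 1 ≤ 1 + Real.log (1 / α) := by linarith [log_one_div_nonneg hα hα1]
  set L := 1 + Real.log (1 / α)
  have hb2 := norm_window_bias_sq_le hn hσ hρ hk hφ hE hb
  have hbias := hz.bias
  have hin : inner ℂ (window n (2 * k₀) z) (window n (2 * k₀) (x - conv (conv φ φ) x))
      = inner ℂ (restr n z) (window n (2 * k₀) (x - conv (conv φ φ) x)) :=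
    inner_window_left z (window_apply_of_notMem _)
  have hp2 : ‖window n (2 * k₀) (conv (conv φ φ) z)‖ ^ 2 ≤ 64 * (ρ ^ 2 * L) := by
    rw [norm_window_sq hkn]
    have h1 := hz.family₁
    have h2 : ∀ t ∈ Finset.Icc (-((2 * k₀ : ℕ) : ℤ)) ((n : ℤ) - (2 * k₀ : ℕ)),
        ‖inner ℂ (convForm n (conv φ φ) t) (restr n z)‖ ^ 2 = ‖conv (conv φ φ) z t‖ ^ 2 := by
      intro t ht
      rw [Finset.mem_Icc] at ht
      rw [inner_convForm hfeas.1 z (by omega) (by omega)]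
    rw [Finset.sum_congr rfl h2] at h1
    refine h1.trans ?_
    calc _ ≤ 4 * (4 * ρ ^ 2) * (4 * L) := by gcongr
      _ = _ := by ring
  rw [sub_conv_observe_eq hfeas.1, map_sub, map_smul]
  set b := window n (2 * k₀) (x - conv (conv φ φ) x)
  set p := window n (2 * k₀) (conv (conv φ φ) z)
  have hσn : ‖(σ : ℂ)‖ = σ := by rw [Complex.norm_real, Real.norm_of_nonneg hσ.le]
  constructor
  · have h1 : ‖b - (σ : ℂ) • p‖ ≤ ‖b‖ + σ * ‖p‖ := by
      refine (norm_sub_le _ _).trans_eq ?_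
      rw [norm_smul, hσn]
    have h2 := pow_le_pow_left₀ (norm_nonneg _) h1 2
    have h3 := mul_le_mul_of_nonneg_left hp2 (sq_nonneg σ)
    nlinarith [sq_nonneg (‖b‖ - σ * ‖p‖)]
  -- The bias vector is deterministic, so this is a single Gaussian linear form.
  · have h1 : ‖inner ℂ (window n (2 * k₀) z) b‖ ≤ 12 * (σ * (ρ * L)) := by
      rw [hin, norm_inner_symm]
      refine le_of_sq_le_sq (hbias.trans ?_) (by positivity)
      calc _ ≤ 4 * (8 * ρ ^ 2 * σ ^ 2) * (4 * L) := by gcongr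
        _ = 128 * (σ * ρ) ^ 2 * L := by ring
        _ ≤ 128 * (σ * ρ) ^ 2 * L ^ 2 := by
            gcongr
            nlinarith
        _ ≤ _ := by nlinarith [sq_nonneg (σ * ρ * L)]
    rw [inner_sub_right, inner_smul_right]
    have h2 := norm_sub_le (inner ℂ (window n (2 * k₀) z) b)
      ((σ : ℂ) * inner ℂ (window n (2 * k₀) z) p)
    rw [norm_mul, hσn] at h2
    have h3 := mul_le_mul_of_nonneg_left hwp hσ.le
    linarith

/-- The `ℓ₂`-risk of the estimator. -/
lemma l2_risk_le (hm : 1 ≤ m) (hn : n = 2 * m) (hσ : 0 < σ) (hρ : 1 ≤ ρ) (hk : k₀ ≤ m)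
    (hκ : 0 ≤ κ) (hα : 0 < α) (hα1 : α < 1)
    (hφ : SupportedOn (-(k₀ : ℤ)) ((m : ℤ) - k₀) φ)
    (hE : 2 * ((m : ℝ) + 1) * ∑ τ ∈ Finset.Icc (-(k₀ : ℤ)) ((m : ℤ) - k₀), ‖φ τ‖ ^ 2 ≤ ρ)
    (hb : ∀ t : ℤ, -(m : ℤ) - k₀ ≤ t → t ≤ (n : ℤ) - k₀ →
        ((m : ℝ) + 1) * ‖(x - conv φ x) t‖ ^ 2 ≤ ρ * σ ^ 2)
    (hS : ∀ τ : ℤ, ∀ u ∈ S, shift τ u ∈ S) (hxS : xS ∈ S) (hx : x = xS + ε)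
    (hz : EstimatorNoiseBounds m n k₀ s ρ σ κ α x ε φ S z)
    (hLS : IsInterpolatingLS n (2 * k₀) (2 * ρ) (observe x σ z) φhat) :
    ‖window n (2 * k₀) (x - conv φhat (observe x σ z))‖ ^ 2
      ≤ 640 * (σ ^ 2 * (ρ ^ 2 * (1 + Real.log (1 / α))
        + (ρ * Real.log (((n : ℝ) + n) / α) + ρ * (κ * Real.sqrt (Real.log (16 / α))) + s))) := by
  have hkn : 2 * k₀ ≤ n := by omega
  have hfeas := conv_self_mem_feasibleFilters hn (by linarith) hk hφ hE
  obtain ⟨hd₀2, hwd₀⟩ := oracle_residual_le hm hn hσ hρ hk hα hα1 hφ hE hb hz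
  have hRd := norm_inner_sub_proj_residual_le hm hn hσ hρ hk hκ hα hα1 hS hxS hx hz hLS.1
  have hmin := hLS.2 _ hfeas
  rw [l2Norm_shift_eq hkn, l2Norm_shift_eq hkn, observe_sub_conv_eq, observe_sub_conv_eq,
    map_add, map_add, map_smul] at hmin
  have hproj := hz.projection.trans
    (mul_le_mul_of_nonneg_left (log_two_pow_div_sixteenth_le hα hα1 s) (by norm_num))
  have hl1 := one_le_log_add_div (n := n) (by omega) hα hα1
  exact quadratic_inequality_bound hσ hρ (by linarith [log_one_div_nonneg hα hα1])
    (by linarith) (by positivity) s.cast_nonneg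
    (norm_sq_le_of_norm_add_smul_sq_le (windowSpace n (2 * k₀) S) hσ hmin) hd₀2 hwd₀ hproj hRd

end Risk

/-! ### The pointwise risk -/

section Pointwise

variable {m n k₀ s : ℕ} {ρ σ κ α : ℝ} {x ε φ φhat z : Signal} {S : Submodule ℂ Signal}

/-- The error of a filter `ψ`, expanded with the help of another filter `φ`. -/
lemma sub_conv_observe_decomposition {a b c d : ℤ} {ψ : Signal} (hφ : SupportedOn a b φ)
    (hψ : SupportedOn c d ψ) :
    x - conv ψ (observe x σ z) = conv φ (x - conv ψ (observe x σ z))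
      + ((x - conv φ x) - conv ψ (x - conv φ x)) - (σ : ℂ) • conv ψ z
      + (σ : ℂ) • conv ψ (conv φ z) := by
  -- The error e equals φ * e + (1 - φ) * e, and in the second summand the two filters commute.
  rw [hψ.conv_observe, hφ.conv_sub, hφ.conv_add, hφ.conv_smul, hψ.conv_sub,
    hφ.conv_left_comm hψ, hφ.conv_left_comm hψ]
  abel

lemma norm_add_four_sq_le (a b c d : ℂ) :
    ‖a + b - c + d‖ ^ 2 ≤ 4 * (‖a‖ ^ 2 + ‖b‖ ^ 2 + ‖c‖ ^ 2 + ‖d‖ ^ 2) := by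
  have h1 : ‖a + b - c + d‖ ≤ ‖a‖ + ‖b‖ + ‖c‖ + ‖d‖ :=
    (norm_add_le _ _).trans (add_le_add_left ((norm_sub_le _ _).trans
      (add_le_add_left (norm_add_le _ _) _)) _)
  have h2 := pow_le_pow_left₀ (norm_nonneg _) h1 2
  nlinarith [sq_nonneg (‖a‖ - ‖b‖), sq_nonneg (‖a‖ - ‖c‖), sq_nonneg (‖a‖ - ‖d‖),
    sq_nonneg (‖b‖ - ‖c‖), sq_nonneg (‖b‖ - ‖d‖), sq_nonneg (‖c‖ - ‖d‖)]

lemma sum_norm_sq_le_div (hn : n = 2 * m)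
    (hE : 2 * ((m : ℝ) + 1) * ∑ τ ∈ Finset.Icc (-(k₀ : ℤ)) ((m : ℤ) - k₀), ‖φ τ‖ ^ 2 ≤ ρ) :
    ∑ τ ∈ Finset.Icc (-(k₀ : ℤ)) ((m : ℤ) - k₀), ‖φ τ‖ ^ 2 ≤ ρ / ((n : ℝ) + 1) := by
  have hE0 : 0 ≤ ∑ τ ∈ Finset.Icc (-(k₀ : ℤ)) ((m : ℤ) - k₀), ‖φ τ‖ ^ 2 :=
    Finset.sum_nonneg fun _ _ => by positivity
  rw [le_div_iff₀ (by positivity), hn]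
  push_cast
  linarith

/-- Cauchy-Schwarz over the inputs. The range of t is exactly where every input t - τ lies in the
window [-2k₀, n - 2k₀]. -/
lemma norm_conv_error_sq_le (hn : n = 2 * m)
    (hφ : SupportedOn (-(k₀ : ℤ)) ((m : ℤ) - k₀) φ)
    (hE : 2 * ((m : ℝ) + 1) * ∑ τ ∈ Finset.Icc (-(k₀ : ℤ)) ((m : ℤ) - k₀), ‖φ τ‖ ^ 2 ≤ ρ)
    (u : Signal) (hk : k₀ ≤ m) {t : ℤ} (h1 : (m : ℤ) - 3 * k₀ ≤ t) (h2 : t ≤ (n : ℤ) - 3 * k₀) :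
    ‖conv φ u t‖ ^ 2 ≤ ρ / ((n : ℝ) + 1) * ‖window n (2 * k₀) u‖ ^ 2 := by
  rw [norm_window_sq (by omega)]
  refine (hφ.norm_conv_sq_le u t
    (Finset.Icc (-((2 * k₀ : ℕ) : ℤ)) ((n : ℤ) - (2 * k₀ : ℕ))) (Finset.Icc_subset_Icc ?_ ?_)).trans ?_
  · push_cast
    omega
  · push_cast
    omega
  · gcongr
    exact sum_norm_sq_le_div hn hE

/-- The ℓ₁-norm of φhat is at most 2ρ, and the inputs t - τ stay in [-m - k₀, n - k₀], where the
oracle bias is controlled. -/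
lemma norm_filtered_bias_sq_le (hn : n = 2 * m) (hσ : 0 < σ) (hρ : 1 ≤ ρ) (hk : k₀ ≤ m)
    (hb : ∀ t : ℤ, -(m : ℤ) - k₀ ≤ t → t ≤ (n : ℤ) - k₀ →
        ((m : ℝ) + 1) * ‖(x - conv φ x) t‖ ^ 2 ≤ ρ * σ ^ 2)
    (hψ : φhat ∈ feasibleFilters n (2 * k₀) (2 * ρ))
    {t : ℤ} (h1 : (m : ℤ) - 3 * k₀ ≤ t) (h2 : t ≤ (n : ℤ) - 3 * k₀) :
    ‖((x - conv φ x) - conv φhat (x - conv φ x)) t‖ ^ 2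
      ≤ 18 * (σ ^ 2 * ρ / ((n : ℝ) + 1) * ρ ^ 2) := by
  have hm : (0 : ℝ) < (m : ℝ) + 1 := by positivity
  set u := x - conv φ x with hu
  set B := Real.sqrt (ρ * σ ^ 2 / ((m : ℝ) + 1)) with hB
  have hB2 : B ^ 2 = ρ * σ ^ 2 / ((m : ℝ) + 1) := Real.sq_sqrt (by positivity)
  have hB0 : 0 ≤ B := Real.sqrt_nonneg _
  have hub : ∀ t : ℤ, -(m : ℤ) - k₀ ≤ t → t ≤ (n : ℤ) - k₀ → ‖u t‖ ≤ B := by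
    intro t h1 h2
    refine Real.le_sqrt_of_sq_le ?_
    rw [le_div_iff₀ hm, mul_comm]
    exact hb t h1 h2
  have h3 : ‖conv φhat u t‖ ≤ 2 * ρ * B := by
    refine (hψ.1.norm_conv_le u t (B := B) fun τ hτ => ?_).trans
      (mul_le_mul_of_nonneg_right (feasible_sum_norm_le (by omega) (by linarith) hψ) hB0)
    rw [Finset.mem_Icc] at hτ
    exact hub _ (by omega) (by omega)
  have h4 : ‖(u - conv φhat u) t‖ ≤ 3 * ρ * B := by
    rw [Pi.sub_apply]
    have := hub t (by omega) (by omega)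
    refine (norm_sub_le _ _).trans ?_
    nlinarith
  have h5 := pow_le_pow_left₀ (norm_nonneg _) h4 2
  rw [mul_pow, hB2] at h5
  refine h5.trans ?_
  have h6 : ρ * σ ^ 2 / ((m : ℝ) + 1) ≤ 2 * (σ ^ 2 * ρ / ((n : ℝ) + 1)) := by
    rw [← mul_div_assoc, div_le_div_iff₀ hm (by positivity), hn]
    push_cast
    have : 0 ≤ σ ^ 2 * ρ := by positivity
    nlinarith
  calc _ ≤ (3 * ρ) ^ 2 * (2 * (σ ^ 2 * ρ / ((n : ℝ) + 1))) := by gcongr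
    _ = _ := by ring

lemma norm_conv_noise_sq_le (hn2 : 2 ≤ n) (hρ : 1 ≤ ρ) (hα : 0 < α) (hα1 : α < 1)
    (hz : EstimatorNoiseBounds m n k₀ s ρ σ κ α x ε φ S z)
    (hψ : φhat ∈ feasibleFilters n (2 * k₀) (2 * ρ))
    {t : ℤ} (h1 : (m : ℤ) - 3 * k₀ ≤ t) (h2 : t ≤ (n : ℤ) - 3 * k₀) :
    ‖conv φhat z t‖ ^ 2
      ≤ 96 * (ρ / ((n : ℝ) + 1) * (ρ * Real.log (((n : ℝ) + n) / α))) := by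
  have hl1 := one_le_log_add_div hn2 hα hα1
  have hlog := log_union_le hn2 hα hα1
  set l := Real.log (((n : ℝ) + n) / α)
  have h3 := norm_conv_le_of_atom hψ z t (Q := Real.sqrt (24 * l)) fun j hj => by
    refine Real.le_sqrt_of_sq_le ((hz.atom_linear t (Finset.mem_Icc.mpr ⟨h1, h2⟩) j hj).trans ?_)
    linarith
  have h4 := pow_le_pow_left₀ (norm_nonneg _) h3 2
  rw [mul_pow, div_pow, Real.sq_sqrt (by positivity), Real.sq_sqrt (by positivity)] at h4
  refine h4.trans (le_of_eq ?_)
  field_simp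
  norm_num

/-- Cauchy-Schwarz separates the random φhat from φ * z, whose energy over the 3m + 1 relevant times
is of order ρ(1 + ln(1/α)). This term yields ρ³/(n+1) in the final rate. -/
lemma norm_conv_conv_noise_sq_le (hn : n = 2 * m) (hρ : 1 ≤ ρ) (hα : 0 < α) (hα1 : α < 1)
    (hk : k₀ ≤ m) (hφ : SupportedOn (-(k₀ : ℤ)) ((m : ℤ) - k₀) φ)
    (hz : EstimatorNoiseBounds m n k₀ s ρ σ κ α x ε φ S z)
    (hψ : φhat ∈ feasibleFilters n (2 * k₀) (2 * ρ))
    {t : ℤ} (h1 : (m : ℤ) - 3 * k₀ ≤ t) (h2 : t ≤ (n : ℤ) - 3 * k₀) :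
    ‖conv φhat (conv φ z) t‖ ^ 2
      ≤ 96 * (ρ / ((n : ℝ) + 1) * (ρ ^ 2 * (1 + Real.log (1 / α)))) := by
  have hlog := log_two_div_sixteenth_le hα hα1
  have hL0 : 0 ≤ 1 + Real.log (1 / α) := by linarith [log_one_div_nonneg hα hα1]
  set L := 1 + Real.log (1 / α)
  have hN : (0 : ℝ) < (n : ℝ) + 1 := by positivity
  have h3 := hψ.1.norm_conv_sq_le (conv φ z) t (Finset.Icc (-(m : ℤ) - k₀) ((n : ℤ) - k₀))
    (Finset.Icc_subset_Icc (by push_cast; omega) (by push_cast; omega))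
  have h4 : ∑ u ∈ Finset.Icc (-(m : ℤ) - k₀) ((n : ℤ) - k₀), ‖conv φ z u‖ ^ 2
      ≤ 4 * (3 / 2 * ρ) * (4 * L) := by
    have h5 : ∀ u ∈ Finset.Icc (-(m : ℤ) - k₀) ((n : ℤ) - k₀),
        ‖inner ℂ (convForm n φ u) (restr n z)‖ ^ 2 = ‖conv φ z u‖ ^ 2 := by
      intro u hu
      rw [Finset.mem_Icc] at hu
      rw [inner_convForm hφ z (by omega) (by omega)]
    have h6 := hz.family₂
    rw [Finset.sum_congr rfl h5] at h6
    exact h6.trans (by gcongr)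
  have h5 : ∑ τ ∈ Finset.Icc (-((2 * k₀ : ℕ) : ℤ)) ((n : ℤ) - (2 * k₀ : ℕ)), ‖φhat τ‖ ^ 2
      ≤ (2 * ρ) ^ 2 / ((n : ℝ) + 1) := by
    rw [le_div_iff₀ hN, mul_comm]
    exact feasible_sum_norm_sq_le (by omega) hψ
  calc _ ≤ (2 * ρ) ^ 2 / ((n : ℝ) + 1) * (4 * (3 / 2 * ρ) * (4 * L)) := by
        refine h3.trans ?_
        gcongr
    _ = _ := by field_simp; ring

/-- The pointwise risk of the estimator, in terms of its `ℓ₂`-risk. -/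
lemma pointwise_risk_le (hm : 1 ≤ m) (hn : n = 2 * m) (hσ : 0 < σ) (hρ : 1 ≤ ρ) (hk : k₀ ≤ m)
    (hα : 0 < α) (hα1 : α < 1)
    (hφ : SupportedOn (-(k₀ : ℤ)) ((m : ℤ) - k₀) φ)
    (hE : 2 * ((m : ℝ) + 1) * ∑ τ ∈ Finset.Icc (-(k₀ : ℤ)) ((m : ℤ) - k₀), ‖φ τ‖ ^ 2 ≤ ρ)
    (hb : ∀ t : ℤ, -(m : ℤ) - k₀ ≤ t → t ≤ (n : ℤ) - k₀ →
        ((m : ℝ) + 1) * ‖(x - conv φ x) t‖ ^ 2 ≤ ρ * σ ^ 2)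
    (hz : EstimatorNoiseBounds m n k₀ s ρ σ κ α x ε φ S z)
    (hψ : φhat ∈ feasibleFilters n (2 * k₀) (2 * ρ)) {K : ℝ} (hK : 0 ≤ K)
    (hD : ‖window n (2 * k₀) (x - conv φhat (observe x σ z))‖ ^ 2
      ≤ 640 * (σ ^ 2 * (ρ ^ 2 * (1 + Real.log (1 / α))
        + (ρ * Real.log (((n : ℝ) + n) / α) + K + s))))
    {t : ℤ} (h1 : (m : ℤ) - 3 * k₀ ≤ t) (h2 : t ≤ (n : ℤ) - 3 * k₀) :
    ‖x t - conv φhat (observe x σ z) t‖ ^ 2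
      ≤ 4000 * (σ ^ 2 * ρ / ((n : ℝ) + 1) * (ρ ^ 2 * (1 + Real.log (1 / α))
        + (ρ * Real.log (((n : ℝ) + n) / α) + K + s))) := by
  have hdec := congrFun (sub_conv_observe_decomposition (x := x) (σ := σ) (z := z) hφ hψ.1) t
  have g1 := norm_conv_error_sq_le hn hφ hE (x - conv φhat (observe x σ z)) hk h1 h2
  have g2 := norm_filtered_bias_sq_le hn hσ hρ hk hb hψ h1 h2
  have g3 := norm_conv_noise_sq_le (by omega) hρ hα hα1 hz hψ h1 h2
  have g4 := norm_conv_conv_noise_sq_le hn hρ hα hα1 hk hφ hz hψ h1 h2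
  have hl1 := one_le_log_add_div (n := n) (by omega) hα hα1
  have hL1 : 1 ≤ 1 + Real.log (1 / α) := by linarith [log_one_div_nonneg hα hα1]
  have hs0 : (0 : ℝ) ≤ s := s.cast_nonneg
  set l := Real.log (((n : ℝ) + n) / α)
  set L := 1 + Real.log (1 / α)
  set c := σ ^ 2 * ρ / ((n : ℝ) + 1) with hc
  have hc0 : 0 ≤ c := by positivity
  have hcσ : ρ / ((n : ℝ) + 1) * σ ^ 2 = c := by rw [hc]; ring
  set X := ρ ^ 2 * L + (ρ * l + K + s)
  have hX1 : ρ ^ 2 ≤ ρ ^ 2 * L := le_mul_of_one_le_right (by positivity) hL1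
  have hX2 : 0 ≤ ρ * l := by positivity
  have hX3 : 0 ≤ ρ ^ 2 * L := by positivity
  have g1' : ‖conv φ (x - conv φhat (observe x σ z)) t‖ ^ 2 ≤ 640 * (c * X) := by
    refine g1.trans ?_
    calc _ ≤ ρ / ((n : ℝ) + 1) * (640 * (σ ^ 2 * X)) := by gcongr
      _ = 640 * ((ρ / ((n : ℝ) + 1) * σ ^ 2) * X) := by ring
      _ = _ := by rw [hcσ]
  have g2' : ‖((x - conv φ x) - conv φhat (x - conv φ x)) t‖ ^ 2 ≤ 18 * (c * X) := by
    refine g2.trans ?_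
    gcongr
    linarith
  have hσn : ∀ u : ℂ, ‖(σ : ℂ) * u‖ ^ 2 = σ ^ 2 * ‖u‖ ^ 2 := by
    intro u
    rw [norm_mul, mul_pow, Complex.norm_real, Real.norm_eq_abs, sq_abs]
  have g3' : ‖(σ : ℂ) * conv φhat z t‖ ^ 2 ≤ 96 * (c * X) := by
    rw [hσn]
    calc _ ≤ σ ^ 2 * (96 * (ρ / ((n : ℝ) + 1) * (ρ * l))) := by gcongr
      _ = 96 * ((ρ / ((n : ℝ) + 1) * σ ^ 2) * (ρ * l)) := by ring
      _ ≤ 96 * (c * X) := by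
          rw [hcσ]
          gcongr
          linarith
  have g4' : ‖(σ : ℂ) * conv φhat (conv φ z) t‖ ^ 2 ≤ 96 * (c * X) := by
    rw [hσn]
    calc _ ≤ σ ^ 2 * (96 * (ρ / ((n : ℝ) + 1) * (ρ ^ 2 * L))) := by gcongr
      _ = 96 * ((ρ / ((n : ℝ) + 1) * σ ^ 2) * (ρ ^ 2 * L)) := by ring
      _ ≤ 96 * (c * X) := by
          rw [hcσ]
          gcongr
          linarith
  have hcX : 0 ≤ c * X := mul_nonneg hc0 (by linarith)
  have h5 : x t - conv φhat (observe x σ z) t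
      = conv φ (x - conv φhat (observe x σ z)) t
        + ((x - conv φ x) - conv φhat (x - conv φ x)) t - (σ : ℂ) * conv φhat z t
        + (σ : ℂ) * conv φhat (conv φ z) t := hdec
  rw [h5]
  -- The total constant is 4(640 + 18 + 96 + 96) = 3400.
  refine (norm_add_four_sq_le _ _ _ _).trans ?_
  linarith

lemma remainder_self (n s : ℕ) (ρ κ α : ℝ) :
    remainder n n ρ s κ α
      = ρ * Real.log (((n : ℝ) + n) / α) + ρ * (κ * Real.sqrt (Real.log (16 / α))) + s := by
  rw [remainder, div_self (by positivity), mul_one, mul_assoc ρ κ]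

end Pointwise

end SignalDenoising

/-! ### Assembly of the two bounds -/

theorem mainTheorem10 :
    ∃ C : ℝ, 0 < C ∧
      ∀ {Ω : Type*} [MeasurableSpace Ω] (P : MeasureTheory.Measure Ω)
        [MeasureTheory.IsProbabilityMeasure P] (ζ : ℤ → Ω → ℂ)
        (_ : SignalDenoising.IsStdComplexNoise P ζ)
        (σ : ℝ) (_ : 0 < σ) (m n k₀ s : ℕ) (ρ κ : ℝ) (x : SignalDenoising.Signal)
        (_ : 1 ≤ m) (_ : n = 2 * m)
        (_ : SignalDenoising.Interpolable P ζ σ m n k₀ ρ x)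
        (_ : SignalDenoising.NearShiftInvariant n n σ s κ x)
        (α : ℝ) (_ : 0 < α) (_ : α < 1),
        ∃ Ξ : Set SignalDenoising.Signal, MeasurableSet Ξ ∧
          ENNReal.ofReal (1 - α) ≤ P {ω | (fun t => ζ t ω) ∈ Ξ} ∧
          ∀ z ∈ Ξ, ∀ φhat : SignalDenoising.Signal,
            SignalDenoising.IsInterpolatingLS n (2 * k₀) (2 * ρ)
              (SignalDenoising.observe x σ z) φhat →
            SignalDenoising.l2Norm n (SignalDenoising.shift ((2 * k₀ : ℕ) : ℤ)
                (x - SignalDenoising.conv φhat (SignalDenoising.observe x σ z))) ^ 2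
              ≤ C * (σ ^ 2 * (ρ ^ 2 * (1 + Real.log (1 / α))
                  + SignalDenoising.remainder n n ρ s κ α)) ∧
            ∀ t : ℤ, (m : ℤ) - 3 * k₀ ≤ t → t ≤ (n : ℤ) - 3 * k₀ →
              ‖x t - SignalDenoising.conv φhat (SignalDenoising.observe x σ z) t‖ ^ 2
                ≤ C * (σ ^ 2 * ρ / ((n : ℝ) + 1) * (ρ ^ 2 * (1 + Real.log (1 / α))
                    + SignalDenoising.remainder n n ρ s κ α)) := by
  -- This constant dominates 640 for the ℓ₂-risk and 3400 for the pointwise risk.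
  refine ⟨4000, by norm_num, ?_⟩
  intro Ω _ P _ ζ hζ σ hσ m n k₀ s ρ κ x hm hn hint hS α hα hα1
  have hρ := hint.1
  have hk := hint.2.1
  obtain ⟨φ, hφ, hE, hb⟩ := hint.exists_filter hζ hσ hn
  obtain ⟨hs1, -, hκ, S, hS1, hSs, xS, ε, hxS, hx, hε⟩ := hS
  -- `Module.finrank` is 0 on infinite-dimensional spaces, so s ≥ 1 is what makes `S` genuinely
  -- finite-dimensional.
  have hfin : FiniteDimensional ℂ S := Module.finite_of_finrank_pos (by omega)
  have hSτ := SignalDenoising.shift_mem_of_shift_one_mem hS1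
  obtain ⟨Ξ, hΞm, hΞP, hΞ⟩ := SignalDenoising.exists_estimatorNoiseBounds (x := x) hζ hn hρ hk
    hSs hφ hE hε hα
  refine ⟨Ξ, hΞm, hΞP, fun z hz φhat hLS => ?_⟩
  have hzb := hΞ z hz
  have hD := SignalDenoising.l2_risk_le hm hn hσ hρ hk hκ hα hα1 hφ hE hb hSτ hxS hx hzb hLS
  have hK : 0 ≤ ρ * (κ * Real.sqrt (Real.log (16 / α))) := by positivity
  rw [SignalDenoising.remainder_self]
  refine ⟨?_, fun t h1 h2 => ?_⟩
  · rw [SignalDenoising.l2Norm_shift_eq (by omega)]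
    refine hD.trans (mul_le_mul_of_nonneg_right (by norm_num) ?_)
    have := SignalDenoising.log_one_div_nonneg hα hα1
    have := SignalDenoising.one_le_log_add_div (n := n) (by omega) hα hα1
    positivity
  · exact SignalDenoising.pointwise_risk_le hm hn hσ hρ hk hα hα1 hφ hE hb hzb hLS.1 hK hD h1 h2
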